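/- **Setting.** Let $\mathcal G(V\cup U)$ be a finite DAG with observed vertices $V$ and latent vertices $U$. A causal model (NPSEM-IE) with graph $\mathcal G$ consists of measurable structural equations $V_k=f_k(\mathrm{pa}(V_k),\epsilon_k)$, $k\in V\cup U$, with jointly independent errors. For $T\subseteq V$ and a value $t$, the potential outcomes $V_k(t)$ solve the system in which the equations of the variables in $T$ are replaced by the constants $t$. The kernel $p(A\,\|\,t)$ is the law of $A(t)$, and $p(a\mid c\,\|\,t)$ denotes conditional densities under $\mathrm{do}(T=t)$. State spaces are standard Borel with $\sigma$-finite dominating measures $\mu_k$ (e.g. counting or Lebesgue measure), and sums denote integrals against these measures. Let $R,S\subseteq V$ be disjoint, $B\in R$, and $W,Z\subseteq R$ with $W$, $Z$, $\{B\}$ pairwise disjoint. Assume that for each $s$ all variables of $(V\cup U)\setminus S$ have a joint density under $\mathrm{do}(S=s)$ with respect to the product of the $\mu_k$. For $A\subseteq V$, the CADMG $\mathcal G(A,S)$ has a directed edge $a\to c$ ($a,c\in A\cup S$) iff $c\notin S$ and $\mathcal G$ has a directed path from $a$ to $c$ with all intermediate vertices outside $A\cup S$. (Its bidirected edges play no role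 here.) Let $\mathrm{de}(B)$ be the set of descendants of $B$, including $B$, in $\mathcal G(R\setminus Z,S)$, and put $$O=\mathrm{de}(B)\setminus(W\cup\{B\}),\quad W^*=\mathrm{de}(B)\cap W,\quad \tilde W=W\setminus W^*,\quad X=R\setminus(O\cup\{B\}\cup Z\cup W).$$ Then $R\setminus(Z\cup W^*\cup\{B\})=O\cup\tilde W\cup X$. **Conditions.** For some $U^*\subseteq U$, and for all $s\in\mathcal X_S$: 1. $O(s,b)\perp\!\!\!\perp B(s)\mid U^*(s),\tilde W(s),X(s)$ for all $b\in\mathcal X_B$. 2. $W(s)\perp\!\!\!\perp (Z(s),B(s))\mid U^*(s),X(s)$. 3. $O(s)\perp\!\!\!\perp Z(s)\mid \tilde W(s),B(s),U^*(s),X(s)$. 4. (Completeness) For almost all $(b,x)$ under the law of $(B(s),X(s))$ and all $g\in L^2(P_{U^*(s)})$: $\sum_{u}g(u)\,p(u\mid b,w,x\,\|\,s)$ converges absolutely and equals $0$ for $P_{W(s)}$-almost all $w$ if and only if $g(U^*(s))=0$ almost surely. 5. (Positivity) $p(b\mid w,x\,\|\,s)>0$ for $\mu_B$-almost all $b$ and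 almost all $(w,x)$ under the law of $(W(s),X(s))$. **Bridge function.** For all $s$, let $q^{(s)}(z,b,x)$ be a measurable treatment bridge function: for almost all $(w,b,x)$ under the law of $(W(s),B(s),X(s))$, $$\sum_z q^{(s)}(z,b,x)\,p(z\mid w,b,x\,\|\,s)=\frac1{p(b\mid w,x\,\|\,s)} .$$ It is assumed sufficiently integrable: for almost all $(b,x)$ under the law of $(B(s),X(s))$, $\sum_z|q^{(s)}(z,b,x)|\,p(z\mid b,x\,\|\,s)<\infty$, and $u\mapsto \frac1{p(b\mid u,x\,\|\,s)}-\sum_z q^{(s)}(z,b,x)\,p(z\mid b,u,x\,\|\,s)$ lies in $L^2(P_{U^*(s)})$. **Proposition (validity of the treatment bridge kernel operation).** (i) For all $s$ and $\mu_B$-almost all $b$, the output kernel $p(R\setminus(Z\cup W^*\cup\{B\})\,\|\,s,b)$ has a density with respect to the product of the dominating measures, given for almost all $(o,\tilde w,x)$ by the absolutely convergent sum $$p(o,\tilde w,x\,\|\,s,b)=\sum_z q^{(s)}(z,b,x)\,p(o,\tilde w,z,b,x\,\|\,s).$$ (ii) Consequently the output kernel is identified from the input kernel. Take any other causal model with the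 same graph and the same observed state spaces (its latent state spaces, its errors and its set $U^*$ may differ) that has joint densities, satisfies conditions 1-5, has the same input kernel $p(R\,\|\,s)$ for all $s$, and for which the second (square) integrability requirement on $q^{(s)}$ holds. Then for all $s$ and $\mu_B$-almost all $b$ it has the same output kernel $p(R\setminus(Z\cup W^*\cup\{B\})\,\|\,s,b)$. -/

import Mathlib

open MeasureTheory ProbabilityTheory

universe u

namespace ProximalID

/-! Hidden variable DAGs, latent projections and CADMGs. -/

/-- A directed acyclic graph with observed vertices `ν` and latent vertices `υ`. -/
structure HiddenDAG (ν υ : Type*) where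
  Edge : ν ⊕ υ → ν ⊕ υ → Prop
  acyclic : ∀ k, ¬ Relation.TransGen Edge k k

namespace HiddenDAG

variable {ν υ : Type*} (G : HiddenDAG ν υ)

/-- The parents of a vertex. -/
def pa (k : ν ⊕ υ) : Set (ν ⊕ υ) := {j | G.Edge j k}

theorem wf [Finite ν] [Finite υ] : WellFounded G.Edge := by
  have : Std.Irrefl (Relation.TransGen G.Edge) := ⟨G.acyclic⟩
  have h : WellFounded (Relation.TransGen G.Edge) := Finite.wellFounded_of_trans_of_irrefl _
  exact Subrelation.wf (fun h => Relation.TransGen.single h) h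

/-- Directed edges of the latent projection of `G` onto the observed vertex set `A`: there is a
directed path in `G` from `a` to `c` all of whose non-endpoint vertices lie outside `A`. -/
def ProjEdge (A : Finset ν) (a c : ν) : Prop :=
  a ∈ A ∧ c ∈ A ∧ ∃ k : ν ⊕ υ,
    Relation.ReflTransGen (fun x y => G.Edge x y ∧ ∀ i ∈ A, y ≠ Sum.inl i) (Sum.inl a) k ∧
      G.Edge k (Sum.inl c)

/-- Directed edges of the CADMG `𝒢(R, S)`: project onto `R ∪ S`, then delete every edge that
points into `S`. -/
def CADMGEdge [DecidableEq ν] (R S : Finset ν) (a c : ν) : Prop :=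
  G.ProjEdge (R ∪ S) a c ∧ c ∉ S

open Classical in
/-- The descendants of `b` (including `b` itself) in the CADMG `𝒢(R, S)`. -/
noncomputable def de [Fintype ν] (R S : Finset ν) (b : ν) : Finset ν :=
  Finset.univ.filter fun c => Relation.ReflTransGen (G.CADMGEdge R S) b c

end HiddenDAG

/-! Structural equation models with independent errors. -/

section Model

variable {ν υ : Type*}

/-- The state spaces of all vertices, observed and latent. -/
def State (𝒳 : ν → Type u) (𝒰 : υ → Type u) : ν ⊕ υ → Type u := Sum.elim 𝒳 𝒰

instance State.measurableSpace (𝒳 : ν → Type u) (𝒰 : υ → Type u) [∀ i, MeasurableSpace (𝒳 i)]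
    [∀ j, MeasurableSpace (𝒰 j)] : ∀ k, MeasurableSpace (State 𝒳 𝒰 k)
  | Sum.inl i => inferInstanceAs (MeasurableSpace (𝒳 i))
  | Sum.inr j => inferInstanceAs (MeasurableSpace (𝒰 j))

/-- An NPSEM-IE with causal graph `G`: structural equations `f k` that read the values of the
parents of `k` and an error `ε k`, the errors being jointly independent. -/
structure NPSEM (G : HiddenDAG ν υ) (𝒳 : ν → Type u) (𝒰 : υ → Type u)
    [∀ i, MeasurableSpace (𝒳 i)] [∀ j, MeasurableSpace (𝒰 j)]
    (Ω : Type*) [MeasurableSpace Ω] where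
  /-- the probability measure on the sample space -/
  P : Measure Ω
  isProb : IsProbabilityMeasure P
  /-- the state spaces of the errors -/
  E : ν ⊕ υ → Type u
  measE : ∀ k, MeasurableSpace (E k)
  /-- the errors -/
  ε : ∀ k, Ω → E k
  measurable_ε : ∀ k, Measurable (ε k)
  indep_ε : iIndepFun ε P
  /-- the structural equations -/
  f : ∀ k, (∀ j : G.pa k, State 𝒳 𝒰 j) → E k → State 𝒳 𝒰 k
  measurable_f : ∀ k, Measurable fun p : (∀ j : G.pa k, State 𝒳 𝒰 j) × E k => f k p.1 p.2

namespace NPSEM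

variable [Finite ν] [Finite υ] [DecidableEq ν] {G : HiddenDAG ν υ}
  {𝒳 : ν → Type u} {𝒰 : υ → Type u}
  [∀ i, MeasurableSpace (𝒳 i)] [∀ j, MeasurableSpace (𝒰 j)]
  {Ω : Type*} [MeasurableSpace Ω] (M : NPSEM G 𝒳 𝒰 Ω)

/-- The solution of the structural equations after `do(T = t)`: the equations of the vertices in
`T` are replaced by the constants `t i`. Of `t` only the coordinates in `T` are used. -/
noncomputable def potential (T : Finset ν) (t : ∀ i, 𝒳 i) (ω : Ω) :
    ∀ k, State 𝒳 𝒰 k :=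
  G.wf.fix fun k rec =>
    match k, rec with
    | Sum.inl i, rec =>
        if i ∈ T then t i else M.f (Sum.inl i) (fun j => rec j j.2) (M.ε (Sum.inl i) ω)
    | Sum.inr j, rec => M.f (Sum.inr j) (fun l => rec l l.2) (M.ε (Sum.inr j) ω)

theorem potential_inl (T : Finset ν) (t : ∀ i, 𝒳 i) (ω : Ω) (i : ν) :
    M.potential T t ω (Sum.inl i) =
      if i ∈ T then t i else
        M.f (Sum.inl i) (fun j => M.potential T t ω j) (M.ε (Sum.inl i) ω) := by
  unfold potential
  rw [WellFounded.fix_eq]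
  rfl

theorem potential_inr (T : Finset ν) (t : ∀ i, 𝒳 i) (ω : Ω) (j : υ) :
    M.potential T t ω (Sum.inr j) =
      M.f (Sum.inr j) (fun l => M.potential T t ω l) (M.ε (Sum.inr j) ω) := by
  unfold potential
  rw [WellFounded.fix_eq]

/-- The potential outcome `i(t)` of an observed variable `i` under `do(T = t)`. -/
noncomputable def var (T : Finset ν) (t : ∀ i, 𝒳 i) (i : ν) (ω : Ω) : 𝒳 i :=
  M.potential T t ω (Sum.inl i)

/-- The random vector `A(t)` of observed variables under `do(T = t)`. -/
noncomputable def obs (T : Finset ν) (t : ∀ i, 𝒳 i) (A : Finset ν) (ω : Ω) : ∀ i : A, 𝒳 i :=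
  fun i => M.var T t i ω

/-- The random vector `C(t)` of latent variables under `do(T = t)`. -/
noncomputable def lat (T : Finset ν) (t : ∀ i, 𝒳 i) (C : Finset υ) (ω : Ω) : ∀ j : C, 𝒰 j :=
  fun j => M.potential T t ω (Sum.inr j)

/-- The kernel `p(A || T)` at `t`: the law of `A(t)` under `do(T = t)`. -/
noncomputable def kernel (A T : Finset ν) (t : ∀ i, 𝒳 i) : Measure (∀ i : A, 𝒳 i) :=
  M.P.map (M.obs T t A)

end NPSEM

end Model

/-! Densities and conditional independence of random elements. -/

section Densities

variable {Ω α β γ : Type*} [MeasurableSpace Ω] [MeasurableSpace α] [MeasurableSpace β]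
  [MeasurableSpace γ]

/-- The product over `A` of the dominating measures. -/
noncomputable def ref {κ : Type*} {𝒴 : κ → Type*} [∀ k, MeasurableSpace (𝒴 k)]
    (μ : ∀ k, Measure (𝒴 k)) (A : Finset κ) : Measure (∀ k : A, 𝒴 k) :=
  Measure.pi fun k : A => μ k

/-- The density `p(y)` of `Y` with respect to the dominating measure `ρ`. -/
noncomputable def density (P : Measure Ω) (ρ : Measure α) (Y : Ω → α) (y : α) : ℝ :=
  ((P.map Y).rnDeriv ρ y).toReal

/-- The conditional density `p(y | c) = p(y, c) / p(c)` of `Y` given `C = c`, with respect to the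
dominating measures `ρ` for `Y` and `τ` for `C`. -/
noncomputable def condDensity (P : Measure Ω) (ρ : Measure α) (τ : Measure γ)
    (Y : Ω → α) (C : Ω → γ) (y : α) (c : γ) : ℝ :=
  density P (ρ.prod τ) (fun ω => (Y ω, C ω)) (y, c) / density P τ C c

/-- Conditional independence of `Y` and `Y'` given `C`. -/
def CondIndepRV (P : Measure Ω) (Y : Ω → α) (Y' : Ω → β) (C : Ω → γ) : Prop :=
  ∀ D : Set α, MeasurableSet D → ∀ D' : Set β, MeasurableSet D' →
    P[(Y ⁻¹' D ∩ Y' ⁻¹' D').indicator (fun _ => (1 : ℝ)) | MeasurableSpace.comap C inferInstance]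
      =ᵐ[P] fun ω =>
        (P[(Y ⁻¹' D).indicator (fun _ => (1 : ℝ)) | MeasurableSpace.comap C inferInstance]) ω *
        (P[(Y' ⁻¹' D').indicator (fun _ => (1 : ℝ)) | MeasurableSpace.comap C inferInstance]) ω

end Densities

/-! The kernel operation. -/

/-- The sets on which the treatment bridge operation acts: input kernel `p(R || S)`, treatment
`B ∈ R`, outcome-inducing proxies `W ⊆ R` and treatment-inducing proxies `Z ⊆ R`. -/
structure TbfInput (ν : Type*) where
  R : Finset ν
  S : Finset ν
  W : Finset ν
  Z : Finset ν
  B : ν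
  disjoint_RS : Disjoint R S
  B_mem : B ∈ R
  W_subset : W ⊆ R
  Z_subset : Z ⊆ R
  B_notMem_W : B ∉ W
  B_notMem_Z : B ∉ Z
  disjoint_WZ : Disjoint W Z

namespace TbfInput

variable {ν υ : Type*} [Fintype ν] [DecidableEq ν] (D : TbfInput ν) (G : HiddenDAG ν υ)

/-- The outcome variables `O = de(B) \ (W ∪ {B})`, descendants being taken in `𝒢(R \ Z, S)`. -/
noncomputable def O : Finset ν := G.de (D.R \ D.Z) D.S D.B \ (D.W ∪ {D.B})

/-- The part `W* = de(B) ∩ W` of `W` that is causally affected by `B`. -/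
noncomputable def Wstar : Finset ν := G.de (D.R \ D.Z) D.S D.B ∩ D.W

/-- The part `W \ W*` of `W` that is not affected by `B`. -/
noncomputable def Wrest : Finset ν := D.W \ D.Wstar G

/-- The covariates `X = R \ (O ∪ {B} ∪ Z ∪ W)`. -/
noncomputable def X : Finset ν := D.R \ (D.O G ∪ {D.B} ∪ D.Z ∪ D.W)

/-- The random variables `R \ (Z ∪ W* ∪ {B})` of the output kernel. -/
noncomputable def out : Finset ν := D.R \ (D.Z ∪ D.Wstar G ∪ {D.B})

theorem X_subset_out : D.X G ⊆ D.out G := by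
  intro i hi
  simp only [X, out, Wstar, Finset.mem_sdiff, Finset.mem_union, Finset.mem_inter,
    Finset.mem_singleton, not_or, not_and] at hi ⊢
  tauto

/-- The `X`-part of a value of the output variables. -/
def xPart {G : HiddenDAG ν υ} {𝒳 : ν → Type u} (r : ∀ i : D.out G, 𝒳 i) : ∀ i : D.X G, 𝒳 i :=
  fun i => r ⟨i, D.X_subset_out G i.2⟩

/-- The outcome variables, the unaffected proxies and the covariates make up the output. -/
theorem out_eq : D.out G = D.O G ∪ D.Wrest G ∪ D.X G := by
  have hde : ∀ i ∈ G.de (D.R \ D.Z) D.S D.B, i ∈ D.R ∧ i ∉ D.Z := by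
    intro i hi
    simp only [HiddenDAG.de, Finset.mem_filter, Finset.mem_univ, true_and] at hi
    cases hi with
    | refl => exact ⟨D.B_mem, D.B_notMem_Z⟩
    | tail _ h =>
      obtain ⟨⟨_, h, _⟩, h'⟩ := h
      simpa [h'] using h
  ext i
  have h1 := hde i
  have h2 := @D.W_subset i
  have h3 : i ∈ D.W → i ∉ D.Z := fun h => Finset.disjoint_left.1 D.disjoint_WZ h
  have h4 : i ∈ D.W → i ≠ D.B := fun h h' => D.B_notMem_W (h' ▸ h)
  simp only [X, O, out, Wstar, Wrest, Finset.mem_sdiff, Finset.mem_union, Finset.mem_inter,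
    Finset.mem_singleton, not_or, not_and]
  tauto

end TbfInput

section Conditions

variable {ν υ : Type*} [Fintype ν] [DecidableEq ν] [Fintype υ] {G : HiddenDAG ν υ}
  (D : TbfInput ν)
  {𝒳 : ν → Type u} {𝒰 : υ → Type u}
  [∀ i, MeasurableSpace (𝒳 i)] [∀ j, MeasurableSpace (𝒰 j)]
  {Ω : Type*} [MeasurableSpace Ω]
  (μ : ∀ i, Measure (𝒳 i)) (η : ∀ j, Measure (𝒰 j))
  (M : NPSEM G 𝒳 𝒰 Ω) (Us : Finset υ)

/-- All non-intervened variables, observed and latent, have a joint density under `do(T = t)`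
with respect to the product of the dominating measures. -/
def HasJointDensity (T : Finset ν) (t : ∀ i, 𝒳 i) : Prop :=
  M.P.map (fun ω => (M.obs T t Tᶜ ω, M.lat T t Finset.univ ω)) ≪
    (ref μ Tᶜ).prod (ref η Finset.univ)

/-- `O(s,b) ⫫ B(s) | U*(s), (W \ W*)(s), X(s)` for all `s`, `b`. -/
def LatentIgnorability : Prop :=
  ∀ (s : ∀ i, 𝒳 i) (b : 𝒳 D.B),
    CondIndepRV M.P (M.obs (insert D.B D.S) (Function.update s D.B b) (D.O G)) (M.var D.S s D.B)
      fun ω => (M.lat D.S s Us ω, M.obs D.S s (D.Wrest G) ω, M.obs D.S s (D.X G) ω)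

/-- `W(s) ⫫ (Z(s), B(s)) | U*(s), X(s)` for all `s`. -/
def ValidOutcomeProxy : Prop :=
  ∀ s : ∀ i, 𝒳 i,
    CondIndepRV M.P (M.obs D.S s D.W) (fun ω => (M.obs D.S s D.Z ω, M.var D.S s D.B ω))
      fun ω => (M.lat D.S s Us ω, M.obs D.S s (D.X G) ω)

/-- `O(s) ⫫ Z(s) | (W \ W*)(s), B(s), U*(s), X(s)` for all `s`. -/
def ValidTreatmentProxy : Prop :=
  ∀ s : ∀ i, 𝒳 i,
    CondIndepRV M.P (M.obs D.S s (D.O G)) (M.obs D.S s D.Z)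
      fun ω => (M.obs D.S s (D.Wrest G) ω, M.var D.S s D.B ω, M.lat D.S s Us ω,
        M.obs D.S s (D.X G) ω)

/-- Completeness of `W` for `U*`: for all `s`, all `b`, `x` (up to null sets) and `g ∈ L²(U*(s))`,
`∑_{u} g(u) p(u | b, w, x || s) = 0` for almost all `w` if and only if `g(U*(s)) = 0` a.s. -/
def TreatmentCompleteness : Prop :=
  ∀ s : ∀ i, 𝒳 i,
    ∀ᵐ c ∂ M.P.map (fun ω => (M.var D.S s D.B ω, M.obs D.S s (D.X G) ω)),
      ∀ g : (∀ j : Us, 𝒰 j) → ℝ, MemLp g 2 (M.P.map (M.lat D.S s Us)) →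
        let F := fun (w : ∀ i : D.W, 𝒳 i) (u : ∀ j : Us, 𝒰 j) =>
          g u * condDensity M.P (ref η Us) ((μ D.B).prod ((ref μ D.W).prod (ref μ (D.X G))))
            (M.lat D.S s Us)
            (fun ω => (M.var D.S s D.B ω, M.obs D.S s D.W ω, M.obs D.S s (D.X G) ω))
            u (c.1, w, c.2)
        ((∀ᵐ w ∂ M.P.map (M.obs D.S s D.W),
            Integrable (F w) (ref η Us) ∧ ∫ u, F w u ∂ ref η Us = 0) ↔
          ∀ᵐ u ∂ M.P.map (M.lat D.S s Us), g u = 0)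

/-- `p(b | w, x || s) > 0` for all `s`, and all `b`, `w`, `x` up to null sets. -/
def ProxyPositivity : Prop :=
  ∀ s : ∀ i, 𝒳 i, ∀ᵐ b ∂ μ D.B,
    ∀ᵐ c ∂ M.P.map (fun ω => (M.obs D.S s D.W ω, M.obs D.S s (D.X G) ω)),
      0 < condDensity M.P (μ D.B) ((ref μ D.W).prod (ref μ (D.X G))) (M.var D.S s D.B)
        (fun ω => (M.obs D.S s D.W ω, M.obs D.S s (D.X G) ω)) b c

/-- The conditions of the treatment bridge operation on the causal model and on the latent
confounders `U*`, apart from the bridge function. -/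
structure TbfConditions : Prop where
  ignorability : LatentIgnorability D M Us
  outcomeProxy : ValidOutcomeProxy D M Us
  treatmentProxy : ValidTreatmentProxy D M Us
  completeness : TreatmentCompleteness D μ η M Us
  positivity : ProxyPositivity D μ M

/-- `q s` is a treatment bridge function for every `s`: it is measurable and
`∑_z q(z, b, x) p(z | w, b, x || s) = 1 / p(b | w, x || s)` for almost all `w`, `b`, `x`, where
`q(·, b, x)` is integrable with respect to `p(z | b, x || s)`, for almost all `b`, `x`. -/
structure IsTreatmentBridge
    (q : (∀ i, 𝒳 i) → (∀ i : D.Z, 𝒳 i) → 𝒳 D.B → (∀ i : D.X G, 𝒳 i) → ℝ) : Prop where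
  measurable : ∀ s, Measurable fun p : (∀ i : D.Z, 𝒳 i) × 𝒳 D.B × (∀ i : D.X G, 𝒳 i) =>
    q s p.1 p.2.1 p.2.2
  integrable : ∀ s,
    ∀ᵐ c ∂ M.P.map (fun ω => (M.var D.S s D.B ω, M.obs D.S s (D.X G) ω)),
      Integrable (fun z => q s z c.1 c.2 *
        condDensity M.P (ref μ D.Z) ((μ D.B).prod (ref μ (D.X G))) (M.obs D.S s D.Z)
          (fun ω => (M.var D.S s D.B ω, M.obs D.S s (D.X G) ω)) z c) (ref μ D.Z)
  bridge : ∀ s,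
    ∀ᵐ c ∂ M.P.map
        (fun ω => (M.obs D.S s D.W ω, M.var D.S s D.B ω, M.obs D.S s (D.X G) ω)),
      ∫ z, q s z c.2.1 c.2.2 *
        condDensity M.P (ref μ D.Z) ((ref μ D.W).prod ((μ D.B).prod (ref μ (D.X G))))
          (M.obs D.S s D.Z)
          (fun ω => (M.obs D.S s D.W ω, M.var D.S s D.B ω, M.obs D.S s (D.X G) ω)) z c
        ∂ ref μ D.Z =
      1 / condDensity M.P (μ D.B) ((ref μ D.W).prod (ref μ (D.X G))) (M.var D.S s D.B)
        (fun ω => (M.obs D.S s D.W ω, M.obs D.S s (D.X G) ω)) c.2.1 (c.1, c.2.2)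

/-- `q` is square integrable enough for completeness to speak about it: for all `s` and almost all
`b`, `x` the function `u ↦ 1 / p(b | u, x || s) - ∑_z q(z, b, x) p(z | b, u, x || s)` belongs to
`L²(U*(s))`. -/
def SufficientlyIntegrable
    (q : (∀ i, 𝒳 i) → (∀ i : D.Z, 𝒳 i) → 𝒳 D.B → (∀ i : D.X G, 𝒳 i) → ℝ) : Prop :=
  ∀ s, ∀ᵐ c ∂ M.P.map (fun ω => (M.var D.S s D.B ω, M.obs D.S s (D.X G) ω)),
    MemLp (fun u =>
      1 / condDensity M.P (μ D.B) ((ref η Us).prod (ref μ (D.X G))) (M.var D.S s D.B)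
        (fun ω => (M.lat D.S s Us ω, M.obs D.S s (D.X G) ω)) c.1 (u, c.2) -
      ∫ z, q s z c.1 c.2 *
        condDensity M.P (ref μ D.Z) ((μ D.B).prod ((ref η Us).prod (ref μ (D.X G))))
          (M.obs D.S s D.Z)
          (fun ω => (M.var D.S s D.B ω, M.lat D.S s Us ω, M.obs D.S s (D.X G) ω))
          z (c.1, u, c.2) ∂ ref μ D.Z) 2 (M.P.map (M.lat D.S s Us))

/-- The density `p(o, w̃, x, z, b || s)` that the input kernel `p(R || s)` gives to the values `r` of
the output variables, `z` of `Z` and `b` of `B`. -/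
noncomputable def inputDensity (s : ∀ i, 𝒳 i) (r : ∀ i : D.out G, 𝒳 i) (z : ∀ i : D.Z, 𝒳 i)
    (b : 𝒳 D.B) : ℝ :=
  density M.P ((ref μ (D.out G)).prod ((ref μ D.Z).prod (μ D.B)))
    (fun ω => (M.obs D.S s (D.out G) ω, M.obs D.S s D.Z ω, M.var D.S s D.B ω)) (r, z, b)

/-- The output kernel `p(R \ (Z ∪ W* ∪ {B}) || S ∪ {B})` at `(s, b)`. -/
noncomputable def outputKernel (s : ∀ i, 𝒳 i) (b : 𝒳 D.B) : Measure (∀ i : D.out G, 𝒳 i) :=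
  M.kernel (D.out G) (insert D.B D.S) (Function.update s D.B b)

end Conditions

end ProximalID

open scoped ENNReal

set_option linter.unusedSectionVars false

/-! Fix `s` and work under `do(S = s)`. Write `U`, `V`, `X`, `Z` for `U*(s)`, `W̃(s)`, `X(s)`,
`Z(s)`, and `R_b` for the output variables under `do(S = s, B = b)`. Since `W̃` and `X` cannot be
reached from `B`, `R_b` is assembled from `O(s,b)`, `V` and `X`, and consistency gives `R_B = R`.

Inverse probability weighting with the latent confounders turns `∫ E[ψ(b, R_b)] db` into `E[ψ(B, R)
/ p(B | U, X)]`. Ignorability removes `O(s,b)` from the conditional density of `B`, and the outcome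
proxy condition removes `V` (`lintegral_potential_eq`). The weight is then replaced by `E[q(Z, B, X)
| B, U, X]`, the bridge equation with `U` in place of `W` (`ae_inv_condDensity_eq_bridge`). Indeed,
because `W ⫫ (Z, B) | U, X`, the difference of the two sides of the latent equation, averaged
against `p(u | b, w, x)`, is the difference of the two sides of the observed one, hence zero;
completeness makes it vanish. Finally `O ⫫ Z | V, B, U, X` and `V ⫫ Z | B, U, X` allow `ψ(B, R)` to
be multiplied inside, which leaves `∫ ψ ∑_z q p(r, z, b)`. Comparing integrands gives the formula
(`ae_potential_density_eq`). Part (ii) follows because the bridge equation and the right hand side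
involve only the input kernel.

Four points need care.

The weights require `p(b | u, x) > 0`, while positivity is assumed only given `(w, x)`. Completeness
supplies it: the indicator of `{u | p(b | u, x) = 0}` integrates to zero against `p(u | b, w, x)`
(`ae_condDensity_ne_zero_of_complete`).

Ignorability speaks of one fixed `b` at a time, whereas weighting needs `O(s, B)`. For a continuous
treatment, null sets depending on `b` could accumulate along the diagonal. They do not: `O(s,b) = g
b Y` with `g` jointly measurable and `Y` the errors other than that of `B`, and the law of `(B, Y)`
is dominated by `μ_B ⊗ P_Y` (`NPSEM.map_var_otherErrors_absolutelyContinuous`). Averaging over finer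
and finer cells of treatment values then reaches the diagonal (`lintegral_diagonal`).

The function `q` is signed and integrable only conditionally. Identities are therefore kept in
`ℝ≥0∞` with the negative part moved to the other side, and subtraction takes place only where both
parts are finite.

The computation yields an identity integrated over `b`; countable generation of the σ-algebra of the
output space turns it into an equality of measures for almost every `b`
(`ae_eq_withDensity_of_lintegral_eq`). -/

namespace ProximalID

/-! ### Conditional densities as disintegrations. -/

section CondDensity

variable {Ω α β γ δ : Type*} [MeasurableSpace Ω] [MeasurableSpace α] [MeasurableSpace β]
  [MeasurableSpace γ] [MeasurableSpace δ]

/-- `k y t` is a version of the conditional density of `Y` at `y`, given `T = t`, with respect to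
the dominating measure `ρ`. -/
structure IsCondDensity (P : Measure Ω) (ρ : Measure α) (Y : Ω → α) (T : Ω → β)
    (k : α → β → ℝ≥0∞) : Prop where
  measurable : Measurable (Function.uncurry k)
  lintegral_eq : ∀ ψ : α × β → ℝ≥0∞, Measurable ψ →
    ∫⁻ ω, ψ (Y ω, T ω) ∂P = ∫⁻ ω, ∫⁻ y, ψ (y, T ω) * k y (T ω) ∂ρ ∂P

/-- The conditional density `p(y | c)` as an extended nonnegative number. -/
noncomputable def eCondDensity (P : Measure Ω) (ρ : Measure α) (τ : Measure γ)
    (Y : Ω → α) (C : Ω → γ) (y : α) (c : γ) : ℝ≥0∞ :=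
  ENNReal.ofReal (condDensity P ρ τ Y C y c)

@[fun_prop]
theorem measurable_density (P : Measure Ω) (ρ : Measure α) (Y : Ω → α) :
    Measurable (density P ρ Y) :=
  (Measure.measurable_rnDeriv _ _).ennreal_toReal

theorem density_nonneg (P : Measure Ω) (ρ : Measure α) (Y : Ω → α) (y : α) :
    0 ≤ density P ρ Y y := ENNReal.toReal_nonneg

theorem condDensity_nonneg (P : Measure Ω) (ρ : Measure α) (τ : Measure γ)
    (Y : Ω → α) (C : Ω → γ) (y : α) (c : γ) : 0 ≤ condDensity P ρ τ Y C y c :=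
  div_nonneg (density_nonneg _ _ _ _) (density_nonneg _ _ _ _)

theorem measurable_condDensity (P : Measure Ω) (ρ : Measure α) (τ : Measure γ)
    (Y : Ω → α) (C : Ω → γ) : Measurable fun p : α × γ => condDensity P ρ τ Y C p.1 p.2 := by
  unfold condDensity
  fun_prop

theorem measurable_eCondDensity (P : Measure Ω) (ρ : Measure α) (τ : Measure γ)
    (Y : Ω → α) (C : Ω → γ) : Measurable (Function.uncurry (eCondDensity P ρ τ Y C)) :=
  (measurable_condDensity P ρ τ Y C).ennreal_ofReal

theorem eCondDensity_toReal (P : Measure Ω) (ρ : Measure α) (τ : Measure γ)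
    (Y : Ω → α) (C : Ω → γ) (y : α) (c : γ) :
    (eCondDensity P ρ τ Y C y c).toReal = condDensity P ρ τ Y C y c :=
  ENNReal.toReal_ofReal (condDensity_nonneg _ _ _ _ _ _ _)

section Basic

variable {P : Measure Ω} [IsProbabilityMeasure P] {ρ : Measure α} [SigmaFinite ρ]
  {τ : Measure γ} [SigmaFinite τ] {Y : Ω → α} {C : Ω → γ}

theorem map_snd_absolutelyContinuous (hY : Measurable Y) (hC : Measurable C)
    (h : P.map (fun ω => (Y ω, C ω)) ≪ ρ.prod τ) : P.map C ≪ τ := by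
  have := (h.map measurable_snd).trans Measure.quasiMeasurePreserving_snd.absolutelyContinuous
  rwa [Measure.map_map measurable_snd (hY.prodMk hC)] at this

/-- Tonelli: both sides have the same integral over every measurable `s`, namely the probability of
`C ∈ s`. -/
theorem lintegral_rnDeriv_prod (hY : Measurable Y) (hC : Measurable C)
    (h : P.map (fun ω => (Y ω, C ω)) ≪ ρ.prod τ) :
    (fun c => ∫⁻ y, (P.map fun ω => (Y ω, C ω)).rnDeriv (ρ.prod τ) (y, c) ∂ρ)
      =ᵐ[τ] (P.map C).rnDeriv τ := by
  have hp : IsProbabilityMeasure (P.map fun ω => (Y ω, C ω)) :=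
    Measure.isProbabilityMeasure_map (hY.prodMk hC).aemeasurable
  have hpc : IsProbabilityMeasure (P.map C) := Measure.isProbabilityMeasure_map hC.aemeasurable
  have hm := Measure.measurable_rnDeriv (P.map fun ω => (Y ω, C ω)) (ρ.prod τ)
  refine ae_eq_of_forall_setLIntegral_eq_of_sigmaFinite ?_ (Measure.measurable_rnDeriv _ _) ?_
  · exact hm.lintegral_prod_left'
  intro s hs _
  rw [Measure.setLIntegral_rnDeriv (map_snd_absolutelyContinuous hY hC h),
    Measure.map_apply hC hs]
  have h1 : ∫⁻ p in Set.univ ×ˢ s, (P.map fun ω => (Y ω, C ω)).rnDeriv (ρ.prod τ) p ∂(ρ.prod τ)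
      = P (C ⁻¹' s) := by
    rw [Measure.setLIntegral_rnDeriv h, Measure.map_apply (hY.prodMk hC) (MeasurableSet.univ.prod hs)]
    congr 1
    ext ω
    simp
  rw [← h1, ← Measure.prod_restrict, Measure.restrict_univ, lintegral_prod_symm' _ hm]

/-- Links the ratio `p(y, c) / p(c)` of the statement to the disintegration identity used
throughout. Real division by zero is harmless, as the joint density vanishes wherever its marginal
does. -/
theorem isCondDensity_eCondDensity (hY : Measurable Y) (hC : Measurable C)
    (h : P.map (fun ω => (Y ω, C ω)) ≪ ρ.prod τ) :
    IsCondDensity P ρ Y C (eCondDensity P ρ τ Y C) := by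
  refine ⟨measurable_eCondDensity P ρ τ Y C, fun ψ hψ => ?_⟩
  have hp : IsProbabilityMeasure (P.map fun ω => (Y ω, C ω)) :=
    Measure.isProbabilityMeasure_map (hY.prodMk hC).aemeasurable
  have hpc : IsProbabilityMeasure (P.map C) := Measure.isProbabilityMeasure_map hC.aemeasurable
  have hk := measurable_eCondDensity P ρ τ Y C
  have hkm : Measurable fun p : α × γ => ψ p * eCondDensity P ρ τ Y C p.1 p.2 := hψ.mul hk
  have hr := Measure.measurable_rnDeriv (P.map fun ω => (Y ω, C ω)) (ρ.prod τ)
  have hG : Measurable fun c => ∫⁻ y, ψ (y, c) * eCondDensity P ρ τ Y C y c ∂ρ :=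
    hkm.lintegral_prod_left'
  rw [← lintegral_map (f := ψ) hψ (hY.prodMk hC),
    ← lintegral_map (f := fun c => ∫⁻ y, ψ (y, c) * eCondDensity P ρ τ Y C y c ∂ρ) hG hC,
    ← lintegral_rnDeriv_mul h hψ.aemeasurable,
    ← lintegral_rnDeriv_mul (map_snd_absolutelyContinuous hY hC h) hG.aemeasurable,
    lintegral_prod_symm' (fun p => (P.map fun ω => (Y ω, C ω)).rnDeriv (ρ.prod τ) p * ψ p)
      (hr.mul hψ)]
  refine lintegral_congr_ae ?_
  have hfin : ∀ᵐ c ∂τ, ∀ᵐ y ∂ρ,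
      (P.map fun ω => (Y ω, C ω)).rnDeriv (ρ.prod τ) (y, c) < ∞ := by
    have := Measure.rnDeriv_lt_top (P.map fun ω => (Y ω, C ω)) (ρ.prod τ)
    exact Measure.ae_ae_of_ae_prod (Measure.measurePreserving_swap.quasiMeasurePreserving.ae this)
  filter_upwards [lintegral_rnDeriv_prod hY hC h, Measure.rnDeriv_lt_top (P.map C) τ, hfin]
    with c h1 h2 h3
  -- If `p(c) = 0`, the marginal identity `h1` forces `p(y, c) = 0` for almost every `y`, so both
  -- sides vanish.
  by_cases h0 : (P.map C).rnDeriv τ c = 0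
  · rw [h0, zero_mul]
    rw [h0, lintegral_eq_zero_iff (by fun_prop)] at h1
    rw [lintegral_eq_zero_iff (by fun_prop)]
    filter_upwards [h1] with y hy
    simp only [Pi.zero_apply] at hy ⊢
    rw [hy, zero_mul]
  · rw [← lintegral_const_mul _ (by fun_prop)]
    refine lintegral_congr_ae ?_
    filter_upwards [h3] with y hy
    simp only [eCondDensity, condDensity, density]
    rw [ENNReal.ofReal_div_of_pos (ENNReal.toReal_pos h0 h2.ne), ENNReal.ofReal_toReal hy.ne,
      ENNReal.ofReal_toReal h2.ne, mul_comm (ψ _) (_ / _), ← mul_assoc,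
      ENNReal.mul_div_cancel h0 h2.ne]

theorem IsCondDensity.lintegral_eq_one {k : α → γ → ℝ≥0∞}
    (hk : IsCondDensity P ρ Y C k) (hC : Measurable C) :
    ∀ᵐ c ∂P.map C, ∫⁻ y, k y c ∂ρ = 1 := by
  have hpc : IsProbabilityMeasure (P.map C) := Measure.isProbabilityMeasure_map hC.aemeasurable
  have hkm := hk.measurable
  have hm : Measurable fun c => ∫⁻ y, k y c ∂ρ := hkm.lintegral_prod_left'
  refine ae_eq_of_forall_setLIntegral_eq_of_sigmaFinite hm measurable_const fun s hs _ => ?_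
  have h := hk.lintegral_eq (fun p => s.indicator 1 p.2)
    ((measurable_one.indicator hs).comp measurable_snd)
  simp only at h
  rw [← lintegral_map (f := s.indicator 1) (measurable_one.indicator hs) hC,
    lintegral_indicator hs] at h
  simp only [Pi.one_apply] at h
  rw [h, ← lintegral_indicator hs, lintegral_map (hm.indicator hs) hC]
  refine lintegral_congr fun ω => ?_
  by_cases hω : C ω ∈ s <;> simp [hω]

end Basic

namespace IsCondDensity

variable {P : Measure Ω} [IsProbabilityMeasure P] {ρ : Measure α} [SigmaFinite ρ]
  {Y : Ω → α} {T : Ω → β}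

/-- Conditional densities are unique up to null sets. -/
theorem ae_eq {k k' : α → β → ℝ≥0∞} (hk : IsCondDensity P ρ Y T k)
    (hk' : IsCondDensity P ρ Y T k') (hT : Measurable T) :
    ∀ᵐ p ∂ρ.prod (P.map T), k p.1 p.2 = k' p.1 p.2 := by
  have hpc : IsProbabilityMeasure (P.map T) := Measure.isProbabilityMeasure_map hT.aemeasurable
  have key : ∀ k'' : α → β → ℝ≥0∞, IsCondDensity P ρ Y T k'' → ∀ s : Set (α × β), MeasurableSet s →
      ∫⁻ p in s, Function.uncurry k'' p ∂ρ.prod (P.map T) =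
        ∫⁻ ω, s.indicator 1 (Y ω, T ω) ∂P := by
    intro k'' hk'' s hs
    rw [hk''.lintegral_eq _ (measurable_one.indicator hs), ← lintegral_indicator hs,
      lintegral_prod_symm' _ (hk''.measurable.indicator hs)]
    have : Measurable fun p : α × β => s.indicator (Function.uncurry k'') p :=
      hk''.measurable.indicator hs
    rw [lintegral_map (this.lintegral_prod_left' (μ := ρ)) hT]
    refine lintegral_congr fun ω => lintegral_congr fun y => ?_
    by_cases h : (y, T ω) ∈ s <;> simp [h, Function.uncurry]
  have := ae_eq_of_forall_setLIntegral_eq_of_sigmaFinite (μ := ρ.prod (P.map T))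
    hk.measurable hk'.measurable fun s hs _ => (key k hk s hs).trans (key k' hk' s hs).symm
  exact this

theorem congr {k k' : α → β → ℝ≥0∞} (hk : IsCondDensity P ρ Y T k) (hT : Measurable T)
    (hk' : Measurable (Function.uncurry k'))
    (h : ∀ᵐ p ∂ρ.prod (P.map T), k p.1 p.2 = k' p.1 p.2) : IsCondDensity P ρ Y T k' := by
  have hpc : IsProbabilityMeasure (P.map T) := Measure.isProbabilityMeasure_map hT.aemeasurable
  refine ⟨hk', fun ψ hψ => ?_⟩
  rw [hk.lintegral_eq ψ hψ]
  have h1 : ∀ᵐ t ∂P.map T, ∀ᵐ y ∂ρ, k y t = k' y t :=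
    Measure.ae_ae_of_ae_prod (Measure.measurePreserving_swap.quasiMeasurePreserving.ae h)
  refine lintegral_congr_ae ?_
  filter_upwards [ae_of_ae_map hT.aemeasurable h1] with ω hω
  refine lintegral_congr_ae ?_
  filter_upwards [hω] with y hy
  rw [hy]

/-- Test functions of `h T` are in particular test functions of `T`, so a density that sees `T` only
through `h T` is one given `h T`. -/
theorem comp {h : β → γ} {k : α → γ → ℝ≥0∞} (hk : IsCondDensity P ρ Y T fun y t => k y (h t))
    (hh : Measurable h) (hkm : Measurable (Function.uncurry k)) :
    IsCondDensity P ρ Y (fun ω => h (T ω)) k :=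
  ⟨hkm, fun ψ hψ => hk.lintegral_eq (fun p => ψ (p.1, h p.2)) (by fun_prop)⟩

/-- A null set for `P_T`, times the reference measure, is null for the joint law. -/
theorem absolutelyContinuous {k : α → β → ℝ≥0∞} (hk : IsCondDensity P ρ Y T k)
    (hY : Measurable Y) (hT : Measurable T) :
    P.map (fun ω => (Y ω, T ω)) ≪ ρ.prod (P.map T) := by
  refine Measure.AbsolutelyContinuous.mk fun s hs h0 => ?_
  have hpc : IsProbabilityMeasure (P.map T) := Measure.isProbabilityMeasure_map hT.aemeasurable
  have h1 : ∀ᵐ t ∂P.map T, ∀ᵐ y ∂ρ, (y, t) ∉ s :=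
    Measure.ae_ae_of_ae_prod (Measure.measurePreserving_swap.quasiMeasurePreserving.ae (measure_eq_zero_iff_ae_notMem.1 h0))
  rw [← lintegral_indicator_one hs,
    lintegral_map (measurable_one.indicator hs) (hY.prodMk hT),
    hk.lintegral_eq _ (measurable_one.indicator hs)]
  have h2 : ∀ᵐ ω ∂P, ∫⁻ y, s.indicator 1 (y, T ω) * k y (T ω) ∂ρ = 0 := by
    filter_upwards [ae_of_ae_map hT.aemeasurable h1] with ω hω
    rw [lintegral_eq_zero_iff]
    · filter_upwards [hω] with y hy
      simp [hy]
    · have := ((measurable_one.indicator hs).mul hk.measurable : Measurable fun p : α × β =>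
        s.indicator (1 : α × β → ℝ≥0∞) p * k p.1 p.2)
      exact this.comp measurable_prodMk_right
  rw [lintegral_congr_ae h2, lintegral_zero]

/-- Weak union: if `V` is independent of `(Z, C)` given `D`, then `V` does not enter the
conditional density of `Z` given `C`, `D`, `V`. -/
theorem weakUnion {𝓥 𝓩 : Type*} [MeasurableSpace 𝓥] [MeasurableSpace 𝓩] {σ : Measure 𝓥}
    [SigmaFinite σ] {ζ : Measure 𝓩} [SigmaFinite ζ] {V : Ω → 𝓥} {Z : Ω → 𝓩} {C : Ω → γ}
    {D : Ω → δ} {kV : 𝓥 → δ → ℝ≥0∞} {kZ : 𝓩 → γ × δ → ℝ≥0∞}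
    (hV : IsCondDensity P σ V (fun ω => ((Z ω, C ω), D ω)) fun v t => kV v t.2)
    (hZ : IsCondDensity P ζ Z (fun ω => (C ω, D ω)) kZ)
    (hkV : Measurable (Function.uncurry kV)) :
    IsCondDensity P ζ Z (fun ω => (V ω, (C ω, D ω))) fun z t => kZ z t.2 := by
  have hkZ := hZ.measurable
  refine ⟨hkZ.comp (by fun_prop : Measurable fun p : 𝓩 × 𝓥 × γ × δ => (p.1, p.2.2)),
    fun ψ hψ => ?_⟩
  have hkZ' : Measurable fun p : 𝓩 × γ × δ => kZ p.1 p.2 := hkZ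
  have hkV' : Measurable fun p : 𝓥 × δ => kV p.1 p.2 := hkV
  -- `e1` integrates `V` out, `e2` then integrates `Z` out of the result, and `e3` puts `V` back;
  -- Tonelli matches the two iterated integrals.
  have e1 := hV.lintegral_eq (fun p => ψ (p.2.1.1, (p.1, (p.2.1.2, p.2.2)))) (by fun_prop)
  have m1 : Measurable fun q : (𝓩 × γ × δ) × 𝓥 => ψ (q.1.1, (q.2, (q.1.2.1, q.1.2.2))) *
      kV q.2 q.1.2.2 := by
    fun_prop
  have e2 := hZ.lintegral_eq (fun p => ∫⁻ v, ψ (p.1, (v, (p.2.1, p.2.2))) * kV v p.2.2 ∂σ)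
    m1.lintegral_prod_right'
  have m3 : Measurable fun q : (𝓥 × (𝓩 × γ) × δ) × 𝓩 => ψ (q.2, (q.1.1, (q.1.2.1.2, q.1.2.2))) *
      kZ q.2 (q.1.2.1.2, q.1.2.2) := by
    fun_prop
  have e3 := hV.lintegral_eq (fun p => ∫⁻ z, ψ (z, (p.1, (p.2.1.2, p.2.2))) *
    kZ z (p.2.1.2, p.2.2) ∂ζ) m3.lintegral_prod_right'
  simp only at e1 e2 e3 ⊢
  rw [e1, e2, e3]
  refine lintegral_congr fun ω => ?_
  have : ∀ v, (∫⁻ z, ψ (z, (v, (C ω, D ω))) * kZ z (C ω, D ω) ∂ζ) * kV v (D ω) =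
      ∫⁻ z, ψ (z, (v, (C ω, D ω))) * kZ z (C ω, D ω) * kV v (D ω) ∂ζ := fun v =>
    (lintegral_mul_const _ (by fun_prop)).symm
  simp_rw [this]
  have : ∀ z, (∫⁻ v, ψ (z, (v, (C ω, D ω))) * kV v (D ω) ∂σ) * kZ z (C ω, D ω) =
      ∫⁻ v, ψ (z, (v, (C ω, D ω))) * kV v (D ω) * kZ z (C ω, D ω) ∂σ := fun z =>
    (lintegral_mul_const _ (by fun_prop)).symm
  simp_rw [this]
  rw [lintegral_lintegral_swap (by fun_prop)]
  refine lintegral_congr fun v => lintegral_congr fun z => ?_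
  ring

end IsCondDensity

end CondDensity

/-! ### From conditional independence to conditional densities. -/

section CondIndep

variable {Ω α β γ δ : Type*} [MeasurableSpace Ω] [MeasurableSpace α] [MeasurableSpace β]
  [MeasurableSpace γ] [MeasurableSpace δ] {P : Measure Ω} 
  {Y : Ω → α} {Y' : Ω → β} {C : Ω → γ}

theorem CondIndepRV.symm (h : CondIndepRV P Y Y' C) : CondIndepRV P Y' Y C := by
  intro D hD D' hD'
  filter_upwards [h D' hD' D hD] with ω hω
  rw [Set.inter_comm, hω, mul_comm]

theorem CondIndepRV.comp_left (h : CondIndepRV P Y Y' C) {f : α → δ} (hf : Measurable f) :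
    CondIndepRV P (fun ω => f (Y ω)) Y' C :=
  fun D hD D' hD' => h (f ⁻¹' D) (hf hD) D' hD'

variable [IsProbabilityMeasure P] {ρ : Measure α} [SigmaFinite ρ] {k : α → γ → ℝ≥0∞}

/-- Conditional independence is stated with conditional expectations of indicators; this expresses
those through the density, by testing on events `C ∈ s`. -/
theorem IsCondDensity.condExp_indicator (hk : IsCondDensity P ρ Y C k) (hY : Measurable Y)
    (hC : Measurable C) {D : Set α} (hD : MeasurableSet D) :
    (fun ω => (∫⁻ y in D, k y (C ω) ∂ρ).toReal) =ᵐ[P]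
      P[(Y ⁻¹' D).indicator (fun _ => (1 : ℝ)) | MeasurableSpace.comap C inferInstance] := by
  have hkm : Measurable fun p : α × γ => k p.1 p.2 := hk.measurable
  have hh : Measurable fun c => ∫⁻ y in D, k y c ∂ρ := hkm.lintegral_prod_left'
  have hhC : Measurable fun ω => ∫⁻ y in D, k y (C ω) ∂ρ := hh.comp hC
  have hle : ∀ᵐ ω ∂P, ∫⁻ y in D, k y (C ω) ∂ρ ≤ 1 := by
    filter_upwards [ae_of_ae_map hC.aemeasurable (hk.lintegral_eq_one hC)] with ω hω
    exact (setLIntegral_le_lintegral _ _).trans hω.le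
  have hint : Integrable (fun ω => (∫⁻ y in D, k y (C ω) ∂ρ).toReal) P := by
    refine Integrable.of_bound (hh.comp hC).ennreal_toReal.aestronglyMeasurable 1 ?_
    filter_upwards [hle] with ω hω
    rw [Real.norm_of_nonneg ENNReal.toReal_nonneg]
    exact ENNReal.toReal_le_of_le_ofReal zero_le_one (by simpa using hω)
  refine ae_eq_condExp_of_forall_setIntegral_eq hC.comap_le
    ((integrable_const _).indicator (hY hD)) (fun s _ _ => hint.integrableOn) ?_ ?_
  · rintro _ ⟨s, hs, rfl⟩ _
    have h1 := hk.lintegral_eq ((D ×ˢ s).indicator 1) (measurable_one.indicator (hD.prod hs))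
    have h2 : ∫⁻ ω, (D ×ˢ s).indicator (1 : α × γ → ℝ≥0∞) (Y ω, C ω) ∂P =
        P (Y ⁻¹' D ∩ C ⁻¹' s) := by
      rw [← lintegral_indicator_one ((hY hD).inter (hC hs))]
      rfl
    have h3 : ∫⁻ ω, ∫⁻ y, (D ×ˢ s).indicator (1 : α × γ → ℝ≥0∞) (y, C ω) * k y (C ω) ∂ρ ∂P =
        ∫⁻ ω in C ⁻¹' s, ∫⁻ y in D, k y (C ω) ∂ρ ∂P := by
      rw [← lintegral_indicator (hC hs)]
      refine lintegral_congr fun ω => ?_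
      by_cases hω : C ω ∈ s
      · rw [Set.indicator_of_mem (show ω ∈ C ⁻¹' s from hω), ← lintegral_indicator hD]
        refine lintegral_congr fun y => ?_
        by_cases hy : y ∈ D <;> simp [hy, hω]
      · simp [hω]
    rw [integral_toReal hhC.aemeasurable.restrict
      (ae_restrict_of_ae (hle.mono fun ω hω => hω.trans_lt ENNReal.one_lt_top)), ← h3, ← h1, h2,
      setIntegral_indicator (hY hD), setIntegral_const, smul_eq_mul, mul_one, Set.inter_comm]
    rfl
  · exact (hh.ennreal_toReal.comp (comap_measurable C)).aestronglyMeasurable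

/-- Under conditional independence of `Y` and `Y'` given `C`, a conditional density of `Y` given
`C` is also one given `(Y', C)`. -/
theorem CondIndepRV.isCondDensity (h : CondIndepRV P Y Y' C) (hY : Measurable Y)
    (hY' : Measurable Y') (hC : Measurable C) (hk : IsCondDensity P ρ Y C k) :
    IsCondDensity P ρ Y (fun ω => (Y' ω, C ω)) fun y t => k y t.2 := by
  have hkm : Measurable fun p : α × γ => k p.1 p.2 := hk.measurable
  have hkm' : Measurable fun p : α × β × γ => k p.1 p.2.2 := by fun_prop
  have hT : Measurable fun ω => (Y' ω, C ω) := hY'.prodMk hC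
  have hpT : IsProbabilityMeasure (P.map fun ω => (Y' ω, C ω)) :=
    Measure.isProbabilityMeasure_map hT.aemeasurable
  have hpYT : IsProbabilityMeasure (P.map fun ω => (Y ω, (Y' ω, C ω))) :=
    Measure.isProbabilityMeasure_map (hY.prodMk hT).aemeasurable
  have hh : ∀ D : Set α, Measurable fun c => ∫⁻ y in D, k y c ∂ρ :=
    fun D => hkm.lintegral_prod_left'
  have hhC : ∀ D : Set α, Measurable fun ω => ∫⁻ y in D, k y (C ω) ∂ρ := fun D => (hh D).comp hC
  have hh2 : ∀ D : Set α, Measurable fun t : β × γ => ∫⁻ y in D, k y t.2 ∂ρ :=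
    fun D => (hh D).comp measurable_snd
  -- Rectangles determine the joint law, and on a rectangle the claim is exactly the product formula
  -- for conditional probabilities.
  have key : P.map (fun ω => (Y ω, (Y' ω, C ω))) =
      (ρ.prod (P.map fun ω => (Y' ω, C ω))).withDensity fun p => k p.1 p.2.2 := by
    refine Measure.ext_prod₃ fun {D D' s} hD hD' hs => ?_
    have hle : ∀ᵐ ω ∂P, ∫⁻ y in D, k y (C ω) ∂ρ ≤ 1 := by
      filter_upwards [ae_of_ae_map hC.aemeasurable (hk.lintegral_eq_one hC)] with ω hω
      exact (setLIntegral_le_lintegral _ _).trans hω.le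
    rw [Measure.map_apply (hY.prodMk hT) (hD.prod (hD'.prod hs)),
      withDensity_apply _ (hD.prod (hD'.prod hs)), ← Measure.prod_restrict,
      lintegral_prod_symm' _ hkm']
    simp only
    have e2 : ∫⁻ t in D' ×ˢ s, ∫⁻ y in D, k y t.2 ∂ρ ∂P.map (fun ω => (Y' ω, C ω)) =
        ∫⁻ ω in (Y' ⁻¹' D' ∩ C ⁻¹' s), ∫⁻ y in D, k y (C ω) ∂ρ ∂P := by
      rw [setLIntegral_map (hD'.prod hs) (hh2 D) hT]
      rfl
    rw [e2]
    have hm := hC.comap_le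
    have hs' : MeasurableSet[MeasurableSpace.comap C inferInstance] (C ⁻¹' s) := ⟨s, hs, rfl⟩
    set f : Ω → ℝ := fun ω => (∫⁻ y in D, k y (C ω) ∂ρ).toReal with hf
    have hfm : StronglyMeasurable[MeasurableSpace.comap C inferInstance] f :=
      ((hh D).ennreal_toReal.comp (comap_measurable C)).stronglyMeasurable
    set g : Ω → ℝ := (Y' ⁻¹' D').indicator (fun _ => (1 : ℝ)) with hg
    have hgi : Integrable g P := (integrable_const _).indicator (hY' hD')
    have hfg : Integrable (f * g) P := by
      refine Integrable.of_bound
        ((hfm.mono hm).aestronglyMeasurable.mul hgi.aestronglyMeasurable) 1 ?_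
      filter_upwards [hle] with ω hω
      have h1 : ‖f ω‖ ≤ 1 := by
        rw [Real.norm_of_nonneg ENNReal.toReal_nonneg]
        exact ENNReal.toReal_le_of_le_ofReal zero_le_one (by simpa using hω)
      have h2 : ‖g ω‖ ≤ 1 := by
        by_cases h : ω ∈ Y' ⁻¹' D' <;> simp [hg, h]
      simpa using mul_le_mul h1 h2 (norm_nonneg _) zero_le_one
    -- The factor `P(Y ∈ D | C) = f` is `σ(C)`-measurable, so it can be moved inside the conditional
    -- expectation of the indicator `g` of `Y' ∈ D'`.
    have c1 : P[(Y ⁻¹' D ∩ Y' ⁻¹' D').indicator (fun _ => (1 : ℝ)) | MeasurableSpace.comap C inferInstance] =ᵐ[P] P[f * g | MeasurableSpace.comap C inferInstance] := by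
      filter_upwards [h D hD D' hD', hk.condExp_indicator hY hC hD,
        condExp_mul_of_stronglyMeasurable_left hfm hfg hgi] with ω h1 h2 h3
      rw [h1, h3, ← h2]
      rfl
    have c2 : ∫ ω in C ⁻¹' s, (Y ⁻¹' D ∩ Y' ⁻¹' D').indicator (fun _ => (1 : ℝ)) ω ∂P =
        ∫ ω in C ⁻¹' s, (f * g) ω ∂P := by
      rw [← setIntegral_condExp hm ((integrable_const _).indicator ((hY hD).inter (hY' hD'))) hs',
        ← setIntegral_condExp hm hfg hs']
      exact setIntegral_congr_ae (hm _ hs') (c1.mono fun ω hω _ => hω)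
    have c3 : (f * g) = (Y' ⁻¹' D').indicator f := by
      ext ω
      by_cases h : ω ∈ Y' ⁻¹' D' <;> simp [hg, h]
    rw [c3, setIntegral_indicator (hY' hD'), setIntegral_indicator ((hY hD).inter (hY' hD')),
      setIntegral_const, smul_eq_mul, mul_one, hf,
      integral_toReal (hhC D).aemeasurable.restrict
      (ae_restrict_of_ae (hle.mono fun ω hω => hω.trans_lt ENNReal.one_lt_top))] at c2
    rw [Measure.real, ENNReal.toReal_eq_toReal_iff' (measure_ne_top _ _)] at c2
    · rw [Set.inter_comm (Y' ⁻¹' D'), ← c2]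
      congr 1
      ext ω
      simp
      tauto
    · refine ((lintegral_mono_ae (ae_restrict_of_ae hle)).trans_lt ?_).ne
      simp
  refine ⟨hkm', fun ψ hψ => ?_⟩
  rw [← lintegral_map hψ (hY.prodMk hT), key, lintegral_withDensity_eq_lintegral_mul _ hkm' hψ,
    lintegral_prod_symm' _ (hkm'.mul hψ), lintegral_map (hkm'.mul hψ).lintegral_prod_left' hT]
  refine lintegral_congr fun ω => lintegral_congr fun y => ?_
  simp [mul_comm]

end CondIndep

/-! ### From every fixed treatment value to the random treatment value. -/

section Diagonal

open MeasurableSpace Filter Topology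

variable {ℬ : Type*} [MeasurableSpace ℬ] [CountablyGenerated ℬ]

/-- Lévy's density theorem along the countable partition. -/
theorem tendsto_measure_inter_countablePartitionSet_div (ν : Measure ℬ) [IsFiniteMeasure ν]
    {A : Set ℬ} (hA : MeasurableSet A) :
    ∀ᵐ b ∂ν, Tendsto
      (fun m => ν (countablePartitionSet m b ∩ A) / ν (countablePartitionSet m b)) atTop
      (𝓝 (A.indicator 1 b)) := by
  -- The differentiation theorem for kernels is applied to constant kernels, with a dummy second
  -- coordinate; the density of `ν.restrict A` with respect to `ν` is the indicator of `A`.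
  let κ : Kernel Unit (ℬ × Unit) := Kernel.const Unit ((ν.restrict A).map fun b => (b, ()))
  let η : Kernel Unit ℬ := Kernel.const Unit ν
  have hm : Measurable fun b : ℬ => (b, ()) := by fun_prop
  have hκη : κ.fst ≤ η := by
    intro _
    rw [Kernel.fst_apply]
    simp only [κ, η, Kernel.const_apply]
    rw [Measure.map_map measurable_fst hm]
    exact (Measure.map_id (μ := ν.restrict A)).le.trans Measure.restrict_le_self
  have h1 := Kernel.tendsto_m_density hκη () MeasurableSet.univ
  have h2 : (fun b => ENNReal.ofReal (Kernel.density κ η () b Set.univ)) =ᵐ[ν]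
      A.indicator 1 := by
    refine ae_eq_of_forall_setLIntegral_eq_of_sigmaFinite ?_ (measurable_one.indicator hA) ?_
    · exact (Kernel.measurable_density_right κ η MeasurableSet.univ ()).ennreal_ofReal
    intro s hs _
    have := Kernel.setLIntegral_density hκη () MeasurableSet.univ hs
    rw [show η () = ν from rfl] at this
    rw [this]
    simp only [κ, Kernel.const_apply]
    rw [Measure.map_apply hm (hs.prod MeasurableSet.univ), lintegral_indicator hA]
    simp [hs, Measure.restrict_apply, Set.inter_comm, hA]
  filter_upwards [h1, h2] with b hb1 hb2
  rw [← hb2]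
  have := (ENNReal.continuous_ofReal.tendsto _).comp hb1
  refine this.congr fun m => ?_
  simp only [Function.comp, Kernel.densityProcess, κ, η, Kernel.const_apply]
  have hp := measurableSet_countablePartitionSet m b
  rw [Measure.map_apply hm (hp.prod MeasurableSet.univ)]
  have e : (fun b : ℬ => (b, ())) ⁻¹' (countablePartitionSet m b ×ˢ Set.univ) =
      countablePartitionSet m b := by ext; simp
  rw [e, Measure.restrict_apply hp, ENNReal.ofReal_toReal]
  by_cases h0 : ν (countablePartitionSet m b) = 0
  · rw [measure_mono_null Set.inter_subset_left h0]
    simp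
  · exact (ENNReal.div_lt_top (measure_ne_top _ _) h0).ne

/-- The relation "same cell" is a finite union of squares `t ×ˢ t`; its measurability makes the cell
averages below jointly measurable. -/
theorem measurableSet_mem_countablePartitionSet (m : ℕ) :
    MeasurableSet {p : ℬ × ℬ | p.2 ∈ countablePartitionSet m p.1} := by
  have : {p : ℬ × ℬ | p.2 ∈ countablePartitionSet m p.1} =
      ⋃ t ∈ countablePartition ℬ m, t ×ˢ t := by
    ext p
    simp only [Set.mem_ofPred_eq, Set.mem_iUnion, Set.mem_prod, exists_prop]
    constructor
    · exact fun h => ⟨_, countablePartitionSet_mem m p.1, mem_countablePartitionSet m p.1, h⟩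
    · rintro ⟨t, ht, h1, h2⟩
      rwa [countablePartitionSet_of_mem ht h1]
  rw [this]
  exact MeasurableSet.biUnion (finite_countablePartition ℬ m).countable fun t ht =>
    (measurableSet_countablePartition m ht).prod (measurableSet_countablePartition m ht)

variable {Ω 𝒪 𝒞 𝒴 : Type*} [MeasurableSpace Ω] [MeasurableSpace 𝒪] [MeasurableSpace 𝒞]
  [MeasurableSpace 𝒴]

/-- If two measures on `ℬ × Ω` give the same joint law to `b`, `C` and `g b' Y` for each fixed `b'`,
and do not see null sets of a product measure for `(b, Y)`, then they also give the same joint law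
to `b`, `C` and `g b Y`. -/
theorem map_diagonal_eq {ρ : Measure ℬ} [SigmaFinite ρ] {θ : Measure 𝒴} [IsFiniteMeasure θ]
    {m₁ m₂ : Measure (ℬ × Ω)} [IsFiniteMeasure m₁] [IsFiniteMeasure m₂]
    {g : ℬ → 𝒴 → 𝒪} (hg : Measurable (Function.uncurry g))
    {Y : Ω → 𝒴} (hY : Measurable Y) {C : Ω → 𝒞} (hC : Measurable C)
    (h₁ : m₁.map (fun p => (p.1, Y p.2)) ≪ ρ.prod θ)
    (h₂ : m₂.map (fun p => (p.1, Y p.2)) ≪ ρ.prod θ)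
    (h : ∀ b, m₁.map (fun p => (p.1, g b (Y p.2), C p.2)) =
      m₂.map (fun p => (p.1, g b (Y p.2), C p.2))) :
    m₁.map (fun p => (p.1, g p.1 (Y p.2), C p.2)) =
      m₂.map (fun p => (p.1, g p.1 (Y p.2), C p.2)) := by
  have hg' : Measurable fun p : ℬ × 𝒴 => g p.1 p.2 := hg
  have hG : Measurable fun p : ℬ × Ω => (p.1, g p.1 (Y p.2), C p.2) := by fun_prop
  have hfin₁ : IsFiniteMeasure (m₁.map fun p => (p.1, g p.1 (Y p.2), C p.2)) :=
    Measure.isFiniteMeasure_map _ _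
  refine Measure.ext_prod₃ fun {D A Γ} hD hA hΓ => ?_
  -- A finite measure with the null sets of `ρ`, so that averages over cells make sense.
  set ν := ρ.toFinite with hν
  -- `avg m (b, y)` is the `ν`-average of `1_A(g b' y)` over `b'` in the level `m` cell of `b`; `w`
  -- below is the corresponding averaging weight.
  set avg : ℕ → ℬ × 𝒴 → ℝ≥0∞ := fun m p =>
    ν (countablePartitionSet m p.1 ∩ {b | g b p.2 ∈ A}) / ν (countablePartitionSet m p.1) with havg
  have hAm : MeasurableSet {p : ℬ × 𝒴 | g p.1 p.2 ∈ A} := hg' hA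
  have hden : ∀ m, Measurable fun b : ℬ => ν (countablePartitionSet m b) := fun m =>
    measurable_measure_prodMk_left (measurableSet_mem_countablePartitionSet m)
  set w : ℕ → ℬ → ℬ → ℝ≥0∞ := fun m b b' =>
    {p : ℬ × ℬ | p.2 ∈ countablePartitionSet m p.1}.indicator 1 (b, b') /
      ν (countablePartitionSet m b) with hw
  have hwm : ∀ m, Measurable fun p : ℬ × ℬ => w m p.1 p.2 := fun m =>
    (measurable_one.indicator (measurableSet_mem_countablePartitionSet m)).div
      ((hden m).comp measurable_fst)
  have hindA : Measurable (A.indicator (1 : 𝒪 → ℝ≥0∞)) := measurable_one.indicator hA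
  have havgw : ∀ m p, avg m p = ∫⁻ b', w m p.1 b' * A.indicator 1 (g b' p.2) ∂ν := by
    intro m p
    have hs : MeasurableSet (countablePartitionSet m p.1 ∩ {b | g b p.2 ∈ A}) :=
      (measurableSet_countablePartitionSet m p.1).inter
        (hAm.preimage (by fun_prop : Measurable fun b : ℬ => (b, p.2)))
    simp only [havg, hw]
    rw [ENNReal.div_eq_inv_mul, ← lintegral_indicator_one hs, ← lintegral_const_mul _
      (measurable_one.indicator hs)]
    refine lintegral_congr fun b' => ?_
    by_cases h1 : b' ∈ countablePartitionSet m p.1 <;> by_cases h2 : g b' p.2 ∈ A <;>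
      simp [h1, h2]
  have havgm : ∀ m, Measurable (avg m) := by
    intro m
    simp_rw [funext (havgw m)]
    have := hwm m
    have : Measurable fun q : (ℬ × 𝒴) × ℬ => w m q.1.1 q.2 * A.indicator 1 (g q.2 q.1.2) := by
      fun_prop
    exact this.lintegral_prod_right'
  have havg1 : ∀ m p, avg m p ≤ 1 := fun m p =>
    ENNReal.div_le_of_le_mul (by simpa using measure_mono Set.inter_subset_left)
  have hDm : Measurable (D.indicator (1 : ℬ → ℝ≥0∞)) := measurable_one.indicator hD
  have hΓm : Measurable (Γ.indicator (1 : 𝒞 → ℝ≥0∞)) := measurable_one.indicator hΓ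
  -- convergence of the averages
  have hlim : ∀ᵐ p ∂ρ.prod θ, Tendsto (fun m => avg m p) atTop
      (𝓝 (A.indicator 1 (g p.1 p.2))) := by
    have hmeas : MeasurableSet {p : ℬ × 𝒴 | Tendsto (fun m => avg m p) atTop
        (𝓝 (A.indicator 1 (g p.1 p.2)))} :=
      measurableSet_tendsto_fun havgm (hindA.comp hg')
    have hsw : ∀ᵐ q ∂θ.prod ρ, Tendsto (fun m => avg m q.swap) atTop
        (𝓝 (A.indicator 1 (g q.2 q.1))) := by
      refine (Measure.ae_prod_iff_ae_ae (hmeas.preimage measurable_swap)).2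
        (Filter.Eventually.of_forall fun y => ?_)
      have := tendsto_measure_inter_countablePartitionSet_div ν
        (hAm.preimage (by fun_prop : Measurable fun b : ℬ => (b, y)))
      exact (absolutelyContinuous_toFinite ρ).ae_le this
    exact Measure.measurePreserving_swap.quasiMeasurePreserving.ae hsw
  -- Convergence holds off a `ρ.prod θ`-null set, and the assumed domination of the law of `(b, Y)`
  -- is what carries it over to `m'`.
  have hconv : ∀ m' : Measure (ℬ × Ω), IsFiniteMeasure m' →
      m'.map (fun p => (p.1, Y p.2)) ≪ ρ.prod θ →
      Tendsto (fun m => ∫⁻ p, avg m (p.1, Y p.2) * (D.indicator 1 p.1 * Γ.indicator 1 (C p.2)) ∂m')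
        atTop (𝓝 (m'.map (fun p => (p.1, g p.1 (Y p.2), C p.2)) (D ×ˢ A ×ˢ Γ))) := by
    intro m' _ hac
    have e : m'.map (fun p => (p.1, g p.1 (Y p.2), C p.2)) (D ×ˢ A ×ˢ Γ) =
        ∫⁻ p, A.indicator 1 (g p.1 (Y p.2)) * (D.indicator 1 p.1 * Γ.indicator 1 (C p.2)) ∂m' := by
      rw [← lintegral_indicator_one (hD.prod (hA.prod hΓ)),
        lintegral_map (measurable_one.indicator (hD.prod (hA.prod hΓ))) hG]
      refine lintegral_congr fun p => ?_
      by_cases h1 : p.1 ∈ D <;> by_cases h2 : g p.1 (Y p.2) ∈ A <;> by_cases h3 : C p.2 ∈ Γ <;>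
        simp [h1, h2, h3]
    rw [e]
    have hle : ∀ p : ℬ × Ω, D.indicator (1 : ℬ → ℝ≥0∞) p.1 * Γ.indicator 1 (C p.2) ≤ 1 := by
      intro p
      by_cases h1 : p.1 ∈ D <;> by_cases h3 : C p.2 ∈ Γ <;> simp [h1, h3]
    refine tendsto_lintegral_of_dominated_convergence (fun _ => 1) (fun m => ?_) (fun m => ?_) ?_ ?_
    · have := havgm m
      fun_prop
    · exact Filter.Eventually.of_forall fun p => mul_le_one' (havg1 m _) (hle p)
    · simp
    · have := ae_of_ae_map (by fun_prop) (hac.ae_le hlim)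
      filter_upwards [this] with p hp
      exact ENNReal.Tendsto.mul_const hp (Or.inr (ne_top_of_le_ne_top ENNReal.one_ne_top (hle p)))
  -- Tonelli writes the averaged integral as a mixture over `b'` of integrals that involve only `g
  -- b' Y` for fixed `b'`, where `m₁` and `m₂` agree.
  have heq : ∀ m, ∀ m' : Measure (ℬ × Ω), IsFiniteMeasure m' →
      ∫⁻ p, avg m (p.1, Y p.2) * (D.indicator 1 p.1 * Γ.indicator 1 (C p.2)) ∂m' =
      ∫⁻ b', ∫⁻ r, w m r.1 b' * A.indicator 1 r.2.1 * (D.indicator 1 r.1 * Γ.indicator 1 r.2.2)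
        ∂m'.map (fun p => (p.1, g b' (Y p.2), C p.2)) ∂ν := by
    intro m m' _
    have hwm' := hwm m
    have e1 : ∀ b', ∫⁻ r, w m r.1 b' * A.indicator 1 r.2.1 *
          (D.indicator 1 r.1 * Γ.indicator 1 r.2.2) ∂m'.map (fun p => (p.1, g b' (Y p.2), C p.2)) =
        ∫⁻ p, w m p.1 b' * A.indicator 1 (g b' (Y p.2)) *
          (D.indicator 1 p.1 * Γ.indicator 1 (C p.2)) ∂m' := by
      intro b'
      rw [lintegral_map (by fun_prop) (by fun_prop)]
    simp_rw [e1]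
    rw [lintegral_lintegral_swap (by fun_prop)]
    refine lintegral_congr fun p => ?_
    rw [havgw, ← lintegral_mul_const _ (by fun_prop)]
  have h12 : ∀ m, ∫⁻ p, avg m (p.1, Y p.2) * (D.indicator 1 p.1 * Γ.indicator 1 (C p.2)) ∂m₁ =
      ∫⁻ p, avg m (p.1, Y p.2) * (D.indicator 1 p.1 * Γ.indicator 1 (C p.2)) ∂m₂ := by
    intro m
    rw [heq m m₁ inferInstance, heq m m₂ inferInstance]
    simp_rw [h]
  refine tendsto_nhds_unique (hconv m₁ inferInstance h₁) ?_
  simp_rw [h12]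
  exact hconv m₂ inferInstance h₂

/-- If, for each `b`, the random element `g b Y` does not enter the conditional density of `B`
given `C`, then the joint law of `(B, g B Y, C)` has this density with respect to the product of
the dominating measure and of the joint laws of `(g b Y, C)`. -/
theorem lintegral_diagonal {P : Measure Ω} [IsProbabilityMeasure P] {ρ : Measure ℬ} [SigmaFinite ρ]
    {g : ℬ → 𝒴 → 𝒪} (hg : Measurable (Function.uncurry g)) {B : Ω → ℬ} (hB : Measurable B)
    {Y : Ω → 𝒴} (hY : Measurable Y) {C : Ω → 𝒞} (hC : Measurable C)
    (hac : P.map (fun ω => (B ω, Y ω)) ≪ ρ.prod (P.map Y))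
    {k : ℬ → 𝒞 → ℝ≥0∞} (hkm : Measurable (Function.uncurry k))
    (hk : ∀ b, IsCondDensity P ρ B (fun ω => (g b (Y ω), C ω)) fun b' t => k b' t.2)
    {ψ : ℬ × 𝒪 × 𝒞 → ℝ≥0∞} (hψ : Measurable ψ) :
    ∫⁻ ω, ψ (B ω, g (B ω) (Y ω), C ω) ∂P =
      ∫⁻ ω, ∫⁻ b, ψ (b, g b (Y ω), C ω) * k b (C ω) ∂ρ ∂P := by
  have hg' : Measurable fun p : ℬ × 𝒴 => g p.1 p.2 := hg
  have hk' : Measurable fun p : ℬ × 𝒞 => k p.1 p.2 := hkm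
  have hkΩ : Measurable fun p : ℬ × Ω => k p.1 (C p.2) := by fun_prop
  -- `m₁` keeps the actual treatment; `m₂` replaces it by a fresh one with density `k · (C ω)`.
  set m₁ : Measure (ℬ × Ω) := P.map fun ω => (B ω, ω) with hm₁
  set m₂ : Measure (ℬ × Ω) := (ρ.prod P).withDensity fun p => k p.1 (C p.2) with hm₂
  have hB' : Measurable fun ω => (B ω, ω) := by fun_prop
  have i₁ : ∀ φ : ℬ × Ω → ℝ≥0∞, Measurable φ → ∫⁻ p, φ p ∂m₁ = ∫⁻ ω, φ (B ω, ω) ∂P :=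
    fun φ hφ => lintegral_map hφ hB'
  have i₂ : ∀ φ : ℬ × Ω → ℝ≥0∞, Measurable φ →
      ∫⁻ p, φ p ∂m₂ = ∫⁻ ω, ∫⁻ b, φ (b, ω) * k b (C ω) ∂ρ ∂P := by
    intro φ hφ
    rw [hm₂, lintegral_withDensity_eq_lintegral_mul _ hkΩ hφ,
      lintegral_prod_symm' _ (hkΩ.mul hφ)]
    exact lintegral_congr fun ω => lintegral_congr fun b => mul_comm _ _
  have hfin₁ : IsFiniteMeasure m₁ := Measure.isFiniteMeasure_map _ _
  have hpoint : ∀ b, m₁.map (fun p => (p.1, g b (Y p.2), C p.2)) =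
      m₂.map (fun p => (p.1, g b (Y p.2), C p.2)) := by
    intro b
    have hmb : Measurable fun p : ℬ × Ω => (p.1, g b (Y p.2), C p.2) := by fun_prop
    ext s hs
    rw [← lintegral_indicator_one hs, ← lintegral_indicator_one hs,
      lintegral_map (measurable_one.indicator hs) hmb,
      lintegral_map (measurable_one.indicator hs) hmb]
    exact (i₁ _ ((measurable_one.indicator hs).comp hmb)).trans
      (((hk b).lintegral_eq (s.indicator 1) (measurable_one.indicator hs)).trans
        (i₂ _ ((measurable_one.indicator hs).comp hmb)).symm)
  -- One value `b₀` is needed to read off that `m₂` has the total mass of `m₁`, hence is finite.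
  rcases isEmpty_or_nonempty ℬ with hℬ | ⟨⟨b₀⟩⟩
  · have : IsEmpty Ω := ⟨fun ω => hℬ.false (B ω)⟩
    simp [Measure.eq_zero_of_isEmpty P]
  have hfin₂ : IsFiniteMeasure m₂ := by
    refine ⟨?_⟩
    have h1 : m₁ Set.univ = m₂ Set.univ := by
      have := congrArg (fun m : Measure (ℬ × 𝒪 × 𝒞) => m Set.univ) (hpoint b₀)
      rwa [Measure.map_apply (by fun_prop) MeasurableSet.univ,
        Measure.map_apply (by fun_prop) MeasurableSet.univ, Set.preimage_univ] at this
    rw [← h1]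
    exact measure_lt_top _ _
  have hpY : IsProbabilityMeasure (P.map Y) := Measure.isProbabilityMeasure_map hY.aemeasurable
  have hG : Measurable fun p : ℬ × Ω => (p.1, g p.1 (Y p.2), C p.2) := by fun_prop
  have main := map_diagonal_eq (ρ := ρ) (θ := P.map Y) (m₁ := m₁) (m₂ := m₂) hg hY hC
    (by
      rw [hm₁, Measure.map_map (by fun_prop) hB']
      exact hac)
    (by
      refine ((withDensity_absolutelyContinuous _ _).map (by fun_prop)).trans ?_
      have := Measure.map_prod_map ρ P measurable_id hY
      rw [Measure.map_id] at this
      rw [this]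
      rfl)
    hpoint
  have := congrArg (fun m : Measure (ℬ × 𝒪 × 𝒞) => ∫⁻ p, ψ p ∂m) main
  rw [lintegral_map hψ hG, lintegral_map hψ hG] at this
  exact (i₁ _ (hψ.comp hG)).symm.trans (this.trans (i₂ _ (hψ.comp hG)))

end Diagonal

/-! ### Inverse weights, conditional expectations and signed integrands. -/

section CondDensityCalculus

variable {Ω α β γ δ : Type*} [MeasurableSpace Ω] [MeasurableSpace α] [MeasurableSpace β]
  [MeasurableSpace γ] [MeasurableSpace δ] {P : Measure Ω} [IsProbabilityMeasure P]
  {ρ : Measure α} [SigmaFinite ρ] {Y : Ω → α} {T : Ω → β} {k : α → β → ℝ≥0∞}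

namespace IsCondDensity

/-- The set where `k` vanishes has probability the integral of `k` over it, which is zero. -/
theorem ae_ne_zero (hk : IsCondDensity P ρ Y T k) (hY : Measurable Y) (hT : Measurable T) :
    ∀ᵐ p ∂P.map (fun ω => (Y ω, T ω)), k p.1 p.2 ≠ 0 := by
  have hkm : Measurable fun p : α × β => k p.1 p.2 := hk.measurable
  have hs : MeasurableSet {p : α × β | k p.1 p.2 = 0} := hkm (measurableSet_singleton 0)
  rw [ae_iff]
  simp only [ne_eq, not_not]
  rw [← lintegral_indicator_one hs, lintegral_map (measurable_one.indicator hs) (hY.prodMk hT),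
    hk.lintegral_eq _ (measurable_one.indicator hs)]
  have : ∀ ω, ∀ y, {p : α × β | k p.1 p.2 = 0}.indicator 1 (y, T ω) * k y (T ω) = 0 := by
    intro ω y
    by_cases h : k y (T ω) = 0 <;> simp [h]
  simp [this]

/-- Dividing by a positive conditional density. -/
theorem lintegral_mul_inv (hk : IsCondDensity P ρ Y T k) (hT : Measurable T)
    (hpos : ∀ᵐ p ∂ρ.prod (P.map T), k p.1 p.2 ≠ 0) (htop : ∀ y t, k y t ≠ ∞)
    {ψ : α × β → ℝ≥0∞} (hψ : Measurable ψ) :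
    ∫⁻ ω, ψ (Y ω, T ω) * (k (Y ω) (T ω))⁻¹ ∂P = ∫⁻ ω, ∫⁻ y, ψ (y, T ω) ∂ρ ∂P := by
  have hpT : IsProbabilityMeasure (P.map T) := Measure.isProbabilityMeasure_map hT.aemeasurable
  have hkm : Measurable fun p : α × β => k p.1 p.2 := hk.measurable
  rw [hk.lintegral_eq (fun p => ψ p * (k p.1 p.2)⁻¹) (by fun_prop)]
  have h1 : ∀ᵐ t ∂P.map T, ∀ᵐ y ∂ρ, k y t ≠ 0 :=
    Measure.ae_ae_of_ae_prod (Measure.measurePreserving_swap.quasiMeasurePreserving.ae hpos)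
  refine lintegral_congr_ae ?_
  filter_upwards [ae_of_ae_map hT.aemeasurable h1] with ω hω
  refine lintegral_congr_ae ?_
  filter_upwards [hω] with y hy
  rw [mul_assoc, ENNReal.inv_mul_cancel hy (htop _ _), mul_one]

/-- The conditional expectation of `h (Y, T)` given `T` is the integral of `h` against the
conditional density of `Y`. -/
theorem ae_lintegral_eq (hk : IsCondDensity P ρ Y T k) (hT : Measurable T)
    {h : α × β → ℝ≥0∞} (hh : Measurable h) {m : β → ℝ≥0∞} (hm : Measurable m)
    (he : ∀ s : Set β, MeasurableSet s →
      ∫⁻ ω, s.indicator 1 (T ω) * h (Y ω, T ω) ∂P = ∫⁻ ω, s.indicator 1 (T ω) * m (T ω) ∂P) :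
    ∀ᵐ t ∂P.map T, ∫⁻ y, h (y, t) * k y t ∂ρ = m t := by
  have hpT : IsProbabilityMeasure (P.map T) := Measure.isProbabilityMeasure_map hT.aemeasurable
  have hkm : Measurable fun p : α × β => k p.1 p.2 := hk.measurable
  have hf : Measurable fun t => ∫⁻ y, h (y, t) * k y t ∂ρ :=
    (hh.mul hkm).lintegral_prod_left' (μ := ρ)
  have aux : ∀ f : β → ℝ≥0∞, Measurable f → ∀ s : Set β, MeasurableSet s →
      ∫⁻ t in s, f t ∂P.map T = ∫⁻ ω, s.indicator 1 (T ω) * f (T ω) ∂P := by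
    intro f hf s hs
    rw [← lintegral_indicator hs, lintegral_map (hf.indicator hs) hT]
    refine lintegral_congr fun ω => ?_
    by_cases hω : T ω ∈ s <;> simp [hω]
  refine ae_eq_of_forall_setLIntegral_eq_of_sigmaFinite hf hm fun s hs _ => ?_
  rw [aux _ hf s hs, aux _ hm s hs, ← he s hs]
  have hsm : Measurable (s.indicator (1 : β → ℝ≥0∞)) := measurable_one.indicator hs
  rw [hk.lintegral_eq (fun p => s.indicator 1 p.2 * h p) (by fun_prop)]
  refine lintegral_congr fun ω => ?_
  rw [← lintegral_const_mul _ (by fun_prop)]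
  refine lintegral_congr fun y => ?_
  ring

/-- Finiteness of conditional expectations is inherited when conditioning on more. -/
theorem ae_lintegral_lt_top {C : Ω → γ} {π : β → γ} {kC : α → γ → ℝ≥0∞}
    (hkC : IsCondDensity P ρ Y C kC) (hk : IsCondDensity P ρ Y T k) (hT : Measurable T)
    (hπ : Measurable π) (hC : ∀ ω, π (T ω) = C ω) {φ : α × γ → ℝ≥0∞} (hφ : Measurable φ)
    (hfin : ∀ᵐ c ∂P.map C, ∫⁻ y, φ (y, c) * kC y c ∂ρ < ∞) :
    ∀ᵐ t ∂P.map T, ∫⁻ y, φ (y, π t) * k y t ∂ρ < ∞ := by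
  obtain rfl : (fun ω => π (T ω)) = C := funext hC
  have hCm : Measurable fun ω => π (T ω) := hπ.comp hT
  have hkm : Measurable fun p : α × β => k p.1 p.2 := hk.measurable
  have hkCm : Measurable fun p : α × γ => kC p.1 p.2 := hkC.measurable
  set F : γ → ℝ≥0∞ := fun c => ∫⁻ y, φ (y, c) * kC y c ∂ρ with hF
  have hFm : Measurable F := (hφ.mul hkCm).lintegral_prod_left' (μ := ρ)
  have hGm : Measurable fun t => ∫⁻ y, φ (y, π t) * k y t ∂ρ := by
    have : Measurable fun p : α × β => φ (p.1, π p.2) * k p.1 p.2 := by fun_prop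
    exact this.lintegral_prod_left' (μ := ρ)
  -- The unconditional expectation of `φ` may be infinite. On `{F ≤ n}` it is at most `n`, so the
  -- finer conditional expectation is finite there; these sets exhaust almost all of the space.
  have hn : ∀ n : ℕ, ∀ᵐ ω ∂P, F (π (T ω)) ≤ n → ∫⁻ y, φ (y, π (T ω)) * k y (T ω) ∂ρ < ∞ := by
    intro n
    have hs : MeasurableSet {c | F c ≤ n} := measurableSet_le hFm measurable_const
    have hsm : Measurable ({c | F c ≤ n}.indicator (1 : γ → ℝ≥0∞)) := measurable_one.indicator hs
    have e1 := hk.lintegral_eq (fun p => {c | F c ≤ n}.indicator 1 (π p.2) * φ (p.1, π p.2))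
      (by fun_prop)
    have e2 := hkC.lintegral_eq (fun p => {c | F c ≤ n}.indicator 1 p.2 * φ p) (by fun_prop)
    have e3 := e1.symm.trans e2
    simp only [mul_assoc] at e3
    have e4 : ∫⁻ ω, ∫⁻ y, {c | F c ≤ n}.indicator 1 (π (T ω)) * (φ (y, π (T ω)) * kC y (π (T ω)))
        ∂ρ ∂P ≤ ∫⁻ _, n ∂P := by
      refine lintegral_mono fun ω => ?_
      rw [lintegral_const_mul _ (by fun_prop)]
      by_cases h : F (π (T ω)) ≤ n
      · rw [Set.indicator_of_mem (show π (T ω) ∈ {c | F c ≤ n} from h), Pi.one_apply, one_mul]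
        exact h
      · simp [h]
    rw [← e3] at e4
    have e5 : ∫⁻ ω, {c | F c ≤ n}.indicator 1 (π (T ω)) *
        ∫⁻ y, φ (y, π (T ω)) * k y (T ω) ∂ρ ∂P ≠ ∞ := by
      refine ne_top_of_le_ne_top ?_ (le_of_eq_of_le ?_ e4)
      · simp
      · refine lintegral_congr fun ω => ?_
        rw [lintegral_const_mul _ (by fun_prop)]
    have hGT := hGm.comp hT
    filter_upwards [ae_lt_top (by fun_prop) e5] with ω hω hle
    simpa [hle] using hω
  rw [ae_map_iff hT.aemeasurable (measurableSet_lt hGm measurable_const)]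
  filter_upwards [ae_all_iff.2 hn, ae_of_ae_map hCm.aemeasurable hfin] with ω h1 h2
  obtain ⟨n, hn⟩ := ENNReal.exists_nat_gt h2.ne
  exact h1 n hn.le

end IsCondDensity

/-- Integrals of a signed function against a conditional density. -/
theorem integral_mul_toReal_eq {f : α → ℝ} (hf : Measurable f) {κ : α → ℝ≥0∞} (hκ : Measurable κ)
    (htop : ∀ᵐ y ∂ρ, κ y ≠ ∞) (hp : ∫⁻ y, ENNReal.ofReal (f y) * κ y ∂ρ < ∞)
    (hn : ∫⁻ y, ENNReal.ofReal (-f y) * κ y ∂ρ < ∞) :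
    Integrable (fun y => f y * (κ y).toReal) ρ ∧
    ∫ y, f y * (κ y).toReal ∂ρ = (∫⁻ y, ENNReal.ofReal (f y) * κ y ∂ρ).toReal -
      (∫⁻ y, ENNReal.ofReal (-f y) * κ y ∂ρ).toReal := by
  have hm : Measurable fun y => f y * (κ y).toReal := by fun_prop
  have e1 : (fun y => ENNReal.ofReal (f y * (κ y).toReal)) =ᵐ[ρ]
      fun y => ENNReal.ofReal (f y) * κ y := by
    filter_upwards [htop] with y hy
    rw [ENNReal.ofReal_mul' ENNReal.toReal_nonneg, ENNReal.ofReal_toReal hy]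
  have e2 : (fun y => ENNReal.ofReal (-(f y * (κ y).toReal))) =ᵐ[ρ]
      fun y => ENNReal.ofReal (-f y) * κ y := by
    filter_upwards [htop] with y hy
    rw [← neg_mul, ENNReal.ofReal_mul' ENNReal.toReal_nonneg, ENNReal.ofReal_toReal hy]
  have hi : Integrable (fun y => f y * (κ y).toReal) ρ := by
    refine ⟨hm.aestronglyMeasurable, ?_⟩
    rw [hasFiniteIntegral_iff_enorm]
    have : (fun y => ‖f y * (κ y).toReal‖ₑ) =ᵐ[ρ] fun y =>
        ENNReal.ofReal (f y) * κ y + ENNReal.ofReal (-f y) * κ y := by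
      filter_upwards [e1, e2] with y h1 h2
      rw [← h1, ← h2]
      rcases le_total 0 (f y * (κ y).toReal) with h | h
      · rw [Real.enorm_of_nonneg h, ENNReal.ofReal_of_nonpos (neg_nonpos.2 h), add_zero]
      · rw [← enorm_neg, Real.enorm_of_nonneg (neg_nonneg.2 h), ENNReal.ofReal_of_nonpos h, zero_add]
    rw [lintegral_congr_ae this, lintegral_add_left (by fun_prop)]
    exact ENNReal.add_lt_top.2 ⟨hp, hn⟩
  refine ⟨hi, ?_⟩
  rw [integral_eq_lintegral_pos_part_sub_lintegral_neg_part hi, lintegral_congr_ae e1,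
    lintegral_congr_ae e2]

end CondDensityCalculus

/-! ### Domination of joint laws and null sets. -/

section AbsolutelyContinuous

variable {Ω α β γ δ : Type*} [MeasurableSpace Ω] [MeasurableSpace α] [MeasurableSpace β]
  [MeasurableSpace γ] [MeasurableSpace δ] {P : Measure Ω} [IsProbabilityMeasure P]
  {ρ : Measure α} [SigmaFinite ρ] {τ : Measure β} [SigmaFinite τ] {Y : Ω → α} {T : Ω → β}

theorem map_prod_swap_absolutelyContinuous (hY : Measurable Y) (hT : Measurable T)
    (h : P.map (fun ω => (Y ω, T ω)) ≪ ρ.prod τ) :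
    P.map (fun ω => (T ω, Y ω)) ≪ τ.prod ρ := by
  have := (h.map measurable_swap).trans
    Measure.measurePreserving_swap.quasiMeasurePreserving.absolutelyContinuous
  rwa [Measure.map_map measurable_swap (hY.prodMk hT)] at this

/-- A disintegration replaces the reference measure of the conditioning variable by its law;
swapping the factors and repeating does the same for the other variable. -/
theorem map_prod_absolutelyContinuous_prod_map (hY : Measurable Y) (hT : Measurable T)
    (h : P.map (fun ω => (Y ω, T ω)) ≪ ρ.prod τ) :
    P.map (fun ω => (Y ω, T ω)) ≪ (P.map Y).prod (P.map T) := by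
  have hpT : IsProbabilityMeasure (P.map T) := Measure.isProbabilityMeasure_map hT.aemeasurable
  have hpY : IsProbabilityMeasure (P.map Y) := Measure.isProbabilityMeasure_map hY.aemeasurable
  have h1 := (isCondDensity_eCondDensity hY hT h).absolutelyContinuous hY hT
  have h2 := map_prod_swap_absolutelyContinuous hY hT h1
  have h3 := (isCondDensity_eCondDensity hT hY h2).absolutelyContinuous hT hY
  exact map_prod_swap_absolutelyContinuous hT hY h3

/-- Where the density of the conditioning variable vanishes, so does the conditional density; a
property that holds almost surely therefore holds almost everywhere else. -/
theorem ae_or_condDensity_eq_zero (hY : Measurable Y) (hT : Measurable T)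
    (h : P.map (fun ω => (Y ω, T ω)) ≪ ρ.prod τ) {p : β → Prop} (hp : ∀ᵐ t ∂P.map T, p t) :
    ∀ᵐ t ∂τ, p t ∨ ∀ y, condDensity P ρ τ Y T y t = 0 := by
  have hpT : IsProbabilityMeasure (P.map T) := Measure.isProbabilityMeasure_map hT.aemeasurable
  have hac := map_snd_absolutelyContinuous hY hT h
  rw [← Measure.withDensity_rnDeriv_eq _ _ hac,
    ae_withDensity_iff (Measure.measurable_rnDeriv _ _)] at hp
  filter_upwards [hp] with t ht
  by_cases h0 : (P.map T).rnDeriv τ t = 0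
  · right
    intro y
    simp [condDensity, density, h0]
  · exact Or.inl (ht h0)

end AbsolutelyContinuous

/-! ### Averaging over the latent confounders given the outcome proxies. -/

section Completeness

variable {Ω 𝓤 𝓦 𝓩 ℬ 𝓧 : Type*} [MeasurableSpace Ω] [MeasurableSpace 𝓤] [MeasurableSpace 𝓦]
  [MeasurableSpace 𝓩] [MeasurableSpace ℬ] [MeasurableSpace 𝓧]
  {P : Measure Ω} [IsProbabilityMeasure P]
  {ρU : Measure 𝓤} [SigmaFinite ρU] {ρW : Measure 𝓦} [SigmaFinite ρW]
  {ρZ : Measure 𝓩} [SigmaFinite ρZ] {ρB : Measure ℬ} [SigmaFinite ρB]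
  {ρX : Measure 𝓧} [SigmaFinite ρX]
  {U : Ω → 𝓤} {W : Ω → 𝓦} {Z : Ω → 𝓩} {B : Ω → ℬ} {X : Ω → 𝓧}

/-- If `s` is null for `(B, X)`, then `1_s(b, x) p(b | w, x)` vanishes almost everywhere and
positivity cancels the second factor. Hence "almost all `(b, x)` under the law" also covers almost
all `b` under the dominating measure. -/
theorem prod_map_absolutelyContinuous_of_pos {kBW : ℬ → 𝓦 × 𝓧 → ℝ≥0∞}
    (hBW : IsCondDensity P ρB B (fun ω => (W ω, X ω)) kBW)
    (hpos : ∀ᵐ p ∂ρB.prod (P.map fun ω => (W ω, X ω)), kBW p.1 p.2 ≠ 0)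
    (hB : Measurable B) (hW : Measurable W) (hX : Measurable X) :
    ρB.prod (P.map X) ≪ P.map fun ω => (B ω, X ω) := by
  have hpX : IsProbabilityMeasure (P.map X) := Measure.isProbabilityMeasure_map hX.aemeasurable
  have hWX : Measurable fun ω => (W ω, X ω) := hW.prodMk hX
  have hpWX : IsProbabilityMeasure (P.map fun ω => (W ω, X ω)) :=
    Measure.isProbabilityMeasure_map hWX.aemeasurable
  have hkm : Measurable fun p : ℬ × 𝓦 × 𝓧 => kBW p.1 p.2 := hBW.measurable
  refine Measure.AbsolutelyContinuous.mk fun s hs h0 => ?_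
  have hsm : Measurable (s.indicator (1 : ℬ × 𝓧 → ℝ≥0∞)) := measurable_one.indicator hs
  rw [← lintegral_indicator_one hs, lintegral_map hsm (by fun_prop),
    hBW.lintegral_eq (fun p => s.indicator 1 (p.1, p.2.2)) (by fun_prop)] at h0
  have hm : Measurable fun t : 𝓦 × 𝓧 => ∫⁻ y, s.indicator 1 (y, t.2) * kBW y t ∂ρB := by
    have : Measurable fun p : ℬ × 𝓦 × 𝓧 => s.indicator (1 : ℬ × 𝓧 → ℝ≥0∞) (p.1, p.2.2) *
      kBW p.1 p.2 := by fun_prop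
    exact this.lintegral_prod_left' (μ := ρB)
  have h0 := (lintegral_eq_zero_iff (hm.comp hWX)).1 h0
  have h1 : ∀ᵐ t ∂P.map (fun ω => (W ω, X ω)), ∀ᵐ y ∂ρB, kBW y t ≠ 0 :=
    Measure.ae_ae_of_ae_prod (Measure.measurePreserving_swap.quasiMeasurePreserving.ae hpos)
  have h2 : ∀ᵐ ω ∂P, ∫⁻ y, s.indicator 1 (y, X ω) ∂ρB = 0 := by
    filter_upwards [h0, ae_of_ae_map hWX.aemeasurable h1] with ω h3 h4
    rw [lintegral_eq_zero_iff (by fun_prop)]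
    simp only [Function.comp, Pi.zero_apply] at h3
    rw [lintegral_eq_zero_iff (by fun_prop)] at h3
    filter_upwards [h3, h4] with y h5 h6
    simpa [h6] using h5
  rw [← lintegral_indicator_one hs, lintegral_prod_symm' _ hsm,
    lintegral_map (hsm.lintegral_prod_left' (μ := ρB)) hX, lintegral_congr_ae h2, lintegral_zero]

/-- Completeness yields conclusions for almost all `(b, x)` and then `P_U`-almost all `u`;
domination by product measures converts them to `ρB ⊗ P_(U,X)`, the form needed for weighting. -/
theorem ae_prod_of_ae_map_ae_map
    (hBX : ρB.prod (P.map X) ≪ P.map fun ω => (B ω, X ω))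
    (hUX : P.map (fun ω => (U ω, X ω)) ≪ (P.map U).prod (P.map X))
    (hU : Measurable U) (hX : Measurable X) {p : ℬ × 𝓤 × 𝓧 → Prop} (hp : MeasurableSet {t | p t})
    (h : ∀ᵐ c ∂P.map (fun ω => (B ω, X ω)), ∀ᵐ u ∂P.map U, p (c.1, u, c.2)) :
    ∀ᵐ t ∂ρB.prod (P.map fun ω => (U ω, X ω)), p t := by
  have hpX : IsProbabilityMeasure (P.map X) := Measure.isProbabilityMeasure_map hX.aemeasurable
  have hpU : IsProbabilityMeasure (P.map U) := Measure.isProbabilityMeasure_map hU.aemeasurable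
  have hpUX : IsProbabilityMeasure (P.map fun ω => (U ω, X ω)) :=
    Measure.isProbabilityMeasure_map (hU.prodMk hX).aemeasurable
  refine (Measure.ae_prod_iff_ae_ae hp).2 ?_
  filter_upwards [Measure.ae_ae_of_ae_prod (hBX.ae_le h)] with b hb
  refine hUX.ae_le ?_
  have hs : MeasurableSet {t : 𝓧 × 𝓤 | p (b, t.2, t.1)} := hp.preimage (by fun_prop)
  have := (Measure.ae_prod_iff_ae_ae (μ := P.map X) (ν := P.map U) hs).2 hb
  exact Measure.measurePreserving_swap.quasiMeasurePreserving.ae this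

theorem ae_ae_of_ae_prod_prod {p : ℬ × 𝓦 × 𝓧 → Prop}
    (h : ∀ᵐ t ∂ρB.prod (ρW.prod ρX), p t) :
    ∀ᵐ c ∂ρB.prod ρX, ∀ᵐ w ∂ρW, p (c.1, w, c.2) := by
  have h1 := ((MeasurePreserving.id ρB).prod
    (Measure.measurePreserving_swap (μ := ρX) (ν := ρW))).comp
    (measurePreserving_prodAssoc ρB ρX ρW)
  exact Measure.ae_ae_of_ae_prod (h1.quasiMeasurePreserving.ae h)

variable {kB : ℬ → 𝓤 × 𝓧 → ℝ≥0∞} {kZ : 𝓩 → ℬ × 𝓤 × 𝓧 → ℝ≥0∞} {kU : 𝓤 → ℬ × 𝓦 × 𝓧 → ℝ≥0∞}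
  {kBW : ℬ → 𝓦 × 𝓧 → ℝ≥0∞} {kZW : 𝓩 → 𝓦 × ℬ × 𝓧 → ℝ≥0∞}

/-- Almost surely `p(B | U, X) ≠ 0` at the realised values, so the event that it vanishes also has
conditional probability zero given `(B, W, X)`. -/
theorem ae_lintegral_indicator_condDensity_eq_zero
    (hkU : IsCondDensity P ρU U (fun ω => (B ω, W ω, X ω)) kU)
    (hkB : IsCondDensity P ρB B (fun ω => (W ω, U ω, X ω)) fun b t => kB b t.2)
    (hkBm : Measurable (Function.uncurry kB))
    (hU : Measurable U) (hW : Measurable W) (hB : Measurable B) (hX : Measurable X) :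
    ∀ᵐ t ∂P.map (fun ω => (B ω, W ω, X ω)),
      ∫⁻ u, ({0} : Set ℝ≥0∞).indicator 1 (kB t.1 (u, t.2.2)) * kU u t ∂ρU = 0 := by
  have hkBm' : Measurable fun p : ℬ × 𝓤 × 𝓧 => kB p.1 p.2 := hkBm
  have h0 : Measurable (({0} : Set ℝ≥0∞).indicator (1 : ℝ≥0∞ → ℝ≥0∞)) :=
    measurable_one.indicator (measurableSet_singleton 0)
  refine hkU.ae_lintegral_eq (by fun_prop)
    (h := fun p => ({0} : Set ℝ≥0∞).indicator 1 (kB p.2.1 (p.1, p.2.2.2)))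
    (by fun_prop) measurable_zero fun s hs => ?_
  have hsm : Measurable (s.indicator (1 : ℬ × 𝓦 × 𝓧 → ℝ≥0∞)) := measurable_one.indicator hs
  simp only [mul_zero, lintegral_zero]
  have hpos := ae_of_ae_map (by fun_prop) (hkB.ae_ne_zero hB (by fun_prop))
  rw [lintegral_eq_zero_iff' (by fun_prop)]
  filter_upwards [hpos] with ω hω
  simp [hω]

/-- This is `E[1 / p(B | U, X) | B, W, X] = 1 / p(B | W, X)`: tested against a function of `(B, W,
X)`, either weight cancels its density and leaves the integral of that function over `b` and the law
of `(W, X)`. -/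
theorem ae_lintegral_inv_condDensity
    (hkU : IsCondDensity P ρU U (fun ω => (B ω, W ω, X ω)) kU)
    (hkB : IsCondDensity P ρB B (fun ω => (W ω, U ω, X ω)) fun b t => kB b t.2)
    (hkBW : IsCondDensity P ρB B (fun ω => (W ω, X ω)) kBW)
    (hkBm : Measurable (Function.uncurry kB))
    (hkBtop : ∀ b t, kB b t ≠ ∞) (hkBWtop : ∀ b t, kBW b t ≠ ∞)
    (hposB : ∀ᵐ p ∂ρB.prod (P.map fun ω => (U ω, X ω)), kB p.1 p.2 ≠ 0)
    (hposBW : ∀ᵐ p ∂ρB.prod (P.map fun ω => (W ω, X ω)), kBW p.1 p.2 ≠ 0)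
    (hU : Measurable U) (hW : Measurable W) (hB : Measurable B) (hX : Measurable X) :
    ∀ᵐ t ∂P.map (fun ω => (B ω, W ω, X ω)),
      ∫⁻ u, (kB t.1 (u, t.2.2))⁻¹ * kU u t ∂ρU = (kBW t.1 t.2)⁻¹ := by
  have hkBm' : Measurable fun p : ℬ × 𝓤 × 𝓧 => kB p.1 p.2 := hkBm
  have hkBWm : Measurable fun p : ℬ × 𝓦 × 𝓧 => kBW p.1 p.2 := hkBW.measurable
  refine hkU.ae_lintegral_eq (by fun_prop) (h := fun p => (kB p.2.1 (p.1, p.2.2.2))⁻¹)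
    (by fun_prop) (by fun_prop) fun s hs => ?_
  have hsm : Measurable (s.indicator (1 : ℬ × 𝓦 × 𝓧 → ℝ≥0∞)) := measurable_one.indicator hs
  -- Positivity is pulled back to `(W, U, X)`, since the weight is used for a density of `B` that
  -- also conditions on `W`.
  have hpos : ∀ᵐ p ∂ρB.prod (P.map fun ω => (W ω, U ω, X ω)), kB p.1 p.2.2 ≠ 0 := by
    have hq : Measure.QuasiMeasurePreserving (Prod.map (id : ℬ → ℬ) (Prod.snd : 𝓦 × 𝓤 × 𝓧 → _))
        (ρB.prod (P.map fun ω => (W ω, U ω, X ω))) (ρB.prod (P.map fun ω => (U ω, X ω))) := by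
      refine ⟨by fun_prop, ?_⟩
      rw [← Measure.map_prod_map _ _ measurable_id measurable_snd, Measure.map_id,
        Measure.map_map measurable_snd (by fun_prop)]
      rfl
    exact hq.ae hposB
  rw [hkB.lintegral_mul_inv (by fun_prop) hpos (fun b t => hkBtop b t.2)
    (ψ := fun p => s.indicator 1 (p.1, p.2.1, p.2.2.2)) (by fun_prop),
    hkBW.lintegral_mul_inv (by fun_prop) hposBW hkBWtop (by fun_prop)]

/-- The tower property: `W` does not enter `p(z | b, u, x)`, so averaging it over `u` given `(b, w,
x)` gives `p(z | w, b, x)`. -/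
theorem ae_lintegral_lintegral_condDensity
    (hkU : IsCondDensity P ρU U (fun ω => (B ω, W ω, X ω)) kU)
    (hkZ : IsCondDensity P ρZ Z (fun ω => (W ω, B ω, U ω, X ω)) fun z t => kZ z t.2)
    (hkZW : IsCondDensity P ρZ Z (fun ω => (W ω, B ω, X ω)) kZW)
    (hkZm : Measurable (Function.uncurry kZ))
    (hW : Measurable W) (hB : Measurable B) (hX : Measurable X)
    {φ : 𝓩 × ℬ × 𝓧 → ℝ≥0∞} (hφ : Measurable φ) :
    ∀ᵐ t ∂P.map (fun ω => (B ω, W ω, X ω)),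
      ∫⁻ u, (∫⁻ z, φ (z, t.1, t.2.2) * kZ z (t.1, u, t.2.2) ∂ρZ) * kU u t ∂ρU =
        ∫⁻ z, φ (z, t.1, t.2.2) * kZW z (t.2.1, t.1, t.2.2) ∂ρZ := by
  have hkZm' : Measurable fun p : 𝓩 × ℬ × 𝓤 × 𝓧 => kZ p.1 p.2 := hkZm
  have hkZWm : Measurable fun p : 𝓩 × 𝓦 × ℬ × 𝓧 => kZW p.1 p.2 := hkZW.measurable
  refine hkU.ae_lintegral_eq (by fun_prop)
    (h := fun p => ∫⁻ z, φ (z, p.2.1, p.2.2.2) * kZ z (p.2.1, p.1, p.2.2.2) ∂ρZ) ?_ ?_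
    fun s hs => ?_
  · have : Measurable fun q : 𝓩 × 𝓤 × ℬ × 𝓦 × 𝓧 => φ (q.1, q.2.2.1, q.2.2.2.2) *
      kZ q.1 (q.2.2.1, q.2.1, q.2.2.2.2) := by fun_prop
    exact this.lintegral_prod_left' (μ := ρZ)
  · have : Measurable fun q : 𝓩 × ℬ × 𝓦 × 𝓧 => φ (q.1, q.2.1, q.2.2.2) *
      kZW q.1 (q.2.2.1, q.2.1, q.2.2.2) := by fun_prop
    exact this.lintegral_prod_left' (μ := ρZ)
  have hsm : Measurable (s.indicator (1 : ℬ × 𝓦 × 𝓧 → ℝ≥0∞)) := measurable_one.indicator hs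
  have e1 := hkZ.lintegral_eq
    (fun p => s.indicator 1 (p.2.2.1, p.2.1, p.2.2.2.2) * φ (p.1, p.2.2.1, p.2.2.2.2))
    (by fun_prop)
  have e2 := hkZW.lintegral_eq
    (fun p => s.indicator 1 (p.2.2.1, p.2.1, p.2.2.2) * φ (p.1, p.2.2.1, p.2.2.2)) (by fun_prop)
  have e3 := e1.symm.trans e2
  simp only [mul_assoc] at e3
  refine Eq.trans (lintegral_congr fun ω => ?_) (e3.trans (lintegral_congr fun ω => ?_))
  · rw [lintegral_const_mul _ (by fun_prop)]
  · rw [lintegral_const_mul _ (by fun_prop)]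

end Completeness

theorem ae_map_comp {Ω β γ : Type*} [MeasurableSpace Ω] [MeasurableSpace β] [MeasurableSpace γ]
    {P : Measure Ω} {T : Ω → β} (hT : Measurable T) {f : β → γ} (hf : Measurable f)
    {p : γ → Prop} (h : ∀ᵐ c ∂P.map (fun ω => f (T ω)), p c) : ∀ᵐ t ∂P.map T, p (f t) := by
  have : Measure.QuasiMeasurePreserving f (P.map T) (P.map fun ω => f (T ω)) := by
    refine ⟨hf, ?_⟩
    rw [Measure.map_map hf hT]
    rfl
  exact this.ae h

theorem lintegral_ofReal_mul_lt_top {α : Type*} [MeasurableSpace α] {ρ : Measure α} {f : α → ℝ}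
    {κ : α → ℝ≥0∞} (h : ∫⁻ y, ‖f y‖ₑ * κ y ∂ρ < ∞) :
    ∫⁻ y, ENNReal.ofReal (f y) * κ y ∂ρ < ∞ ∧ ∫⁻ y, ENNReal.ofReal (-f y) * κ y ∂ρ < ∞ := by
  constructor
  · refine lt_of_le_of_lt (lintegral_mono fun y => mul_le_mul_left ?_ _) h
    exact Real.ofReal_le_enorm _
  · refine lt_of_le_of_lt (lintegral_mono fun y => mul_le_mul_left ?_ _) h
    rw [← enorm_neg]
    exact Real.ofReal_le_enorm _

/-! ### Completeness: positivity and the bridge equation given the latent confounders. -/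

section Completeness

variable {Ω 𝓤 𝓦 𝓩 ℬ 𝓧 : Type*} [MeasurableSpace Ω] [MeasurableSpace 𝓤] [MeasurableSpace 𝓦]
  [MeasurableSpace 𝓩] [MeasurableSpace ℬ] [MeasurableSpace 𝓧]
  {P : Measure Ω} [IsProbabilityMeasure P]
  {ρU : Measure 𝓤} [SigmaFinite ρU] {ρW : Measure 𝓦} [SigmaFinite ρW]
  {ρZ : Measure 𝓩} [SigmaFinite ρZ] {ρB : Measure ℬ} [SigmaFinite ρB]
  {ρX : Measure 𝓧} [SigmaFinite ρX]
  {U : Ω → 𝓤} {W : Ω → 𝓦} {Z : Ω → 𝓩} {B : Ω → ℬ} {X : Ω → 𝓧}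

/-- Completeness quantifies `w` under `P_W` separately from `(b, x)`, while identities are known
only under the joint law. At the additional points the density of `(b, w, x)` vanishes, so `p(u | b,
w, x)` is zero by convention and the integrals over `u` vanish anyway. -/
theorem ae_ae_or_condDensity_eq_zero
    (hac : P.map (fun ω => (U ω, B ω, W ω, X ω)) ≪ ρU.prod (ρB.prod (ρW.prod ρX)))
    (hWac : P.map W ≪ ρW) (hBXac : P.map (fun ω => (B ω, X ω)) ≪ ρB.prod ρX)
    (hU : Measurable U) (hW : Measurable W) (hB : Measurable B) (hX : Measurable X)
    {p : ℬ × 𝓦 × 𝓧 → Prop} (hp : ∀ᵐ t ∂P.map (fun ω => (B ω, W ω, X ω)), p t) :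
    ∀ᵐ c ∂P.map (fun ω => (B ω, X ω)), ∀ᵐ w ∂P.map W, p (c.1, w, c.2) ∨
      ∀ u, condDensity P ρU (ρB.prod (ρW.prod ρX)) U (fun ω => (B ω, W ω, X ω)) u
        (c.1, w, c.2) = 0 := by
  filter_upwards [hBXac.ae_le (ae_ae_of_ae_prod_prod
    (ae_or_condDensity_eq_zero hU (by fun_prop) hac hp))] with c hc
  exact hWac.ae_le hc

variable {kB : ℬ → 𝓤 × 𝓧 → ℝ≥0∞} {kZ : 𝓩 → ℬ × 𝓤 × 𝓧 → ℝ≥0∞}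
  {kBW : ℬ → 𝓦 × 𝓧 → ℝ≥0∞} {kZW : 𝓩 → 𝓦 × ℬ × 𝓧 → ℝ≥0∞} {kZX : 𝓩 → ℬ × 𝓧 → ℝ≥0∞}

/-- Completeness forces `p(b | u, x) > 0`. -/
theorem ae_condDensity_ne_zero_of_complete
    (hac : P.map (fun ω => (U ω, B ω, W ω, X ω)) ≪ ρU.prod (ρB.prod (ρW.prod ρX)))
    (hWac : P.map W ≪ ρW) (hBXac : P.map (fun ω => (B ω, X ω)) ≪ ρB.prod ρX)
    (hU : Measurable U) (hW : Measurable W) (hB : Measurable B) (hX : Measurable X)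
    (hkB : IsCondDensity P ρB B (fun ω => (W ω, U ω, X ω)) fun b t => kB b t.2)
    (hkBm : Measurable (Function.uncurry kB))
    (hcomp : ∀ᵐ c ∂P.map (fun ω => (B ω, X ω)), ∀ g : 𝓤 → ℝ, MemLp g 2 (P.map U) →
      (∀ᵐ w ∂P.map W, Integrable (fun u => g u * condDensity P ρU (ρB.prod (ρW.prod ρX)) U
          (fun ω => (B ω, W ω, X ω)) u (c.1, w, c.2)) ρU ∧
        ∫ u, g u * condDensity P ρU (ρB.prod (ρW.prod ρX)) U
          (fun ω => (B ω, W ω, X ω)) u (c.1, w, c.2) ∂ρU = 0) → ∀ᵐ u ∂P.map U, g u = 0) :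
    ∀ᵐ c ∂P.map (fun ω => (B ω, X ω)), ∀ᵐ u ∂P.map U, kB c.1 (u, c.2) ≠ 0 := by
  have hpU : IsProbabilityMeasure (P.map U) := Measure.isProbabilityMeasure_map hU.aemeasurable
  have hkBm' : Measurable fun p : ℬ × 𝓤 × 𝓧 => kB p.1 p.2 := hkBm
  have hkU := isCondDensity_eCondDensity hU (by fun_prop) hac
  have hkUm := measurable_condDensity P ρU (ρB.prod (ρW.prod ρX)) U (fun ω => (B ω, W ω, X ω))
  have h0 : Measurable (({0} : Set ℝ≥0∞).indicator (1 : ℝ≥0∞ → ℝ≥0∞)) :=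
    measurable_one.indicator (measurableSet_singleton 0)
  have h0r : Measurable (({0} : Set ℝ≥0∞).indicator (1 : ℝ≥0∞ → ℝ)) :=
    measurable_one.indicator (measurableSet_singleton 0)
  filter_upwards [hcomp, ae_ae_or_condDensity_eq_zero hac hWac hBXac hU hW hB hX
    (ae_lintegral_indicator_condDensity_eq_zero hkU hkB hkBm hU hW hB hX)] with c hc h1
  -- The test function is the indicator of `{u | p(b | u, x) = 0}`; being bounded, it is square
  -- integrable.
  have := hc (fun u => ({0} : Set ℝ≥0∞).indicator 1 (kB c.1 (u, c.2))) ?_ ?_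
  · filter_upwards [this] with u hu hk
    simp [hk] at hu
  · refine MemLp.of_bound (C := 1) ?_ ?_
    · exact (by fun_prop : Measurable fun u => ({0} : Set ℝ≥0∞).indicator (1 : ℝ≥0∞ → ℝ)
        (kB c.1 (u, c.2))).aestronglyMeasurable
    · refine Filter.Eventually.of_forall fun u => ?_
      by_cases h : kB c.1 (u, c.2) = 0 <;> simp [h]
  · filter_upwards [h1] with w hw
    have hz : (fun u => ({0} : Set ℝ≥0∞).indicator (1 : ℝ≥0∞ → ℝ) (kB c.1 (u, c.2)) *
        condDensity P ρU (ρB.prod (ρW.prod ρX)) U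
          (fun ω => (B ω, W ω, X ω)) u (c.1, w, c.2)) =ᵐ[ρU] 0 := by
      rcases hw with hw | hw
      · have hkUm' := measurable_eCondDensity P ρU (ρB.prod (ρW.prod ρX)) U
          (fun ω => (B ω, W ω, X ω))
        have hkUm'' : Measurable fun u => eCondDensity P ρU (ρB.prod (ρW.prod ρX)) U
          (fun ω => (B ω, W ω, X ω)) u (c.1, w, c.2) :=
          hkUm'.comp (by fun_prop : Measurable fun u => (u, (c.1, w, c.2)))
        rw [lintegral_eq_zero_iff (by fun_prop)] at hw
        filter_upwards [hw] with u hu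
        by_cases h : kB c.1 (u, c.2) = 0
        · simp only [h, Set.mem_singleton_iff, Set.indicator_of_mem, Pi.one_apply, one_mul,
            Pi.zero_apply, eCondDensity, ENNReal.ofReal_eq_zero] at hu ⊢
          exact le_antisymm hu (condDensity_nonneg _ _ _ _ _ _ _)
        · simp [h]
      · exact Filter.Eventually.of_forall fun u => by simp [hw u]
    exact ⟨(integrable_zero _ _ _).congr hz.symm, by rw [integral_congr_ae hz]; simp⟩

/-- A treatment bridge function for the proxies is also one for the latent confounders. -/
theorem ae_inv_condDensity_eq_bridge
    (hac : P.map (fun ω => (U ω, B ω, W ω, X ω)) ≪ ρU.prod (ρB.prod (ρW.prod ρX)))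
    (hWac : P.map W ≪ ρW) (hBXac : P.map (fun ω => (B ω, X ω)) ≪ ρB.prod ρX)
    (hUXac : P.map (fun ω => (U ω, X ω)) ≪ ρU.prod ρX)
    (hU : Measurable U) (hW : Measurable W) (hB : Measurable B) (hX : Measurable X)
    (hkB : IsCondDensity P ρB B (fun ω => (W ω, U ω, X ω)) fun b t => kB b t.2)
    (hkBm : Measurable (Function.uncurry kB)) (hkBtop : ∀ b t, kB b t ≠ ∞)
    (hkZ : IsCondDensity P ρZ Z (fun ω => (W ω, B ω, U ω, X ω)) fun z t => kZ z t.2)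
    (hkZm : Measurable (Function.uncurry kZ)) (hkZtop : ∀ z t, kZ z t ≠ ∞)
    (hkBW : IsCondDensity P ρB B (fun ω => (W ω, X ω)) kBW) (hkBWtop : ∀ b t, kBW b t ≠ ∞)
    (hkZW : IsCondDensity P ρZ Z (fun ω => (W ω, B ω, X ω)) kZW) (hkZWtop : ∀ z t, kZW z t ≠ ∞)
    (hkZX : IsCondDensity P ρZ Z (fun ω => (B ω, X ω)) kZX) (hkZXtop : ∀ z t, kZX z t ≠ ∞)
    (hposBW : ∀ᵐ p ∂ρB.prod (P.map fun ω => (W ω, X ω)), kBW p.1 p.2 ≠ 0)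
    (hcomp : ∀ᵐ c ∂P.map (fun ω => (B ω, X ω)), ∀ g : 𝓤 → ℝ, MemLp g 2 (P.map U) →
      (∀ᵐ w ∂P.map W, Integrable (fun u => g u * condDensity P ρU (ρB.prod (ρW.prod ρX)) U
          (fun ω => (B ω, W ω, X ω)) u (c.1, w, c.2)) ρU ∧
        ∫ u, g u * condDensity P ρU (ρB.prod (ρW.prod ρX)) U
          (fun ω => (B ω, W ω, X ω)) u (c.1, w, c.2) ∂ρU = 0) → ∀ᵐ u ∂P.map U, g u = 0)
    {q : 𝓩 × ℬ × 𝓧 → ℝ} (hq : Measurable q)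
    (hqint : ∀ᵐ c ∂P.map (fun ω => (B ω, X ω)),
      Integrable (fun z => q (z, c) * (kZX z c).toReal) ρZ)
    (hbridge : ∀ᵐ c ∂P.map (fun ω => (W ω, B ω, X ω)),
      ∫ z, q (z, c.2) * (kZW z c).toReal ∂ρZ = 1 / (kBW c.2.1 (c.1, c.2.2)).toReal)
    (hsq : ∀ᵐ c ∂P.map (fun ω => (B ω, X ω)), MemLp (fun u => 1 / (kB c.1 (u, c.2)).toReal -
      ∫ z, q (z, c) * (kZ z (c.1, u, c.2)).toReal ∂ρZ) 2 (P.map U)) :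
    (∀ᵐ p ∂ρB.prod (P.map fun ω => (U ω, X ω)), kB p.1 p.2 ≠ 0) ∧
    ∀ᵐ t ∂P.map (fun ω => (B ω, U ω, X ω)),
      (kB t.1 t.2)⁻¹ + ∫⁻ z, ENNReal.ofReal (-q (z, t.1, t.2.2)) * kZ z t ∂ρZ =
        ∫⁻ z, ENNReal.ofReal (q (z, t.1, t.2.2)) * kZ z t ∂ρZ := by
  have hkBm' : Measurable fun p : ℬ × 𝓤 × 𝓧 => kB p.1 p.2 := hkBm
  have hkZm' : Measurable fun p : 𝓩 × ℬ × 𝓤 × 𝓧 => kZ p.1 p.2 := hkZm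
  have hkZWm : Measurable fun p : 𝓩 × 𝓦 × ℬ × 𝓧 => kZW p.1 p.2 := hkZW.measurable
  have hkU := isCondDensity_eCondDensity hU (by fun_prop) hac
  have hBX := prod_map_absolutelyContinuous_of_pos hkBW hposBW hB hW hX
  have hUX := map_prod_absolutelyContinuous_prod_map hU hX hUXac
  have hpos := ae_condDensity_ne_zero_of_complete hac hWac hBXac hU hW hB hX hkB hkBm hcomp
  have hposB := ae_prod_of_ae_map_ae_map hBX hUX hU hX
    (hkBm' (measurableSet_singleton 0).compl) hpos
  refine ⟨hposB, ?_⟩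
  -- integrability of the bridge function
  have hfin : ∀ᵐ c ∂P.map (fun ω => (B ω, X ω)), ∫⁻ z, ‖q (z, c)‖ₑ * kZX z c ∂ρZ < ∞ := by
    filter_upwards [hqint] with c hc
    refine lt_of_eq_of_lt (lintegral_congr fun z => ?_) hc.2
    rw [enorm_mul, Real.enorm_of_nonneg ENNReal.toReal_nonneg, ENNReal.ofReal_toReal (hkZXtop _ _)]
  have hqe : Measurable fun p : 𝓩 × ℬ × 𝓧 => ‖q p‖ₑ := hq.enorm
  have hfinW := hkZX.ae_lintegral_lt_top hkZW (by fun_prop) measurable_snd (fun ω => rfl) hqe hfin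
  have hkZ' : IsCondDensity P ρZ Z (fun ω => (B ω, U ω, X ω)) kZ := hkZ.comp measurable_snd hkZm
  have hfinU := hkZX.ae_lintegral_lt_top hkZ' (by fun_prop)
    (by fun_prop : Measurable fun t : ℬ × 𝓤 × 𝓧 => (t.1, t.2.2)) (fun ω => rfl) hqe hfin
  -- the identity holds on average over `u`
  have hperm : Measurable fun t : ℬ × 𝓦 × 𝓧 => (t.2.1, t.1, t.2.2) := by fun_prop
  have hBWX : Measurable fun ω => (B ω, W ω, X ω) := by fun_prop
  have hgood := ae_ae_or_condDensity_eq_zero hac hWac hBXac hU hW hB hX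
    (((ae_lintegral_inv_condDensity hkU hkB hkBW hkBm hkBtop hkBWtop hposB hposBW hU hW hB hX).and
    (ae_lintegral_lintegral_condDensity hkU hkZ hkZW hkZm hW hB hX
      (φ := fun p => ENNReal.ofReal (q p)) (by fun_prop))).and
    ((ae_lintegral_lintegral_condDensity hkU hkZ hkZW hkZm hW hB hX
      (φ := fun p => ENNReal.ofReal (-q p)) (by fun_prop)).and
    ((ae_map_comp hBWX hperm hfinW).and ((ae_map_comp hBWX hperm hbridge).and
      (hkBW.ae_ne_zero hB (by fun_prop))))))
  have hzero : ∀ᵐ c ∂P.map (fun ω => (B ω, X ω)), ∀ᵐ u ∂P.map U,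
      1 / (kB c.1 (u, c.2)).toReal - ∫ z, q (z, c) * (kZ z (c.1, u, c.2)).toReal ∂ρZ = 0 := by
    filter_upwards [hcomp, hsq, hgood] with c hc hcsq hcgood
    refine hc _ hcsq ?_
    filter_upwards [hcgood] with w hw
    -- In the second case `p(u | b, w, x)` is identically zero and there is nothing to check.
    rcases hw with ⟨⟨hA, hIp⟩, hIn, hF, hbr, hnz⟩ | hw
    swap
    · simp [hw]
    obtain ⟨hFp, hFn⟩ := lintegral_ofReal_mul_lt_top hF
    set κ : 𝓤 → ℝ≥0∞ := fun u => eCondDensity P ρU (ρB.prod (ρW.prod ρX)) U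
      (fun ω => (B ω, W ω, X ω)) u (c.1, w, c.2) with hκ
    have hκm : Measurable κ := (measurable_eCondDensity P ρU (ρB.prod (ρW.prod ρX)) U
      (fun ω => (B ω, W ω, X ω))).comp (by fun_prop : Measurable fun u => (u, (c.1, w, c.2)))
    have hκtop : ∀ u, κ u ≠ ∞ := fun u => ENNReal.ofReal_ne_top
    have hκr : ∀ u, condDensity P ρU (ρB.prod (ρW.prod ρX)) U
      (fun ω => (B ω, W ω, X ω)) u (c.1, w, c.2) = (κ u).toReal := fun u =>
      (eCondDensity_toReal _ _ _ _ _ _ _).symm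
    set Ip : 𝓤 → ℝ≥0∞ := fun u =>
      ∫⁻ z, ENNReal.ofReal (q (z, c.1, c.2)) * kZ z (c.1, u, c.2) ∂ρZ with hIpdef
    set In : 𝓤 → ℝ≥0∞ := fun u =>
      ∫⁻ z, ENNReal.ofReal (-q (z, c.1, c.2)) * kZ z (c.1, u, c.2) ∂ρZ with hIndef
    have hIpm : Measurable Ip := by
      have : Measurable fun p : 𝓩 × 𝓤 => ENNReal.ofReal (q (p.1, c.1, c.2)) *
        kZ p.1 (c.1, p.2, c.2) := by fun_prop
      exact this.lintegral_prod_left' (μ := ρZ)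
    have hInm : Measurable In := by
      have : Measurable fun p : 𝓩 × 𝓤 => ENNReal.ofReal (-q (p.1, c.1, c.2)) *
        kZ p.1 (c.1, p.2, c.2) := by fun_prop
      exact this.lintegral_prod_left' (μ := ρZ)
    have hkBinv : Measurable fun u => (kB c.1 (u, c.2))⁻¹ := by fun_prop
    have hAtop : ∫⁻ u, (kB c.1 (u, c.2))⁻¹ * κ u ∂ρU ≠ ∞ := by
      rw [hA]
      exact ENNReal.inv_ne_top.2 hnz
    have hPtop : ∫⁻ u, Ip u * κ u ∂ρU ≠ ∞ := by
      rw [hIp]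
      exact hFp.ne
    have hNtop : ∫⁻ u, In u * κ u ∂ρU ≠ ∞ := by
      rw [hIn]
      exact hFn.ne
    have hAm : Measurable fun u => (kB c.1 (u, c.2))⁻¹ * κ u := hkBinv.mul hκm
    have hPm : Measurable fun u => Ip u * κ u := hIpm.mul hκm
    have hNm : Measurable fun u => In u * κ u := hInm.mul hκm
    have hAi := integrable_toReal_of_lintegral_ne_top hAm.aemeasurable hAtop
    have hPi := integrable_toReal_of_lintegral_ne_top hPm.aemeasurable hPtop
    have hNi := integrable_toReal_of_lintegral_ne_top hNm.aemeasurable hNtop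
    have hPNi : Integrable (fun u => (Ip u * κ u).toReal - (In u * κ u).toReal) ρU := hPi.sub hNi
    have hAlt := ae_lt_top hAm hAtop
    have hPlt := ae_lt_top hPm hPtop
    have hNlt := ae_lt_top hNm hNtop
    have heq : (fun u => (1 / (kB c.1 (u, c.2)).toReal -
          ∫ z, q (z, c) * (kZ z (c.1, u, c.2)).toReal ∂ρZ) *
          condDensity P ρU (ρB.prod (ρW.prod ρX)) U
            (fun ω => (B ω, W ω, X ω)) u (c.1, w, c.2)) =ᵐ[ρU]
        fun u => ((kB c.1 (u, c.2))⁻¹ * κ u).toReal -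
          ((Ip u * κ u).toReal - (In u * κ u).toReal) := by
      filter_upwards [hPlt, hNlt] with u hu1 hu2
      rw [hκr]
      by_cases h0 : κ u = 0
      · simp [h0]
      -- Finiteness of the conditional integrals of `q⁺` and `q⁻` comes from that of their averages,
      -- and so is available only where the weight `κ u` is nonzero.
      have h1 : Ip u < ∞ := lt_top_iff_ne_top.2 fun h => by
        simp [h, ENNReal.top_mul h0] at hu1
      have h2 : In u < ∞ := lt_top_iff_ne_top.2 fun h => by
        simp [h, ENNReal.top_mul h0] at hu2
      have h3 := (integral_mul_toReal_eq (ρ := ρZ) (f := fun z => q (z, c))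
        (κ := fun z => kZ z (c.1, u, c.2)) (by fun_prop) (by fun_prop) (ae_of_all _ fun z => hkZtop _ _)
        h1 h2).2
      rw [h3, ENNReal.toReal_mul, ENNReal.toReal_mul, ENNReal.toReal_mul, ENNReal.toReal_inv]
      simp only [one_div, hIpdef, hIndef]
      ring
    refine ⟨(hAi.sub hPNi).congr heq.symm, ?_⟩
    rw [integral_congr_ae heq, integral_sub hAi hPNi, integral_sub hPi hNi,
      integral_toReal hAm.aemeasurable hAlt,
      integral_toReal hPm.aemeasurable hPlt,
      integral_toReal hNm.aemeasurable hNlt, hA, hIp, hIn]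
    have h4 := (integral_mul_toReal_eq (ρ := ρZ) (f := fun z => q (z, c))
      (κ := fun z => kZW z (w, c.1, c.2)) (by fun_prop) (by fun_prop) (ae_of_all _ fun z => hkZWtop _ _)
      hFp hFn).2
    have hbr' : ∫ z, q (z, c) * (kZW z (w, c.1, c.2)).toReal ∂ρZ =
      1 / (kBW c.1 (w, c.2)).toReal := hbr
    rw [← h4, hbr', ENNReal.toReal_inv, one_div, sub_self]
  -- back to extended nonnegative numbers
  have hIm : ∀ f : ℝ → ℝ, Measurable f → Measurable fun t : ℬ × 𝓤 × 𝓧 =>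
      ∫⁻ z, ENNReal.ofReal (f (q (z, t.1, t.2.2))) * kZ z t ∂ρZ := by
    intro f hf
    have : Measurable fun p : 𝓩 × ℬ × 𝓤 × 𝓧 => ENNReal.ofReal (f (q (p.1, p.2.1, p.2.2.2))) *
      kZ p.1 p.2 := by fun_prop
    exact this.lintegral_prod_left' (μ := ρZ)
  have hImp := hIm (fun x => x) measurable_id
  have hImn := hIm (fun x => -x) measurable_neg
  -- The identity is moved to `ρB ⊗ P_(U,X)`, but finiteness is known only under the joint law of
  -- `(B, U, X)`. It is therefore carried as a hypothesis and discharged after passing to that law.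
  have hfinal : ∀ᵐ t ∂ρB.prod (P.map fun ω => (U ω, X ω)),
      ∫⁻ z, ENNReal.ofReal (q (z, t.1, t.2.2)) * kZ z t ∂ρZ < ∞ →
      ∫⁻ z, ENNReal.ofReal (-q (z, t.1, t.2.2)) * kZ z t ∂ρZ < ∞ →
      (kB t.1 t.2)⁻¹ + ∫⁻ z, ENNReal.ofReal (-q (z, t.1, t.2.2)) * kZ z t ∂ρZ =
        ∫⁻ z, ENNReal.ofReal (q (z, t.1, t.2.2)) * kZ z t ∂ρZ := by
    refine ae_prod_of_ae_map_ae_map hBX hUX hU hX ?_ ?_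
    · refine MeasurableSet.imp (measurableSet_lt hImp measurable_const)
        (MeasurableSet.imp (measurableSet_lt hImn measurable_const) ?_)
      exact measurableSet_eq_fun (by fun_prop) hImp
    filter_upwards [hpos, hzero] with c hc1 hc2
    filter_upwards [hc1, hc2] with u hu1 hu2 hp hn
    have h3 := (integral_mul_toReal_eq (ρ := ρZ) (f := fun z => q (z, c))
      (κ := fun z => kZ z (c.1, u, c.2)) (by fun_prop) (by fun_prop) (ae_of_all _ fun z => hkZtop _ _)
      hp hn).2
    rw [h3, one_div, ← ENNReal.toReal_inv] at hu2
    rw [← ENNReal.toReal_eq_toReal_iff' (ENNReal.add_ne_top.2 ⟨ENNReal.inv_ne_top.2 hu1, hn.ne⟩)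
      hp.ne, ENNReal.toReal_add (ENNReal.inv_ne_top.2 hu1) hn.ne]
    simp only [Prod.mk.eta] at hu2 ⊢
    linarith
  have hkB' : IsCondDensity P ρB B (fun ω => (U ω, X ω)) kB := hkB.comp measurable_snd hkBm
  filter_upwards [(hkB'.absolutelyContinuous hB (by fun_prop)).ae_le hfinal, hfinU] with t h1 h2
  exact h1 (lintegral_ofReal_mul_lt_top h2).1 (lintegral_ofReal_mul_lt_top h2).2

end Completeness

/-! ### From an identity integrated over treatment values to almost every treatment value. -/

section Disintegration

/-- Two families of measures with the same integrals over all rectangles agree almost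
everywhere. -/
theorem ae_eq_withDensity_of_lintegral_eq {Ω ℬ 𝓡 : Type*} [MeasurableSpace Ω] [MeasurableSpace ℬ]
    [MeasurableSpace 𝓡] [MeasurableSpace.CountablyGenerated 𝓡]
    {P : Measure Ω} [IsProbabilityMeasure P] {ρB : Measure ℬ} [SigmaFinite ρB]
    {ρR : Measure 𝓡} [SigmaFinite ρR] {h : ℬ → Ω → 𝓡} (hh : Measurable (Function.uncurry h))
    {l : ℬ × 𝓡 → ℝ≥0∞} (hl : Measurable l)
    (heq : ∀ ψ : ℬ × 𝓡 → ℝ≥0∞, Measurable ψ →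
      ∫⁻ b, ∫⁻ ω, ψ (b, h b ω) ∂P ∂ρB = ∫⁻ p, ψ p * l p ∂ρB.prod ρR) :
    ∀ᵐ b ∂ρB, P.map (h b) = ρR.withDensity fun r => l (b, r) := by
  have hh' : Measurable fun p : ℬ × Ω => h p.1 p.2 := hh
  have hhb : ∀ b, Measurable (h b) := fun b => hh'.comp measurable_prodMk_left
  -- For one set at a time; the exceptional null set of `b` depends on `A`, and uniqueness of
  -- kernels on a countably generated space removes this dependence.
  have hA : ∀ A : Set 𝓡, MeasurableSet A →
      ∀ᵐ b ∂ρB, P.map (h b) A = ρR.withDensity (fun r => l (b, r)) A := by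
    intro A hA
    have hAm : Measurable (A.indicator (1 : 𝓡 → ℝ≥0∞)) := measurable_one.indicator hA
    have e1 : ∀ b, P.map (h b) A = ∫⁻ ω, A.indicator 1 (h b ω) ∂P := fun b => by
      rw [← lintegral_indicator_one hA, lintegral_map hAm (hhb b)]
    have e2 : ∀ b, ρR.withDensity (fun r => l (b, r)) A = ∫⁻ r, A.indicator 1 r * l (b, r) ∂ρR := by
      intro b
      rw [withDensity_apply _ hA, ← lintegral_indicator hA]
      refine lintegral_congr fun r => ?_
      by_cases hr : r ∈ A <;> simp [hr]
    simp_rw [e1, e2]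
    have m1 : Measurable fun b => ∫⁻ ω, A.indicator 1 (h b ω) ∂P := by
      have : Measurable fun p : ℬ × Ω => A.indicator (1 : 𝓡 → ℝ≥0∞) (h p.1 p.2) := by fun_prop
      exact this.lintegral_prod_right'
    have m2 : Measurable fun b => ∫⁻ r, A.indicator 1 r * l (b, r) ∂ρR := by
      have : Measurable fun p : ℬ × 𝓡 => A.indicator (1 : 𝓡 → ℝ≥0∞) p.2 * l p := by fun_prop
      exact this.lintegral_prod_right'
    refine ae_eq_of_forall_setLIntegral_eq_of_sigmaFinite m1 m2 fun D hD _ => ?_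
    have hDm : Measurable (D.indicator (1 : ℬ → ℝ≥0∞)) := measurable_one.indicator hD
    have aux : ∀ f : ℬ → ℝ≥0∞, ∫⁻ b in D, f b ∂ρB = ∫⁻ b, D.indicator 1 b * f b ∂ρB := by
      intro f
      rw [← lintegral_indicator hD]
      refine lintegral_congr fun b => ?_
      by_cases hb : b ∈ D <;> simp [hb]
    have := heq (fun p => D.indicator 1 p.1 * A.indicator 1 p.2) (by fun_prop)
    rw [lintegral_prod _ (by fun_prop)] at this
    rw [aux, aux]
    refine Eq.trans (lintegral_congr fun b => ?_) (this.trans (lintegral_congr fun b => ?_))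
    · have := hhb b
      exact (lintegral_const_mul _ (by fun_prop)).symm
    · simp only [mul_assoc]
      rw [lintegral_const_mul _ (by fun_prop)]
  let κ₁ : Kernel ℬ 𝓡 := ⟨fun b => P.map (h b), by
    refine Measure.measurable_of_measurable_coe _ fun s hs => ?_
    simp_rw [Measure.map_apply (hhb _) hs]
    exact measurable_measure_prodMk_left (hh' hs)⟩
  have hκ₁ : IsMarkovKernel κ₁ :=
    ⟨fun b => Measure.isProbabilityMeasure_map (hhb b).aemeasurable⟩
  have m3 : Measurable fun b => ∫⁻ r, l (b, r) ∂ρR := hl.lintegral_prod_right'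
  -- On a null set of `b` the mass of `l (b, ·)` may exceed one or be infinite. Cutting off there
  -- makes `κ₂` a finite kernel, as uniqueness requires.
  have hG : MeasurableSet {b | ∫⁻ r, l (b, r) ∂ρR ≤ 1} := measurableSet_le m3 measurable_const
  set G := {b | ∫⁻ r, l (b, r) ∂ρR ≤ 1} with hGdef
  have hGm : Measurable (G.indicator (1 : ℬ → ℝ≥0∞)) := measurable_one.indicator hG
  let κ₂ : Kernel ℬ 𝓡 := ⟨fun b => ρR.withDensity fun r => G.indicator 1 b * l (b, r), by
    refine Measure.measurable_of_measurable_coe _ fun s hs => ?_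
    simp_rw [withDensity_apply _ hs]
    have : Measurable fun p : ℬ × 𝓡 => G.indicator 1 p.1 * l p := by fun_prop
    exact this.lintegral_prod_right'⟩
  have hκ₂ : IsFiniteKernel κ₂ := by
    refine ⟨1, ENNReal.one_lt_top, fun b => ?_⟩
    change ρR.withDensity (fun r => G.indicator 1 b * l (b, r)) Set.univ ≤ 1
    rw [withDensity_apply _ MeasurableSet.univ, Measure.restrict_univ]
    by_cases hb : b ∈ G
    · simp only [Set.indicator_of_mem hb, Pi.one_apply, one_mul]
      exact hb
    · simp [hb]
  have hGae : ∀ᵐ b ∂ρB, b ∈ G := by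
    filter_upwards [hA Set.univ MeasurableSet.univ] with b hb
    rw [Measure.map_apply (hhb b) MeasurableSet.univ, withDensity_apply _ MeasurableSet.univ,
      Measure.restrict_univ, Set.preimage_univ, measure_univ] at hb
    exact hb.symm.le
  have hG2 : ∀ b ∈ G, κ₂ b = ρR.withDensity fun r => l (b, r) := by
    intro b hb
    change ρR.withDensity (fun r => G.indicator 1 b * l (b, r)) = _
    simp [hb]
  have hκ : κ₁ =ᵐ[ρB.toFinite] κ₂ := by
    refine Kernel.ae_eq_of_compProd_eq (Measure.ext_prod fun {D A} hD hA' => ?_)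
    rw [Measure.compProd_apply_prod hD hA', Measure.compProd_apply_prod hD hA']
    refine setLIntegral_congr_fun_ae hD ?_
    have h1 : ∀ᵐ b ∂ρB, κ₁ b A = κ₂ b A := by
      filter_upwards [hA A hA', hGae] with b hb hbG
      rw [hG2 b hbG, ← hb]
      rfl
    rw [← ae_toFinite] at h1
    exact h1.mono fun b hb _ => hb
  rw [Filter.EventuallyEq, ae_toFinite] at hκ
  filter_upwards [hκ, hGae] with b hb hbG
  rw [← hG2 b hbG, ← hb]
  rfl

end Disintegration

/-! ### Inverse probability weighting and the bridge formula. -/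

section Bridge

variable {Ω 𝓤 𝓥 𝓞 𝓡 𝓨 𝓩 ℬ 𝓧 : Type*} [MeasurableSpace Ω] [MeasurableSpace 𝓤] [MeasurableSpace 𝓥]
  [MeasurableSpace 𝓞] [MeasurableSpace 𝓡] [MeasurableSpace 𝓨]
  [MeasurableSpace 𝓩] [MeasurableSpace ℬ] [MeasurableSpace 𝓧]
  {P : Measure Ω} [IsProbabilityMeasure P]
  {ρR : Measure 𝓡} [SigmaFinite ρR]
  {ρZ : Measure 𝓩} [SigmaFinite ρZ] {ρB : Measure ℬ} [SigmaFinite ρB]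
  {U : Ω → 𝓤} {V : Ω → 𝓥} {Z : Ω → 𝓩} {B : Ω → ℬ} {X : Ω → 𝓧} {Y : Ω → 𝓨} {R : Ω → 𝓡}
  {g : ℬ → 𝓨 → 𝓞} {j : 𝓞 × 𝓥 × 𝓧 → 𝓡}
  {kB : ℬ → 𝓤 × 𝓧 → ℝ≥0∞} {kZ : 𝓩 → ℬ × 𝓤 × 𝓧 → ℝ≥0∞} {kBV : ℬ → 𝓤 × 𝓥 × 𝓧 → ℝ≥0∞}
  {kZX : 𝓩 → ℬ × 𝓧 → ℝ≥0∞}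

/-- The joint density is integrated with `z` innermost, because the bridge formula compares
functions of `(b, r)` after summing over `z`. -/
theorem lintegral_map_rnDeriv (hR : Measurable R) (hZ : Measurable Z) (hB : Measurable B)
    (hac : P.map (fun ω => (R ω, Z ω, B ω)) ≪ ρR.prod (ρZ.prod ρB))
    {φ : 𝓡 × 𝓩 × ℬ → ℝ≥0∞} (hφ : Measurable φ) :
    ∫⁻ ω, φ (R ω, Z ω, B ω) ∂P = ∫⁻ p, ∫⁻ z, φ (p.2, z, p.1) *
      (P.map (fun ω => (R ω, Z ω, B ω))).rnDeriv (ρR.prod (ρZ.prod ρB)) (p.2, z, p.1) ∂ρZ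
        ∂ρB.prod ρR := by
  have hpm : IsProbabilityMeasure (P.map fun ω => (R ω, Z ω, B ω)) :=
    Measure.isProbabilityMeasure_map (by fun_prop)
  have hd := Measure.measurable_rnDeriv (P.map fun ω => (R ω, Z ω, B ω)) (ρR.prod (ρZ.prod ρB))
  rw [← lintegral_map hφ (by fun_prop), ← lintegral_rnDeriv_mul hac hφ.aemeasurable]
  have hσ : MeasurePreserving (fun t : (ℬ × 𝓡) × 𝓩 => (t.1.2, t.2, t.1.1))
      ((ρB.prod ρR).prod ρZ) (ρR.prod (ρZ.prod ρB)) := by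
    have h1 := (measurePreserving_prodAssoc ρR ρZ ρB)
    have h2 := (Measure.measurePreserving_swap (μ := ρB) (ν := ρR.prod ρZ))
    exact h1.comp (h2.comp (measurePreserving_prodAssoc ρB ρR ρZ))
  rw [← hσ.lintegral_comp (f := fun t => (P.map fun ω => (R ω, Z ω, B ω)).rnDeriv
    (ρR.prod (ρZ.prod ρB)) t * φ t) (hd.mul hφ), lintegral_prod _ (by fun_prop)]
  exact lintegral_congr fun p => lintegral_congr fun z => mul_comm _ _

/-- Conditional integrability given `(b, x)` passes to the joint density of `(r, z, b)` by
localising on `{F ≤ n}`. The conclusion is for the reference measure rather than the law, so the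
points with `F = ∞` need a separate argument. -/
theorem ae_lintegral_rnDeriv_lt_top (hR : Measurable R) (hZ : Measurable Z) (hB : Measurable B)
    (hX : Measurable X)
    (hac : P.map (fun ω => (R ω, Z ω, B ω)) ≪ ρR.prod (ρZ.prod ρB))
    {x : 𝓡 → 𝓧} (hx : Measurable x) (hxR : ∀ ω, x (R ω) = X ω)
    (hkZX : IsCondDensity P ρZ Z (fun ω => (B ω, X ω)) kZX)
    {φ : 𝓩 × ℬ × 𝓧 → ℝ≥0∞} (hφ : Measurable φ)
    (hfin : ∀ᵐ c ∂P.map (fun ω => (B ω, X ω)), ∫⁻ z, φ (z, c) * kZX z c ∂ρZ < ∞) :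
    ∀ᵐ p ∂ρB.prod ρR, ∫⁻ z, φ (z, p.1, x p.2) *
      (P.map (fun ω => (R ω, Z ω, B ω))).rnDeriv (ρR.prod (ρZ.prod ρB)) (p.2, z, p.1) ∂ρZ < ∞ := by
  have hd := Measure.measurable_rnDeriv (P.map fun ω => (R ω, Z ω, B ω)) (ρR.prod (ρZ.prod ρB))
  set d := (P.map fun ω => (R ω, Z ω, B ω)).rnDeriv (ρR.prod (ρZ.prod ρB)) with hddef
  have hkm : Measurable fun p : 𝓩 × ℬ × 𝓧 => kZX p.1 p.2 := hkZX.measurable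
  set F : ℬ × 𝓧 → ℝ≥0∞ := fun c => ∫⁻ z, φ (z, c) * kZX z c ∂ρZ with hF
  have hFm : Measurable F := (hφ.mul hkm).lintegral_prod_left' (μ := ρZ)
  have hGm : Measurable fun p : ℬ × 𝓡 => ∫⁻ z, φ (z, p.1, x p.2) * d (p.2, z, p.1) ∂ρZ := by
    have : Measurable fun t : (ℬ × 𝓡) × 𝓩 => φ (t.2, t.1.1, x t.1.2) * d (t.1.2, t.2, t.1.1) := by
      fun_prop
    exact this.lintegral_prod_right'
  have hn : ∀ n : ℕ, ∀ᵐ p ∂ρB.prod ρR, F (p.1, x p.2) ≤ n →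
      ∫⁻ z, φ (z, p.1, x p.2) * d (p.2, z, p.1) ∂ρZ < ∞ := by
    intro n
    have hs : MeasurableSet {c | F c ≤ n} := measurableSet_le hFm measurable_const
    have hsm : Measurable ({c | F c ≤ n}.indicator (1 : ℬ × 𝓧 → ℝ≥0∞)) :=
      measurable_one.indicator hs
    have e1 := lintegral_map_rnDeriv hR hZ hB hac
      (φ := fun t => {c | F c ≤ n}.indicator 1 (t.2.2, x t.1) * φ (t.2.1, t.2.2, x t.1))
      (by fun_prop)
    have e2 := hkZX.lintegral_eq (fun p => {c | F c ≤ n}.indicator 1 p.2 * φ p) (by fun_prop)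
    simp only [hxR, mul_assoc] at e1 e2
    have e4 : ∫⁻ ω, ∫⁻ z, {c | F c ≤ n}.indicator 1 (B ω, X ω) * (φ (z, B ω, X ω) *
        kZX z (B ω, X ω)) ∂ρZ ∂P ≤ ∫⁻ _, n ∂P := by
      refine lintegral_mono fun ω => ?_
      rw [lintegral_const_mul _ (by fun_prop)]
      by_cases h : F (B ω, X ω) ≤ n
      · rw [Set.indicator_of_mem (show (B ω, X ω) ∈ {c | F c ≤ n} from h), Pi.one_apply, one_mul]
        exact h
      · simp [h]
    rw [← e2, e1] at e4
    have e5 : ∫⁻ p, {c | F c ≤ n}.indicator 1 (p.1, x p.2) *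
        ∫⁻ z, φ (z, p.1, x p.2) * d (p.2, z, p.1) ∂ρZ ∂ρB.prod ρR ≠ ∞ := by
      refine ne_top_of_le_ne_top ?_ (le_of_eq_of_le ?_ e4)
      · simp
      · refine lintegral_congr fun p => ?_
        rw [lintegral_const_mul _ (by fun_prop)]
    filter_upwards [ae_lt_top (by fun_prop) e5] with p hp hle
    simpa [hle] using hp
  -- The event `F (B, X) = ∞` has probability zero, so above almost every point of `{F = ∞}` the
  -- joint density vanishes for almost every `z`.
  have htop : ∀ᵐ p ∂ρB.prod ρR, F (p.1, x p.2) = ∞ → ∫⁻ z, d (p.2, z, p.1) ∂ρZ = 0 := by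
    have hs : MeasurableSet {c | F c = ∞} := hFm (measurableSet_singleton ∞)
    have hsm : Measurable ({c | F c = ∞}.indicator (1 : ℬ × 𝓧 → ℝ≥0∞)) :=
      measurable_one.indicator hs
    have e1 := lintegral_map_rnDeriv hR hZ hB hac
      (φ := fun t => {c | F c = ∞}.indicator 1 (t.2.2, x t.1)) (by fun_prop)
    simp only [hxR] at e1
    have e2 : ∫⁻ ω, {c | F c = ∞}.indicator 1 (B ω, X ω) ∂P = 0 := by
      rw [lintegral_eq_zero_iff (by fun_prop)]
      filter_upwards [ae_of_ae_map (by fun_prop) hfin] with ω hω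
      simp [hF, hω.ne]
    have hm : Measurable fun p : ℬ × 𝓡 => ∫⁻ z, {c | F c = ∞}.indicator 1 (p.1, x p.2) *
        d (p.2, z, p.1) ∂ρZ := by
      have : Measurable fun t : (ℬ × 𝓡) × 𝓩 => {c | F c = ∞}.indicator 1 (t.1.1, x t.1.2) *
        d (t.1.2, t.2, t.1.1) := by fun_prop
      exact this.lintegral_prod_right'
    rw [e2, eq_comm, lintegral_eq_zero_iff hm] at e1
    filter_upwards [e1] with p hp hFp
    simpa [hFp] using hp
  filter_upwards [ae_all_iff.2 hn, htop] with p h1 h2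
  by_cases h : F (p.1, x p.2) = ∞
  · have h3 := h2 h
    rw [lintegral_eq_zero_iff (by fun_prop)] at h3
    have : ∫⁻ z, φ (z, p.1, x p.2) * d (p.2, z, p.1) ∂ρZ = 0 := by
      rw [lintegral_eq_zero_iff (by fun_prop)]
      filter_upwards [h3] with z hz
      simp only [Pi.zero_apply] at hz ⊢
      rw [hz, mul_zero]
    rw [this]
    exact ENNReal.zero_lt_top
  · obtain ⟨n, hn⟩ := ENNReal.exists_nat_gt h
    exact h1 n hn.le

/-- Inverse probability weighting for the potential outcomes `j (g b Y, V, X)`. -/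
theorem lintegral_potential_eq [MeasurableSpace.CountablyGenerated ℬ]
    (hg : Measurable (Function.uncurry g)) (hj : Measurable j)
    (hU : Measurable U) (hV : Measurable V) (hB : Measurable B) (hX : Measurable X)
    (hY : Measurable Y) (hYac : P.map (fun ω => (B ω, Y ω)) ≪ ρB.prod (P.map Y))
    (hRj : ∀ ω, R ω = j (g (B ω) (Y ω), V ω, X ω))
    (hkB : IsCondDensity P ρB B (fun ω => (V ω, U ω, X ω)) fun b t => kB b t.2)
    (hkBm : Measurable (Function.uncurry kB)) (hkBtop : ∀ b t, kB b t ≠ ∞)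
    (hkBV : IsCondDensity P ρB B (fun ω => (U ω, V ω, X ω)) kBV)
    (hkBO : ∀ b, IsCondDensity P ρB B (fun ω => (g b (Y ω), U ω, V ω, X ω)) fun b' t => kBV b' t.2)
    (hpos : ∀ᵐ p ∂ρB.prod (P.map fun ω => (U ω, X ω)), kB p.1 p.2 ≠ 0)
    {ψ : ℬ × 𝓡 → ℝ≥0∞} (hψ : Measurable ψ) :
    ∫⁻ b, ∫⁻ ω, ψ (b, j (g b (Y ω), V ω, X ω)) ∂P ∂ρB =
      ∫⁻ ω, ψ (B ω, R ω) * (kB (B ω) (U ω, X ω))⁻¹ ∂P := by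
  have hg' : Measurable fun p : ℬ × 𝓨 => g p.1 p.2 := hg
  have hkBm' : Measurable fun p : ℬ × 𝓤 × 𝓧 => kB p.1 p.2 := hkBm
  have hC : Measurable fun ω => (U ω, V ω, X ω) := by fun_prop
  have hpC : IsProbabilityMeasure (P.map fun ω => (U ω, V ω, X ω)) :=
    Measure.isProbabilityMeasure_map hC.aemeasurable
  have hpUX : IsProbabilityMeasure (P.map fun ω => (U ω, X ω)) :=
    Measure.isProbabilityMeasure_map (by fun_prop)
  have hkB3 : IsCondDensity P ρB B (fun ω => (U ω, V ω, X ω)) fun b t => kB b (t.1, t.2.2) := by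
    refine ⟨?_, fun ψ hψ => hkB.lintegral_eq (fun p => ψ (p.1, p.2.2.1, p.2.1, p.2.2.2))
      (by fun_prop)⟩
    exact hkBm'.comp (by fun_prop : Measurable fun p : ℬ × 𝓤 × 𝓥 × 𝓧 => (p.1, p.2.1, p.2.2.2))
  -- By uniqueness of conditional densities `p(b | u, v, x) = p(b | u, x)`; this replaces the
  -- density in ignorability by the one that appears in the latent bridge.
  have huniq := hkBV.ae_eq hkB3 hC
  have hkBO' : ∀ b, IsCondDensity P ρB B (fun ω => (g b (Y ω), U ω, V ω, X ω))
      fun b' t => kB b' (t.2.1, t.2.2.2) := by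
    intro b
    have hgb : Measurable fun ω => g b (Y ω) := by fun_prop
    refine (hkBO b).congr (by fun_prop) ?_ ?_
    · exact hkBm'.comp
        (by fun_prop : Measurable fun p : ℬ × 𝓞 × 𝓤 × 𝓥 × 𝓧 => (p.1, p.2.2.1, p.2.2.2.2))
    · have hq : Measure.QuasiMeasurePreserving
          (Prod.map (id : ℬ → ℬ) (Prod.snd : 𝓞 × 𝓤 × 𝓥 × 𝓧 → _))
          (ρB.prod (P.map fun ω => (g b (Y ω), U ω, V ω, X ω)))
          (ρB.prod (P.map fun ω => (U ω, V ω, X ω))) := by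
        refine ⟨by fun_prop, ?_⟩
        rw [← Measure.map_prod_map _ _ measurable_id measurable_snd, Measure.map_id,
          Measure.map_map measurable_snd (by fun_prop)]
        rfl
      exact hq.ae huniq
  -- The test function already carries the weight `1 / p(b | u, x)`, which cancels the density on
  -- the right.
  have hdiag := lintegral_diagonal hg hB hY hC hYac
    (k := fun b t => kB b (t.1, t.2.2)) hkB3.measurable hkBO'
    (ψ := fun p => ψ (p.1, j (p.2.1, p.2.2.2.1, p.2.2.2.2)) * (kB p.1 (p.2.2.1, p.2.2.2.2))⁻¹)
    (by fun_prop)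
  simp only [← hRj] at hdiag
  rw [hdiag, lintegral_lintegral_swap (by fun_prop)]
  have h1 : ∀ᵐ t ∂P.map (fun ω => (U ω, X ω)), ∀ᵐ b ∂ρB, kB b t ≠ 0 :=
    Measure.ae_ae_of_ae_prod (Measure.measurePreserving_swap.quasiMeasurePreserving.ae hpos)
  refine lintegral_congr_ae ?_
  filter_upwards [ae_of_ae_map (by fun_prop) h1] with ω hω
  refine lintegral_congr_ae ?_
  filter_upwards [hω] with b hb
  rw [mul_assoc, ENNReal.inv_mul_cancel hb (hkBtop _ _), mul_one]

/-- The bridge formula for the density of the potential outcomes `j (g b Y, V, X)`. -/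
theorem ae_potential_density_eq [MeasurableSpace.CountablyGenerated ℬ]
    [MeasurableSpace.CountablyGenerated 𝓡]
    (hg : Measurable (Function.uncurry g)) (hj : Measurable j)
    (hU : Measurable U) (hV : Measurable V) (hB : Measurable B) (hX : Measurable X)
    (hZ : Measurable Z)
    (hY : Measurable Y) (hYac : P.map (fun ω => (B ω, Y ω)) ≪ ρB.prod (P.map Y))
    (hRj : ∀ ω, R ω = j (g (B ω) (Y ω), V ω, X ω))
    (hkB : IsCondDensity P ρB B (fun ω => (V ω, U ω, X ω)) fun b t => kB b t.2)
    (hkBm : Measurable (Function.uncurry kB)) (hkBtop : ∀ b t, kB b t ≠ ∞)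
    (hkBV : IsCondDensity P ρB B (fun ω => (U ω, V ω, X ω)) kBV)
    (hkBO : ∀ b, IsCondDensity P ρB B (fun ω => (g b (Y ω), U ω, V ω, X ω)) fun b' t => kBV b' t.2)
    (hpos : ∀ᵐ p ∂ρB.prod (P.map fun ω => (U ω, X ω)), kB p.1 p.2 ≠ 0)
    (hkZm : Measurable (Function.uncurry kZ))
    (hkZ : IsCondDensity P ρZ Z (fun ω => (g (B ω) (Y ω), V ω, B ω, U ω, X ω))
      fun z t => kZ z t.2.2)
    {q : 𝓩 × ℬ × 𝓧 → ℝ} (hq : Measurable q)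
    (hbr : ∀ᵐ t ∂P.map (fun ω => (B ω, U ω, X ω)),
      (kB t.1 t.2)⁻¹ + ∫⁻ z, ENNReal.ofReal (-q (z, t.1, t.2.2)) * kZ z t ∂ρZ =
        ∫⁻ z, ENNReal.ofReal (q (z, t.1, t.2.2)) * kZ z t ∂ρZ)
    (hac : P.map (fun ω => (R ω, Z ω, B ω)) ≪ ρR.prod (ρZ.prod ρB))
    {x : 𝓡 → 𝓧} (hx : Measurable x) (hxR : ∀ ω, x (R ω) = X ω)
    (hkZX : IsCondDensity P ρZ Z (fun ω => (B ω, X ω)) kZX)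
    (hfin : ∀ᵐ c ∂P.map (fun ω => (B ω, X ω)), ∫⁻ z, ‖q (z, c)‖ₑ * kZX z c ∂ρZ < ∞) :
    ∀ᵐ b ∂ρB, P.map (fun ω => j (g b (Y ω), V ω, X ω)) ≪ ρR ∧ ∀ᵐ r ∂ρR,
      Integrable (fun z => q (z, b, x r) *
        density P (ρR.prod (ρZ.prod ρB)) (fun ω => (R ω, Z ω, B ω)) (r, z, b)) ρZ ∧
      ((P.map fun ω => j (g b (Y ω), V ω, X ω)).rnDeriv ρR r).toReal =
        ∫ z, q (z, b, x r) *
          density P (ρR.prod (ρZ.prod ρB)) (fun ω => (R ω, Z ω, B ω)) (r, z, b) ∂ρZ := by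
  have hg' : Measurable fun p : ℬ × 𝓨 => g p.1 p.2 := hg
  have hkZm' : Measurable fun p : 𝓩 × ℬ × 𝓤 × 𝓧 => kZ p.1 p.2 := hkZm
  have hkBm' : Measurable fun p : ℬ × 𝓤 × 𝓧 => kB p.1 p.2 := hkBm
  obtain rfl : R = fun ω => j (g (B ω) (Y ω), V ω, X ω) := funext hRj
  set R : Ω → 𝓡 := fun ω => j (g (B ω) (Y ω), V ω, X ω) with hRdef
  have hR : Measurable R := by fun_prop
  have hpm : IsProbabilityMeasure (P.map fun ω => (R ω, Z ω, B ω)) :=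
    Measure.isProbabilityMeasure_map (by fun_prop)
  have hd := Measure.measurable_rnDeriv (P.map fun ω => (R ω, Z ω, B ω)) (ρR.prod (ρZ.prod ρB))
  have hdtop := Measure.rnDeriv_lt_top (P.map fun ω => (R ω, Z ω, B ω)) (ρR.prod (ρZ.prod ρB))
  have hI := fun (φ : 𝓡 × 𝓩 × ℬ → ℝ≥0∞) (hφ : Measurable φ) =>
    lintegral_map_rnDeriv hR hZ hB hac hφ
  have hfinR := ae_lintegral_rnDeriv_lt_top hR hZ hB hX hac hx hxR hkZX
    (φ := fun p => ‖q p‖ₑ) hq.enorm hfin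
  have hσ : Measure.QuasiMeasurePreserving (fun t : (ℬ × 𝓡) × 𝓩 => (t.1.2, t.2, t.1.1))
      ((ρB.prod ρR).prod ρZ) (ρR.prod (ρZ.prod ρB)) := by
    have h1 := (measurePreserving_prodAssoc ρR ρZ ρB)
    have h2 := (Measure.measurePreserving_swap (μ := ρB) (ν := ρR.prod ρZ))
    exact (h1.comp (h2.comp (measurePreserving_prodAssoc ρB ρR ρZ))).quasiMeasurePreserving
  have hdtop' := Measure.ae_ae_of_ae_prod (hσ.ae hdtop)
  set d := (P.map fun ω => (R ω, Z ω, B ω)).rnDeriv (ρR.prod (ρZ.prod ρB)) with hddef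
  -- the positive and negative parts of the right hand side
  have key : ∀ f : ℝ → ℝ, Measurable f → ∀ ψ : ℬ × 𝓡 → ℝ≥0∞, Measurable ψ →
      ∫⁻ ω, ψ (B ω, R ω) * ∫⁻ z, ENNReal.ofReal (f (q (z, B ω, X ω))) * kZ z (B ω, U ω, X ω) ∂ρZ ∂P =
      ∫⁻ p, ψ p * ∫⁻ z, ENNReal.ofReal (f (q (z, p.1, x p.2))) * d (p.2, z, p.1) ∂ρZ
        ∂ρB.prod ρR := by
    intro f hf ψ hψ
    have e1 := hkZ.lintegral_eq (fun p => ψ (p.2.2.2.1, j (p.2.1, p.2.2.1, p.2.2.2.2.2)) *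
      ENNReal.ofReal (f (q (p.1, p.2.2.2.1, p.2.2.2.2.2)))) (by fun_prop)
    have e2 := hI (fun t => ψ (t.2.2, t.1) * ENNReal.ofReal (f (q (t.2.1, t.2.2, x t.1))))
      (by fun_prop)
    simp only [hxR, mul_assoc] at e1 e2
    have e3 := e1.symm.trans e2
    refine Eq.trans (lintegral_congr fun ω => ?_) (e3.trans (lintegral_congr fun p => ?_))
    · rw [lintegral_const_mul _ (by fun_prop)]
    · rw [lintegral_const_mul _ (by fun_prop)]
  have hfm : ∀ f : ℝ → ℝ, Measurable f → Measurable fun p : ℬ × 𝓡 =>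
      ∫⁻ z, ENNReal.ofReal (f (q (z, p.1, x p.2))) * d (p.2, z, p.1) ∂ρZ := by
    intro f hf
    have : Measurable fun t : (ℬ × 𝓡) × 𝓩 => ENNReal.ofReal (f (q (t.2, t.1.1, x t.1.2))) *
      d (t.1.2, t.2, t.1.1) := by fun_prop
    exact this.lintegral_prod_right'
  set fp : ℬ × 𝓡 → ℝ≥0∞ := fun p =>
    ∫⁻ z, ENNReal.ofReal (q (z, p.1, x p.2)) * d (p.2, z, p.1) ∂ρZ with hfp
  set fn : ℬ × 𝓡 → ℝ≥0∞ := fun p =>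
    ∫⁻ z, ENNReal.ofReal (-q (z, p.1, x p.2)) * d (p.2, z, p.1) ∂ρZ with hfn
  have hfpm : Measurable fp := hfm (fun y => y) measurable_id
  have hfnm : Measurable fn := hfm (fun y => -y) measurable_neg
  -- The latent bridge equation multiplied by `ψ(B, R)` and integrated, with the negative part of
  -- `q` on the left so that no subtraction occurs.
  have hsum : ∀ ψ : ℬ × 𝓡 → ℝ≥0∞, Measurable ψ →
      ∫⁻ b, ∫⁻ ω, ψ (b, j (g b (Y ω), V ω, X ω)) ∂P ∂ρB + ∫⁻ p, ψ p * fn p ∂ρB.prod ρR =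
        ∫⁻ p, ψ p * fp p ∂ρB.prod ρR := by
    intro ψ hψ
    rw [lintegral_potential_eq (R := R) hg hj hU hV hB hX hY hYac (fun _ => rfl) hkB hkBm hkBtop
      hkBV hkBO hpos hψ, ← key (fun y => y) measurable_id ψ hψ,
      ← key (fun y => -y) measurable_neg ψ hψ, ← lintegral_add_left (by fun_prop)]
    refine lintegral_congr_ae ?_
    filter_upwards [ae_of_ae_map (by fun_prop) hbr] with ω hω
    rw [← mul_add, hω]
  -- the joint measure of `b` and the potential outcomes
  have hh : Measurable fun p : ℬ × Ω => (p.1, j (g p.1 (Y p.2), V p.2, X p.2)) := by fun_prop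
  set Λ : Measure (ℬ × 𝓡) := (ρB.prod P).map fun p => (p.1, j (g p.1 (Y p.2), V p.2, X p.2))
    with hΛ
  have hΛi : ∀ ψ : ℬ × 𝓡 → ℝ≥0∞, Measurable ψ → ∫⁻ p, ψ p ∂Λ =
      ∫⁻ b, ∫⁻ ω, ψ (b, j (g b (Y ω), V ω, X ω)) ∂P ∂ρB := by
    intro ψ hψ
    rw [hΛ, lintegral_map hψ hh, lintegral_prod _ (by fun_prop)]
  -- Applying `hsum` to the indicator of a null set makes the right side vanish, and with it both
  -- nonnegative terms on the left. The existence of an output density is thus a conclusion.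
  have hΛac : Λ ≪ ρB.prod ρR := by
    refine Measure.AbsolutelyContinuous.mk fun s hs h0 => ?_
    have hsm : Measurable (s.indicator (1 : ℬ × 𝓡 → ℝ≥0∞)) := measurable_one.indicator hs
    have h1 := hsum _ hsm
    have h2 : ∫⁻ p, s.indicator 1 p * fp p ∂ρB.prod ρR = 0 := by
      rw [lintegral_eq_zero_iff (by fun_prop)]
      filter_upwards [measure_eq_zero_iff_ae_notMem.1 h0] with p hp
      simp [hp]
    rw [h2, ← hΛi _ hsm, lintegral_indicator_one hs] at h1
    exact (add_eq_zero.1 h1).1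
  have hlm := Measure.measurable_rnDeriv Λ (ρB.prod ρR)
  have hΛd := Measure.withDensity_rnDeriv_eq _ _ hΛac
  set l := Λ.rnDeriv (ρB.prod ρR) with hl
  have hΛl : ∀ ψ : ℬ × 𝓡 → ℝ≥0∞, Measurable ψ →
      ∫⁻ b, ∫⁻ ω, ψ (b, j (g b (Y ω), V ω, X ω)) ∂P ∂ρB = ∫⁻ p, ψ p * l p ∂ρB.prod ρR := by
    intro ψ hψ
    rw [← hΛi ψ hψ, ← hΛd, lintegral_withDensity_eq_lintegral_mul _ hlm hψ]
    exact lintegral_congr fun p => mul_comm _ _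
  have hlf : ∀ᵐ p ∂ρB.prod ρR, l p + fn p = fp p := by
    refine ae_eq_of_forall_setLIntegral_eq_of_sigmaFinite (hlm.add hfnm) hfpm fun s hs _ => ?_
    have hsm : Measurable (s.indicator (1 : ℬ × 𝓡 → ℝ≥0∞)) := measurable_one.indicator hs
    have aux : ∀ f : ℬ × 𝓡 → ℝ≥0∞, ∫⁻ p in s, f p ∂ρB.prod ρR =
        ∫⁻ p, s.indicator 1 p * f p ∂ρB.prod ρR := by
      intro f
      rw [← lintegral_indicator hs]
      refine lintegral_congr fun p => ?_
      by_cases hp : p ∈ s <;> simp [hp]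
    rw [aux, aux, ← hsum _ hsm, hΛl _ hsm, ← lintegral_add_left (by fun_prop)]
    exact lintegral_congr fun p => mul_add _ _ _
  have hdis := ae_eq_withDensity_of_lintegral_eq
    (h := fun b ω => j (g b (Y ω), V ω, X ω)) (by fun_prop) hlm hΛl
  filter_upwards [hdis, Measure.ae_ae_of_ae_prod hlf, Measure.ae_ae_of_ae_prod hfinR,
    Measure.ae_ae_of_ae_prod hdtop'] with b hb1 hb2 hb3 hb4
  rw [hb1]
  refine ⟨withDensity_absolutelyContinuous _ _, ?_⟩
  have hlb : Measurable fun r => l (b, r) := hlm.comp measurable_prodMk_left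
  filter_upwards [Measure.rnDeriv_withDensity ρR hlb, hb2, hb3, hb4]
    with r hr1 hr2 hr3 hr4
  obtain ⟨hp, hn⟩ := lintegral_ofReal_mul_lt_top hr3
  have h4 := integral_mul_toReal_eq (ρ := ρZ) (f := fun z => q (z, b, x r))
    (κ := fun z => d (r, z, b)) (by fun_prop) (by fun_prop) (hr4.mono fun z hz => hz.ne) hp hn
  refine ⟨h4.1, ?_⟩
  refine Eq.trans ?_ h4.2.symm
  -- Both parts of the bridge integral are finite here, so `l + fn = fp` may be solved for `l` in
  -- the reals.
  have hl' : l (b, r) ≠ ∞ := ne_top_of_le_ne_top hp.ne (le_of_le_of_eq le_self_add hr2)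
  rw [hr1]
  have h5 := congrArg ENNReal.toReal hr2
  rw [ENNReal.toReal_add hl' hn.ne] at h5
  exact eq_sub_of_add_eq h5

end Bridge

/-! ### Marginals and rearrangements of dominated laws. -/

section Qmp

variable {Ω α β γ δ : Type*} [MeasurableSpace Ω] [MeasurableSpace α] [MeasurableSpace β]
  [MeasurableSpace γ] [MeasurableSpace δ]

theorem map_comp_absolutelyContinuous {P : Measure Ω} {T : Ω → α} {τ : Measure α}
    {σ : Measure β} {f : α → β} (h : P.map T ≪ τ) (hT : Measurable T)
    (hf : Measure.QuasiMeasurePreserving f τ σ) : P.map (fun ω => f (T ω)) ≪ σ := by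
  have := (h.map hf.measurable).trans hf.absolutelyContinuous
  rwa [Measure.map_map hf.measurable hT] at this

variable (ρ : Measure α) [SigmaFinite ρ] (σ : Measure β) [SigmaFinite σ] (τ : Measure γ)
  [SigmaFinite τ]

theorem quasiMeasurePreserving_swap_left : Measure.QuasiMeasurePreserving
    (fun p : α × β × γ => (p.2.1, p.1, p.2.2)) (ρ.prod (σ.prod τ)) (σ.prod (ρ.prod τ)) := by
  have h1 := ((measurePreserving_prodAssoc ρ σ τ).symm MeasurableEquiv.prodAssoc)
  have h2 := (Measure.measurePreserving_swap (μ := ρ) (ν := σ)).prod (MeasurePreserving.id τ)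
  exact ((measurePreserving_prodAssoc σ ρ τ).comp (h2.comp h1)).quasiMeasurePreserving

variable {ρ σ τ}

theorem quasiMeasurePreserving_map_right {f : β → γ}
    (hf : Measure.QuasiMeasurePreserving f σ τ) : Measure.QuasiMeasurePreserving
    (fun p : α × β => (p.1, f p.2)) (ρ.prod σ) (ρ.prod τ) :=
  MeasureTheory.QuasiMeasurePreserving.prodMap (Measure.QuasiMeasurePreserving.id ρ) hf

end Qmp

/-! ### The bridge formula from the conditional independence assumptions. -/

section Bridge

variable {Ω 𝓤 𝓥 𝓦 𝓞 𝓡 𝓨 𝓩 ℬ 𝓧 : Type*} [MeasurableSpace Ω] [MeasurableSpace 𝓤]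
  [MeasurableSpace 𝓥] [MeasurableSpace 𝓦]
  [MeasurableSpace 𝓞] [MeasurableSpace 𝓡] [MeasurableSpace 𝓨]
  [MeasurableSpace 𝓩] [MeasurableSpace ℬ] [MeasurableSpace 𝓧]
  {P : Measure Ω} [IsProbabilityMeasure P]
  {ρU : Measure 𝓤} [SigmaFinite ρU] {ρV : Measure 𝓥} [SigmaFinite ρV]
  {ρW : Measure 𝓦} [SigmaFinite ρW] {ρR : Measure 𝓡} [SigmaFinite ρR]
  {ρZ : Measure 𝓩} [SigmaFinite ρZ] {ρB : Measure ℬ} [SigmaFinite ρB]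
  {ρX : Measure 𝓧} [SigmaFinite ρX]
  {U : Ω → 𝓤} {V : Ω → 𝓥} {W : Ω → 𝓦} {Z : Ω → 𝓩} {B : Ω → ℬ} {X : Ω → 𝓧} {Y : Ω → 𝓨}
  {R : Ω → 𝓡} {g : ℬ → 𝓨 → 𝓞} {j : 𝓞 × 𝓥 × 𝓧 → 𝓡}

/-- Consequences of `W ⫫ (Z, B) | U, X` for the conditional densities of `Z` and `B`. -/
theorem isCondDensity_of_condIndep
    (hU : Measurable U) (hW : Measurable W) (hB : Measurable B) (hX : Measurable X)
    (hZ : Measurable Z)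
    (hac : P.map (fun ω => (Z ω, W ω, B ω, U ω, X ω)) ≪
      ρZ.prod (ρW.prod (ρB.prod (ρU.prod ρX))))
    (hI : CondIndepRV P W (fun ω => (Z ω, B ω)) fun ω => (U ω, X ω)) :
    IsCondDensity P ρB B (fun ω => (W ω, U ω, X ω))
      (fun b t => eCondDensity P ρB (ρU.prod ρX) B (fun ω => (U ω, X ω)) b t.2) ∧
    IsCondDensity P ρZ Z (fun ω => (W ω, B ω, U ω, X ω))
      (fun z t => eCondDensity P ρZ (ρB.prod (ρU.prod ρX)) Z (fun ω => (B ω, U ω, X ω)) z t.2) := by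
  have hM : Measurable fun ω => (Z ω, W ω, B ω, U ω, X ω) := by fun_prop
  have hZBUX := map_comp_absolutelyContinuous hac hM
    (Measure.quasiMeasurePreserving_snd.comp (quasiMeasurePreserving_swap_left _ _ _))
  have hBUX := map_snd_absolutelyContinuous hZ (by fun_prop) hZBUX
  have hWBUX := map_snd_absolutelyContinuous hZ (by fun_prop) hac
  have hWUX := map_comp_absolutelyContinuous hWBUX (by fun_prop)
    (quasiMeasurePreserving_map_right Measure.quasiMeasurePreserving_snd)
  have hkB := isCondDensity_eCondDensity hB (by fun_prop) hBUX
  have hkZ := isCondDensity_eCondDensity hZ (by fun_prop) hZBUX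
  have hkW := isCondDensity_eCondDensity hW (by fun_prop) hWUX
  refine ⟨?_, ?_⟩
  -- For `B` it suffices to forget `Z`. For `Z`, weak union moves `B` into the conditioning.
  · refine CondIndepRV.isCondDensity ?_ hB hW (by fun_prop) hkB
    exact hI.symm.comp_left measurable_snd
  · exact (hI.isCondDensity hW (by fun_prop) (by fun_prop) hkW).weakUnion hkZ
      (measurable_eCondDensity _ _ _ _ _)

/-- The bridge formula for the density of the potential outcomes `j (g b Y, V, X)`, under
conditional independences, completeness, positivity and the bridge equation. -/
theorem ae_potential_density_eq_of_condIndep [MeasurableSpace.CountablyGenerated ℬ]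
    [MeasurableSpace.CountablyGenerated 𝓡]
    (hg : Measurable (Function.uncurry g)) (hj : Measurable j)
    (hU : Measurable U) (hV : Measurable V) (hW : Measurable W) (hB : Measurable B)
    (hX : Measurable X) (hZ : Measurable Z)
    (hY : Measurable Y) (hYac : P.map (fun ω => (B ω, Y ω)) ≪ ρB.prod (P.map Y))
    (hRj : ∀ ω, R ω = j (g (B ω) (Y ω), V ω, X ω))
    {x : 𝓡 → 𝓧} (hx : Measurable x) (hxR : ∀ ω, x (R ω) = X ω)
    {v : 𝓦 → 𝓥} (hv : Measurable v) (hvW : ∀ ω, v (W ω) = V ω)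
    (hacW : P.map (fun ω => (Z ω, W ω, B ω, U ω, X ω)) ≪
      ρZ.prod (ρW.prod (ρB.prod (ρU.prod ρX))))
    (hacV : P.map (fun ω => (Z ω, V ω, B ω, U ω, X ω)) ≪
      ρZ.prod (ρV.prod (ρB.prod (ρU.prod ρX))))
    (hacR : P.map (fun ω => (R ω, Z ω, B ω)) ≪ ρR.prod (ρZ.prod ρB))
    (hI1 : ∀ b, CondIndepRV P (fun ω => g b (Y ω)) B fun ω => (U ω, V ω, X ω))
    (hI2 : CondIndepRV P W (fun ω => (Z ω, B ω)) fun ω => (U ω, X ω))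
    (hI3 : CondIndepRV P (fun ω => g (B ω) (Y ω)) Z fun ω => (V ω, B ω, U ω, X ω))
    (hcomp : ∀ᵐ c ∂P.map (fun ω => (B ω, X ω)), ∀ g : 𝓤 → ℝ, MemLp g 2 (P.map U) →
      (∀ᵐ w ∂P.map W, Integrable (fun u => g u * condDensity P ρU (ρB.prod (ρW.prod ρX)) U
          (fun ω => (B ω, W ω, X ω)) u (c.1, w, c.2)) ρU ∧
        ∫ u, g u * condDensity P ρU (ρB.prod (ρW.prod ρX)) U
          (fun ω => (B ω, W ω, X ω)) u (c.1, w, c.2) ∂ρU = 0) → ∀ᵐ u ∂P.map U, g u = 0)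
    (hpos : ∀ᵐ b ∂ρB, ∀ᵐ c ∂P.map (fun ω => (W ω, X ω)),
      0 < condDensity P ρB (ρW.prod ρX) B (fun ω => (W ω, X ω)) b c)
    {q : 𝓩 × ℬ × 𝓧 → ℝ} (hq : Measurable q)
    (hqint : ∀ᵐ c ∂P.map (fun ω => (B ω, X ω)), Integrable (fun z => q (z, c) *
      condDensity P ρZ (ρB.prod ρX) Z (fun ω => (B ω, X ω)) z c) ρZ)
    (hbridge : ∀ᵐ c ∂P.map (fun ω => (W ω, B ω, X ω)),
      ∫ z, q (z, c.2) * condDensity P ρZ (ρW.prod (ρB.prod ρX)) Z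
        (fun ω => (W ω, B ω, X ω)) z c ∂ρZ =
      1 / condDensity P ρB (ρW.prod ρX) B (fun ω => (W ω, X ω)) c.2.1 (c.1, c.2.2))
    (hsq : ∀ᵐ c ∂P.map (fun ω => (B ω, X ω)), MemLp (fun u =>
      1 / condDensity P ρB (ρU.prod ρX) B (fun ω => (U ω, X ω)) c.1 (u, c.2) -
      ∫ z, q (z, c) * condDensity P ρZ (ρB.prod (ρU.prod ρX)) Z
        (fun ω => (B ω, U ω, X ω)) z (c.1, u, c.2) ∂ρZ) 2 (P.map U)) :
    ∀ᵐ b ∂ρB, P.map (fun ω => j (g b (Y ω), V ω, X ω)) ≪ ρR ∧ ∀ᵐ r ∂ρR,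
      Integrable (fun z => q (z, b, x r) *
        density P (ρR.prod (ρZ.prod ρB)) (fun ω => (R ω, Z ω, B ω)) (r, z, b)) ρZ ∧
      ((P.map fun ω => j (g b (Y ω), V ω, X ω)).rnDeriv ρR r).toReal =
        ∫ z, q (z, b, x r) *
          density P (ρR.prod (ρZ.prod ρB)) (fun ω => (R ω, Z ω, B ω)) (r, z, b) ∂ρZ := by
  have hg' : Measurable fun p : ℬ × 𝓨 => g p.1 p.2 := hg
  have hMW : Measurable fun ω => (Z ω, W ω, B ω, U ω, X ω) := by fun_prop
  have hMV : Measurable fun ω => (Z ω, V ω, B ω, U ω, X ω) := by fun_prop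
  -- marginal densities
  have aZBUX := map_comp_absolutelyContinuous hacW hMW
    (Measure.quasiMeasurePreserving_snd.comp (quasiMeasurePreserving_swap_left _ _ _))
  have aBUX := map_snd_absolutelyContinuous hZ (by fun_prop) aZBUX
  have aUX := map_snd_absolutelyContinuous hB (by fun_prop) aBUX
  have aZWBX := map_comp_absolutelyContinuous hacW hMW
    (quasiMeasurePreserving_map_right (quasiMeasurePreserving_map_right
      (quasiMeasurePreserving_map_right Measure.quasiMeasurePreserving_snd)))
  have aZBX := map_comp_absolutelyContinuous aZBUX (by fun_prop)
    (quasiMeasurePreserving_map_right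
      (quasiMeasurePreserving_map_right Measure.quasiMeasurePreserving_snd))
  have aBX := map_snd_absolutelyContinuous hZ (by fun_prop) aZBX
  have aWBX := map_snd_absolutelyContinuous hZ (by fun_prop) aZWBX
  have aBWX := map_comp_absolutelyContinuous aWBX (by fun_prop)
    (quasiMeasurePreserving_swap_left _ _ _)
  have aWBUX := map_snd_absolutelyContinuous hZ (by fun_prop) hacW
  have aW := map_comp_absolutelyContinuous aWBUX (by fun_prop) Measure.quasiMeasurePreserving_fst
  have aUBWX := map_comp_absolutelyContinuous aWBUX (by fun_prop)
    ((quasiMeasurePreserving_map_right (quasiMeasurePreserving_swap_left _ _ _)).comp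
      ((quasiMeasurePreserving_swap_left _ _ _).comp
        (quasiMeasurePreserving_map_right (quasiMeasurePreserving_swap_left _ _ _))))
  have aVBUX := map_snd_absolutelyContinuous hZ (by fun_prop) hacV
  have aBUVX := map_comp_absolutelyContinuous aVBUX (by fun_prop)
    ((quasiMeasurePreserving_map_right (quasiMeasurePreserving_swap_left _ _ _)).comp
      (quasiMeasurePreserving_swap_left _ _ _))
  -- conditional densities
  obtain ⟨hkB, hkZ⟩ := isCondDensity_of_condIndep hU hW hB hX hZ hacW hI2
  -- `V` is a function of the proxies `W` and inherits their independence, which later removes it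
  -- from the densities of `B` and `Z`.
  have hI2V : CondIndepRV P V (fun ω => (Z ω, B ω)) fun ω => (U ω, X ω) := by
    obtain rfl : (fun ω => v (W ω)) = V := funext hvW
    exact hI2.comp_left hv
  obtain ⟨hkBV, hkZV⟩ := isCondDensity_of_condIndep hU hV hB hX hZ hacV hI2V
  have hkBW := isCondDensity_eCondDensity hB (by fun_prop) aBWX
  have hkZW := isCondDensity_eCondDensity hZ (by fun_prop) aZWBX
  have hkZX := isCondDensity_eCondDensity hZ (by fun_prop) aZBX
  have hkBUVX := isCondDensity_eCondDensity hB (by fun_prop) aBUVX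
  have hkZVBUX := isCondDensity_eCondDensity hZ (by fun_prop) hacV
  have hkZm := measurable_eCondDensity P ρZ (ρB.prod (ρU.prod ρX)) Z (fun ω => (B ω, U ω, X ω))
  have hpWX : IsProbabilityMeasure (P.map fun ω => (W ω, X ω)) :=
    Measure.isProbabilityMeasure_map (by fun_prop)
  have hposBW : ∀ᵐ p ∂ρB.prod (P.map fun ω => (W ω, X ω)),
      eCondDensity P ρB (ρW.prod ρX) B (fun ω => (W ω, X ω)) p.1 p.2 ≠ 0 := by
    refine (Measure.ae_prod_iff_ae_ae
      (hkBW.measurable (measurableSet_singleton 0).compl)).2 ?_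
    filter_upwards [hpos] with b hb
    filter_upwards [hb] with c hc
    exact (ENNReal.ofReal_pos.2 hc).ne'
  simp only [← eCondDensity_toReal P ρZ, ← eCondDensity_toReal P ρB] at hqint hbridge hsq
  obtain ⟨hposB, hbr⟩ := ae_inv_condDensity_eq_bridge aUBWX aW aBX aUX hU hW hB hX
    hkB (measurable_eCondDensity _ _ _ _ _) (fun _ _ => ENNReal.ofReal_ne_top)
    hkZ hkZm (fun _ _ => ENNReal.ofReal_ne_top)
    hkBW (fun _ _ => ENNReal.ofReal_ne_top) hkZW (fun _ _ => ENNReal.ofReal_ne_top)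
    hkZX (fun _ _ => ENNReal.ofReal_ne_top) hposBW hcomp hq hqint hbridge hsq
  -- The treatment proxy condition removes the outcome from the conditional density of `Z`, and the
  -- outcome proxy condition removes `V`; uniqueness identifies the two versions.
  have hkZO : IsCondDensity P ρZ Z (fun ω => (g (B ω) (Y ω), V ω, B ω, U ω, X ω)) fun z t =>
      eCondDensity P ρZ (ρB.prod (ρU.prod ρX)) Z (fun ω => (B ω, U ω, X ω)) z t.2.2 := by
    have h1 := hI3.symm.isCondDensity hZ (by fun_prop) (by fun_prop) hkZVBUX
    have h2 := hkZVBUX.ae_eq hkZV (by fun_prop)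
    have hO : Measurable fun ω => g (B ω) (Y ω) := by fun_prop
    refine h1.congr (by fun_prop) ?_ ?_
    · exact hkZm.comp
        (by fun_prop : Measurable fun p : 𝓩 × 𝓞 × 𝓥 × ℬ × 𝓤 × 𝓧 => (p.1, p.2.2.2))
    · have hpT : IsProbabilityMeasure (P.map fun ω => (V ω, B ω, U ω, X ω)) :=
        Measure.isProbabilityMeasure_map (by fun_prop)
      have hpT' : IsProbabilityMeasure (P.map fun ω => (g (B ω) (Y ω), V ω, B ω, U ω, X ω)) :=
        Measure.isProbabilityMeasure_map (by fun_prop)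
      have hq' : Measure.QuasiMeasurePreserving
          (Prod.snd : 𝓞 × 𝓥 × ℬ × 𝓤 × 𝓧 → _)
          (P.map fun ω => (g (B ω) (Y ω), V ω, B ω, U ω, X ω))
          (P.map fun ω => (V ω, B ω, U ω, X ω)) := by
        refine ⟨by fun_prop, ?_⟩
        rw [Measure.map_map measurable_snd (by fun_prop)]
        rfl
      exact (quasiMeasurePreserving_map_right hq').ae h2
  have hfin : ∀ᵐ c ∂P.map (fun ω => (B ω, X ω)), ∫⁻ z, ‖q (z, c)‖ₑ *
      eCondDensity P ρZ (ρB.prod ρX) Z (fun ω => (B ω, X ω)) z c ∂ρZ < ∞ := by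
    filter_upwards [hqint] with c hc
    refine lt_of_eq_of_lt (lintegral_congr fun z => ?_) hc.2
    rw [enorm_mul, Real.enorm_of_nonneg ENNReal.toReal_nonneg,
      ENNReal.ofReal_toReal (show eCondDensity _ _ _ _ _ _ _ ≠ ∞ from ENNReal.ofReal_ne_top)]
  refine ae_potential_density_eq hg hj hU hV hB hX hZ hY hYac hRj hkBV
    (measurable_eCondDensity _ _ _ _ _) (fun _ _ => ENNReal.ofReal_ne_top) hkBUVX
    (fun b => ?_) hposB hkZm hkZO hq hbr hacR hx hxR hkZX hfin
  exact (hI1 b).symm.isCondDensity hB (by fun_prop) (by fun_prop) hkBUVX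

end Bridge

/-! ### Directed paths and descendants. -/

namespace HiddenDAG

variable {ν υ : Type*} (G : HiddenDAG ν υ)

/-- `k` can be reached from the observed vertex `b` along a directed path of `G` that does not
return to `T`. -/
def Reaches (T : Finset ν) (b : ν) (k : ν ⊕ υ) : Prop :=
  Relation.ReflTransGen (fun x y => G.Edge x y ∧ ∀ i ∈ T, y ≠ Sum.inl i) (Sum.inl b) k

variable {G}

/-- A path from `b` to one of its parents would close a directed cycle. -/
theorem not_reaches_of_edge {T : Finset ν} {b : ν} {j : ν ⊕ υ} (h : G.Edge j (Sum.inl b)) :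
    ¬ G.Reaches T b j := fun hj =>
  G.acyclic _ (Relation.TransGen.tail'
    (Relation.ReflTransGen.mono (fun _ _ (h : G.Edge _ _ ∧ _) => h.1) _ _ hj) h)

/-- Cut the path at each visit to `A ∪ S`. Every piece is an edge of the projection, and none of
these edges is deleted because the path never enters `S`. -/
theorem mem_de_of_reaches [Fintype ν] [DecidableEq ν] {A S : Finset ν} {b c : ν}
    (hb : b ∈ A) (hc : c ∈ A) (h : G.Reaches S b (Sum.inl c)) : c ∈ G.de A S b := by
  have key : ∀ k, G.Reaches S b k → ∃ a ∈ A ∪ S, Relation.ReflTransGen (G.CADMGEdge A S) b a ∧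
      Relation.ReflTransGen (fun x y => G.Edge x y ∧ ∀ i ∈ A ∪ S, y ≠ Sum.inl i) (Sum.inl a) k := by
    intro k hk
    induction hk with
    | refl => exact ⟨b, Finset.mem_union_left _ hb, .refl, .refl⟩
    | @tail k l _ hkl ih =>
      obtain ⟨a, ha, hba, hak⟩ := ih
      by_cases hl : ∃ i ∈ A ∪ S, l = Sum.inl i
      · obtain ⟨i, hi, rfl⟩ := hl
        exact ⟨i, hi, hba.tail ⟨⟨ha, hi, k, hak, hkl.1⟩, fun hiS => hkl.2 i hiS rfl⟩, .refl⟩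
      · push Not at hl
        exact ⟨a, ha, hba, hak.tail ⟨hkl.1, hl⟩⟩
  obtain ⟨a, _, hba, hac⟩ := key _ h
  -- The remaining piece has no later vertex in `A ∪ S` but ends in `c ∈ A`, so it must be trivial.
  obtain hac | ⟨k, _, hk⟩ := Relation.ReflTransGen.cases_tail hac
  · obtain rfl := Sum.inl_injective hac
    simp only [de, Finset.mem_filter, Finset.mem_univ, true_and]
    convert! hba
  · exact absurd rfl (hk.2 c (Finset.mem_union_left _ hc))

end HiddenDAG

/-! ### Solutions of the structural equations as functions of the errors. -/

namespace NPSEM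

attribute [local instance] NPSEM.measE NPSEM.isProb

variable {ν υ : Type*} [Finite ν] [Finite υ] [DecidableEq ν] {G : HiddenDAG ν υ}
  {𝒳 : ν → Type u} {𝒰 : υ → Type u}
  [∀ i, MeasurableSpace (𝒳 i)] [∀ j, MeasurableSpace (𝒰 j)]
  {Ω : Type*} [MeasurableSpace Ω] (M : NPSEM G 𝒳 𝒰 Ω)

/-- The solution of the structural equations after `do(T = t)`, as a function of the errors. -/
noncomputable def solve (T : Finset ν) (t : ∀ i, 𝒳 i) (e : ∀ k, M.E k) : ∀ k, State 𝒳 𝒰 k :=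
  G.wf.fix fun k rec =>
    match k, rec with
    | Sum.inl i, rec =>
        if i ∈ T then t i else M.f (Sum.inl i) (fun j => rec j j.2) (e (Sum.inl i))
    | Sum.inr j, rec => M.f (Sum.inr j) (fun l => rec l l.2) (e (Sum.inr j))

theorem solve_of_mem {T : Finset ν} (t : ∀ i, 𝒳 i) (e : ∀ k, M.E k) {i : ν} (hi : i ∈ T) :
    M.solve T t e (Sum.inl i) = t i := by
  unfold solve
  rw [WellFounded.fix_eq]
  exact if_pos hi

theorem solve_of_ne {T : Finset ν} (t : ∀ i, 𝒳 i) (e : ∀ k, M.E k) {k : ν ⊕ υ}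
    (hk : ∀ i ∈ T, k ≠ Sum.inl i) :
    M.solve T t e k = M.f k (fun j => M.solve T t e j) (e k) := by
  unfold solve
  rw [WellFounded.fix_eq]
  cases k with
  | inl i => exact if_neg fun hi => hk i hi rfl
  | inr j => rfl

/-- The value that the solution after `do(T = t)` gives to an observed vertex. -/
noncomputable def solveVar (T : Finset ν) (t : ∀ i, 𝒳 i) (i : ν) (e : ∀ k, M.E k) : 𝒳 i :=
  M.solve T t e (Sum.inl i)

variable {M}

/-- Uniqueness of the solution of the structural equations, on a set `p` of vertices that contains
the parents of all vertices at which agreement is not known yet. -/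
theorem eq_solve {T : Finset ν} {t : ∀ i, 𝒳 i} {e : ∀ k, M.E k} {φ : ∀ k, State 𝒳 𝒰 k}
    {p : ν ⊕ υ → Prop}
    (h : ∀ k, p k → φ k = M.solve T t e k ∨ (∀ i ∈ T, k ≠ Sum.inl i) ∧
      φ k = M.f k (fun j => φ j) (e k) ∧ ∀ j, G.Edge j k → p j) :
    ∀ k, p k → φ k = M.solve T t e k := by
  intro k
  induction k using G.wf.induction with
  | _ k ih =>
  intro hk
  obtain h | ⟨h1, h2, h3⟩ := h k hk
  · exact h
  · rw [h2, M.solve_of_ne t e h1]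
    congr 1
    funext j
    exact ih j j.2 (h3 j j.2)

theorem potential_eq_solve (T : Finset ν) (t : ∀ i, 𝒳 i) (ω : Ω) :
    M.potential T t ω = M.solve T t fun k => M.ε k ω := by
  funext k
  refine eq_solve (p := fun _ => True) (fun k _ => ?_) k trivial
  cases k with
  | inl i =>
    by_cases hi : i ∈ T
    · left
      exact (potential_inl ..).trans ((if_pos hi).trans (solve_of_mem _ _ _ hi).symm)
    · right
      refine ⟨fun i' hi' h => hi (Sum.inl_injective h ▸ hi'), ?_, fun _ _ => trivial⟩
      exact (potential_inl ..).trans (if_neg hi)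
  | inr j => exact Or.inr ⟨fun _ _ => Sum.inr_ne_inl, potential_inr .., fun _ _ => trivial⟩

/-- The error of a vertex that is intervened on is irrelevant. -/
theorem solve_congr_error {T : Finset ν} {b : ν} (hb : b ∈ T) (t : ∀ i, 𝒳 i)
    {e e' : ∀ k, M.E k} (h : ∀ k, k ≠ Sum.inl b → e k = e' k) :
    M.solve T t e = M.solve T t e' := by
  funext k
  refine eq_solve (p := fun _ => True) (fun k _ => ?_) k trivial
  by_cases hk : ∀ i ∈ T, k ≠ Sum.inl i
  · refine Or.inr ⟨hk, ?_, fun _ _ => trivial⟩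
    rw [solve_of_ne _ _ _ hk, h k (hk b hb)]
  · push Not at hk
    obtain ⟨i, hi, rfl⟩ := hk
    left
    rw [solve_of_mem _ _ _ hi, solve_of_mem _ _ _ hi]

/-- Consistency: intervening with the natural value changes nothing. -/
theorem solve_eq_solve_insert {T : Finset ν} {b : ν} (hb : b ∉ T) (t : ∀ i, 𝒳 i)
    (e : ∀ k, M.E k) : M.solve T t e =
      M.solve (insert b T) (Function.update t b (M.solveVar T t b e)) e := by
  funext k
  refine eq_solve (p := fun _ => True) (fun k _ => ?_) k trivial
  by_cases hk : ∀ i ∈ insert b T, k ≠ Sum.inl i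
  · refine Or.inr ⟨hk, ?_, fun _ _ => trivial⟩
    exact solve_of_ne _ _ _ fun i hi => hk i (Finset.mem_insert_of_mem hi)
  · push Not at hk
    obtain ⟨i, hi, rfl⟩ := hk
    left
    rw [solve_of_mem _ _ _ hi]
    by_cases hib : i = b
    · subst hib
      exact (Function.update_self i (M.solveVar T t i e) t).symm
    · exact (solve_of_mem _ _ _ (Finset.mem_of_mem_insert_of_ne hi hib)).trans
        (Function.update_of_ne hib _ _).symm

/-- An intervention on `b` does not affect the vertices that cannot be reached from `b`. -/
theorem solve_eq_solve_insert_of_not_reaches {T : Finset ν} {b : ν} (t : ∀ i, 𝒳 i)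
    (c : 𝒳 b) (e : ∀ k, M.E k) {k : ν ⊕ υ} (hk : ¬ G.Reaches T b k) :
    M.solve T t e k = M.solve (insert b T) (Function.update t b c) e k := by
  refine eq_solve (p := fun k => ¬ G.Reaches T b k) (fun k hk => ?_) k hk
  have hkb : k ≠ Sum.inl b := by
    rintro rfl
    exact hk .refl
  by_cases hkT : ∀ i ∈ T, k ≠ Sum.inl i
  · refine Or.inr ⟨?_, solve_of_ne _ _ _ hkT, fun j hj hbj => hk (Relation.ReflTransGen.tail hbj ⟨hj, hkT⟩)⟩
    simpa [hkb] using hkT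
  · push Not at hkT
    obtain ⟨i, hi, rfl⟩ := hkT
    left
    rw [solve_of_mem _ _ _ hi, solve_of_mem _ _ _ (Finset.mem_insert_of_mem hi),
      Function.update_of_ne]
    rintro rfl
    exact hkb rfl

/-- Induction along the graph. Intervention value and errors vary together with `a`; this gives the
joint measurability in `(b, Y)` required by the diagonal argument. -/
theorem measurable_solve {α : Type*} [MeasurableSpace α] (T : Finset ν) {t : α → ∀ i, 𝒳 i}
    (ht : Measurable t) {e : α → ∀ k, M.E k} (he : Measurable e) (k : ν ⊕ υ) :
    Measurable fun a => M.solve T (t a) (e a) k := by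
  induction k using G.wf.induction with
  | _ k ih =>
  by_cases hk : ∀ i ∈ T, k ≠ Sum.inl i
  · simp only [solve_of_ne _ _ _ hk]
    exact (M.measurable_f k).comp
      ((measurable_pi_lambda _ fun (j : G.pa k) => ih j.1 j.2).prodMk ((measurable_pi_apply k).comp he))
  · push Not at hk
    obtain ⟨i, hi, rfl⟩ := hk
    simp only [solve_of_mem _ _ _ hi]
    exact (measurable_pi_apply i).comp ht

variable (M)

theorem measurable_errors : Measurable fun ω k => M.ε k ω := measurable_pi_lambda _ M.measurable_ε

theorem measurable_potential (T : Finset ν) (t : ∀ i, 𝒳 i) (k : ν ⊕ υ) :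
    Measurable fun ω => M.potential T t ω k := by
  simp only [potential_eq_solve]
  exact measurable_solve T measurable_const M.measurable_errors k

theorem measurable_var (T : Finset ν) (t : ∀ i, 𝒳 i) (i : ν) : Measurable (M.var T t i) :=
  M.measurable_potential T t (Sum.inl i)

theorem measurable_obs (T : Finset ν) (t : ∀ i, 𝒳 i) (A : Finset ν) : Measurable (M.obs T t A) :=
  measurable_pi_lambda _ fun i => M.measurable_var T t i

theorem measurable_lat (T : Finset ν) (t : ∀ i, 𝒳 i) (C : Finset υ) : Measurable (M.lat T t C) :=
  measurable_pi_lambda _ fun j => M.measurable_potential T t (Sum.inr j)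

end NPSEM

/-! ### The law of the treatment given all other errors. -/

section StructuralEquation

variable {Ω 𝓔 𝓨 𝓥 ℬ : Type*} [MeasurableSpace Ω] [MeasurableSpace 𝓔] [MeasurableSpace 𝓨]
  [MeasurableSpace 𝓥] [MeasurableSpace ℬ]

/-- The law of `F (v, ε)`, for `ε` with law `τ`, as a kernel. -/
noncomputable def errorKernel (τ : Measure 𝓔) [IsProbabilityMeasure τ] (F : 𝓥 × 𝓔 → ℬ) :
    Kernel 𝓥 ℬ := (Kernel.id ×ₖ Kernel.const 𝓥 τ).map F

variable {τ : Measure 𝓔} [IsProbabilityMeasure τ] {F : 𝓥 × 𝓔 → ℬ}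

theorem errorKernel_apply (hF : Measurable F) (v : 𝓥) :
    errorKernel τ F v = τ.map fun e => F (v, e) := by
  rw [errorKernel, Kernel.map_apply _ hF, Kernel.prod_apply, Kernel.id_apply, Kernel.const_apply,
    Measure.dirac_prod, Measure.map_map hF measurable_prodMk_left]
  rfl

theorem isMarkovKernel_errorKernel (hF : Measurable F) : IsMarkovKernel (errorKernel τ F) :=
  Kernel.IsMarkovKernel.map _ hF

variable {P : Measure Ω} [IsProbabilityMeasure P] {ε : Ω → 𝓔} {Y : Ω → 𝓨}

/-- Independence makes the law of `(V, ε)` a product, so given `V = v` the value `F (V, ε)` is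
distributed as `F (v, ε)`. -/
theorem map_structural_eq {V : Ω → 𝓥} (hε : Measurable ε) (hV : Measurable V)
    (hind : IndepFun V ε P) (hF : Measurable F) [IsProbabilityMeasure (P.map ε)] :
    P.map (fun ω => (V ω, F (V ω, ε ω))) = P.map V ⊗ₘ errorKernel (P.map ε) F := by
  have hV' : IsProbabilityMeasure (P.map V) := Measure.isProbabilityMeasure_map hV.aemeasurable
  have := isMarkovKernel_errorKernel (τ := P.map ε) hF
  have h1 := (indepFun_iff_map_prod_eq_prod_map_map hV.aemeasurable hε.aemeasurable).1 hind
  have hF' : Measurable fun p : 𝓥 × 𝓔 => (p.1, F p) := by fun_prop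
  have h2 : P.map (fun ω => (V ω, F (V ω, ε ω))) =
      ((P.map V).prod (P.map ε)).map fun p => (p.1, F p) := by
    rw [← h1, Measure.map_map hF' (by fun_prop)]
    rfl
  ext s hs
  rw [h2, Measure.map_apply hF' hs, Measure.prod_apply (hF' hs), Measure.compProd_apply hs]
  refine lintegral_congr fun v => ?_
  rw [errorKernel_apply hF, Measure.map_apply (by fun_prop) (measurable_prodMk_left hs)]
  rfl

/-- If `B = F (h(Y), ε)` has a conditional density given `h(Y)`, and `ε` is independent of `Y`, then
`B` has a conditional density given `Y`. -/
theorem map_prod_absolutelyContinuous_of_indep [MeasurableSpace.CountablyGenerated ℬ]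
    {ρ : Measure ℬ} [IsFiniteMeasure ρ] {h : 𝓨 → 𝓥} {B : Ω → ℬ}
    (hε : Measurable ε) (hY : Measurable Y) (hind : IndepFun Y ε P) (hh : Measurable h)
    (hF : Measurable F) (hB : ∀ ω, B ω = F (h (Y ω), ε ω))
    (hac : P.map (fun ω => (B ω, h (Y ω))) ≪ ρ.prod (P.map fun ω => h (Y ω))) :
    P.map (fun ω => (B ω, Y ω)) ≪ ρ.prod (P.map Y) := by
  obtain rfl : B = fun ω => F (h (Y ω), ε ω) := funext hB
  have hhY : Measurable fun ω => h (Y ω) := by fun_prop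
  have h1 : IsProbabilityMeasure (P.map ε) := Measure.isProbabilityMeasure_map hε.aemeasurable
  have h2 : IsProbabilityMeasure (P.map Y) := Measure.isProbabilityMeasure_map hY.aemeasurable
  have h3 : IsProbabilityMeasure (P.map fun ω => h (Y ω)) :=
    Measure.isProbabilityMeasure_map hhY.aemeasurable
  have hFh : Measurable fun p : 𝓨 × 𝓔 => F (h p.1, p.2) := by fun_prop
  have hk := isMarkovKernel_errorKernel (τ := P.map ε) hF
  have hk' := isMarkovKernel_errorKernel (τ := P.map ε) hFh
  have e1 := map_structural_eq hε hhY (hind.comp hh measurable_id) hF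
  have e2 := map_structural_eq hε hY hind hFh
  have a1 := map_prod_swap_absolutelyContinuous (hF.comp (hhY.prodMk hε)) hhY hac
  rw [← Measure.compProd_const] at a1
  -- Domination of the joint law gives domination of the kernel at almost every `v`. The kernel
  -- given `Y = y` depends only on `h y`, so this pulls back along `h`.
  have a2 := (e1.symm ▸ a1 : (P.map fun ω => h (Y ω)) ⊗ₘ errorKernel (P.map ε) F ≪
    (P.map fun ω => h (Y ω)) ⊗ₘ Kernel.const 𝓥 ρ).kernel_of_compProd
  have a3 : P.map (fun ω => h (Y ω)) = (P.map Y).map h := (Measure.map_map hh hY).symm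
  rw [a3] at a2
  have a4 : ∀ᵐ y ∂P.map Y,
      errorKernel (P.map ε) (fun p : 𝓨 × 𝓔 => F (h p.1, p.2)) y ≪ Kernel.const 𝓨 ρ y := by
    filter_upwards [ae_of_ae_map hh.aemeasurable a2] with y hy
    rwa [errorKernel_apply hFh, Kernel.const_apply, ← errorKernel_apply hF (h y)]
  have a5 := Measure.AbsolutelyContinuous.compProd_right a4
  rw [← e2, Measure.compProd_const] at a5
  exact map_prod_swap_absolutelyContinuous hY (hFh.comp (hY.prodMk hε)) a5

end StructuralEquation

/-! ### Marginals of the product reference measures. -/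

section Restrict

variable {κ : Type*} [DecidableEq κ] {𝒴 : κ → Type*} [∀ k, MeasurableSpace (𝒴 k)]
  (μ : ∀ k, Measure (𝒴 k)) [∀ k, SigmaFinite (μ k)]

instance sigmaFinite_ref {κ : Type*} {𝒴 : κ → Type*} [∀ k, MeasurableSpace (𝒴 k)]
    (μ : ∀ k, Measure (𝒴 k)) [∀ k, SigmaFinite (μ k)] (A : Finset κ) : SigmaFinite (ref μ A) :=
  inferInstanceAs (SigmaFinite (Measure.pi fun k : A => μ k))

/-- Only null sets are controlled: the coordinates that are dropped may have mass other than one,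
even infinite mass. -/
theorem quasiMeasurePreserving_restrict {A T : Finset κ} (h : A ⊆ T) :
    Measure.QuasiMeasurePreserving (Finset.restrict₂ (π := 𝒴) h) (ref μ T) (ref μ A) := by
  obtain ⟨C, hC, rfl⟩ : ∃ C, Disjoint A C ∧ T = A ∪ C :=
    ⟨T \ A, Finset.disjoint_sdiff, (Finset.union_sdiff_of_subset h).symm⟩
  have h1 := ((measurePreserving_piFinsetUnion hC μ).symm _).quasiMeasurePreserving
  have h2 : Finset.restrict₂ (π := 𝒴) h =
      Prod.fst ∘ (MeasurableEquiv.piFinsetUnion 𝒴 hC).symm := by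
    funext y
    obtain ⟨p, rfl⟩ := (MeasurableEquiv.piFinsetUnion 𝒴 hC).surjective y
    rw [Function.comp_apply, MeasurableEquiv.symm_apply_apply]
    funext i
    exact Equiv.piFinsetUnion_left 𝒴 hC i.2 _
  rw [h2]
  exact Measure.quasiMeasurePreserving_fst.comp h1

theorem quasiMeasurePreserving_restrict_prod {A C T : Finset κ} (hAC : Disjoint A C) (hA : A ⊆ T)
    (hC : C ⊆ T) : Measure.QuasiMeasurePreserving
      (fun y => (Finset.restrict₂ (π := 𝒴) hA y, Finset.restrict₂ (π := 𝒴) hC y))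
      (ref μ T) ((ref μ A).prod (ref μ C)) := by
  have h1 := ((measurePreserving_piFinsetUnion hAC μ).symm _).quasiMeasurePreserving
  have h2 : (fun y => (Finset.restrict₂ (π := 𝒴) hA y, Finset.restrict₂ (π := 𝒴) hC y)) =
      (MeasurableEquiv.piFinsetUnion 𝒴 hAC).symm ∘
        Finset.restrict₂ (π := 𝒴) (Finset.union_subset hA hC) := by
    funext y
    refine ((MeasurableEquiv.piFinsetUnion 𝒴 hAC).symm_apply_eq.2 ?_).symm
    funext ⟨i, hi⟩
    obtain h | h := Finset.mem_union.1 hi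
    · exact (Equiv.piFinsetUnion_left 𝒴 hAC (f := Finset.restrict₂ hA y)
        (g := Finset.restrict₂ hC y) h hi).symm
    · exact (Equiv.piFinsetUnion_right 𝒴 hAC (f := Finset.restrict₂ hA y)
        (g := Finset.restrict₂ hC y) h hi).symm
  rw [h2]
  exact h1.comp (quasiMeasurePreserving_restrict μ _)

theorem quasiMeasurePreserving_eval_restrict {A T : Finset κ} {b : κ} (hb : b ∉ A) (hbT : b ∈ T)
    (hA : A ⊆ T) : Measure.QuasiMeasurePreserving
      (fun y : ∀ i : T, 𝒴 i => (y ⟨b, hbT⟩, Finset.restrict₂ (π := 𝒴) hA y))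
      (ref μ T) ((μ b).prod (ref μ A)) := by
  have h1 := quasiMeasurePreserving_restrict_prod μ (Finset.disjoint_singleton_left.2 hb)
    (Finset.singleton_subset_iff.2 hbT) hA
  have h2 : Measure.QuasiMeasurePreserving (fun y : ∀ i : ({b} : Finset κ), 𝒴 i =>
      y ⟨b, Finset.mem_singleton_self b⟩) (ref μ {b}) (μ b) :=
    Measure.quasiMeasurePreserving_eval _ (⟨b, Finset.mem_singleton_self b⟩ : ({b} : Finset κ))
  exact (MeasureTheory.QuasiMeasurePreserving.prodMap h2
    (Measure.QuasiMeasurePreserving.id (ref μ A))).comp h1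

end Restrict

/-! ### Dominated laws of subvectors of the model. -/

section JointDensity

variable {ν υ : Type*} [Fintype ν] [DecidableEq ν] [Fintype υ] [DecidableEq υ] {G : HiddenDAG ν υ}
  {𝒳 : ν → Type u} {𝒰 : υ → Type u}
  [∀ i, MeasurableSpace (𝒳 i)] [∀ j, MeasurableSpace (𝒰 j)]
  {Ω : Type*} [MeasurableSpace Ω] {μ : ∀ i, Measure (𝒳 i)} [∀ i, SigmaFinite (μ i)]
  {η : ∀ j, Measure (𝒰 j)} [∀ j, SigmaFinite (η j)]
  {M : NPSEM G 𝒳 𝒰 Ω} {T : Finset ν} {t : ∀ i, 𝒳 i}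

namespace HasJointDensity

theorem map_var_lat_obs (h : HasJointDensity μ η M T t) {b : ν} (hb : b ∉ T) {A : Finset ν} (hbA : b ∉ A) (hA : Disjoint A T) :
    M.P.map (fun ω => (M.var T t b ω, M.lat T t Finset.univ ω, M.obs T t A ω)) ≪
      (μ b).prod ((ref η Finset.univ).prod (ref μ A)) := by
  have hm : Measurable fun ω => (M.obs T t Tᶜ ω, M.lat T t Finset.univ ω) :=
    (M.measurable_obs T t _).prodMk (M.measurable_lat T t _)
  exact map_comp_absolutelyContinuous h hm
    ((quasiMeasurePreserving_swap_left _ _ _).comp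
      ((quasiMeasurePreserving_map_right (quasiMeasurePreserving_eval_restrict μ hbA
        (Finset.mem_compl.2 hb) (Finset.subset_compl_iff_disjoint_right.2 hA))).comp
        Measure.measurePreserving_swap.quasiMeasurePreserving))

theorem map_obs_obs_var_obs (h : HasJointDensity μ η M T t) {A₁ A₂ A₃ : Finset ν} {b : ν}
    (hb : b ∉ T) (h₁ : Disjoint A₁ T)
    (h₂ : Disjoint A₂ T) (h₃ : Disjoint A₃ T) (h₁₂ : Disjoint A₁ A₂) (h₁₃ : Disjoint A₁ A₃)
    (h₂₃ : Disjoint A₂ A₃) (hb₁ : b ∉ A₁) (hb₂ : b ∉ A₂) (hb₃ : b ∉ A₃) (C : Finset υ) :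
    M.P.map (fun ω => (M.obs T t A₁ ω, M.obs T t A₂ ω, M.var T t b ω, M.lat T t C ω,
        M.obs T t A₃ ω)) ≪
      (ref μ A₁).prod ((ref μ A₂).prod ((μ b).prod ((ref η C).prod (ref μ A₃)))) := by
  have hm : Measurable fun ω => (M.obs T t Tᶜ ω, M.lat T t Finset.univ ω) :=
    (M.measurable_obs T t _).prodMk (M.measurable_lat T t _)
  have q1 := quasiMeasurePreserving_restrict_prod μ
    (show Disjoint A₁ (A₂ ∪ insert b A₃) by
      simp [h₁₂, h₁₃, hb₁])
    (Finset.subset_compl_iff_disjoint_right.2 h₁)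
    (show A₂ ∪ insert b A₃ ⊆ Tᶜ by
      rw [Finset.subset_compl_iff_disjoint_right]
      simp [h₂, h₃, hb])
  have q2 := quasiMeasurePreserving_restrict_prod μ
    (show Disjoint A₂ (insert b A₃) by simp [h₂₃, hb₂])
    Finset.subset_union_left Finset.subset_union_right
  have q3 := quasiMeasurePreserving_eval_restrict μ hb₃ (Finset.mem_insert_self b A₃)
    (Finset.subset_insert b A₃)
  have q4 := MeasureTheory.QuasiMeasurePreserving.prodMap
    (quasiMeasurePreserving_restrict η (Finset.subset_univ C))
    ((quasiMeasurePreserving_map_right (quasiMeasurePreserving_map_right q3)).comp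
      ((quasiMeasurePreserving_map_right q2).comp q1))
  have q5 := (quasiMeasurePreserving_map_right (quasiMeasurePreserving_map_right
      (quasiMeasurePreserving_swap_left (ref η C) (μ b) (ref μ A₃)))).comp
    ((quasiMeasurePreserving_map_right (quasiMeasurePreserving_swap_left (ref η C) (ref μ A₂)
      ((μ b).prod (ref μ A₃)))).comp
      (quasiMeasurePreserving_swap_left (ref η C) (ref μ A₁)
        ((ref μ A₂).prod ((μ b).prod (ref μ A₃)))))
  exact map_comp_absolutelyContinuous h hm
    (q5.comp (q4.comp Measure.measurePreserving_swap.quasiMeasurePreserving))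

theorem map_obs_obs_var (h : HasJointDensity μ η M T t) {A₁ A₂ : Finset ν} {b : ν}
    (hb : b ∉ T) (h₁ : Disjoint A₁ T)
    (h₂ : Disjoint A₂ T) (h₁₂ : Disjoint A₁ A₂) (hb₁ : b ∉ A₁) (hb₂ : b ∉ A₂) :
    M.P.map (fun ω => (M.obs T t A₁ ω, M.obs T t A₂ ω, M.var T t b ω)) ≪
      (ref μ A₁).prod ((ref μ A₂).prod (μ b)) := by
  refine map_comp_absolutelyContinuous
    (h.map_obs_obs_var_obs hb h₁ h₂ (Finset.disjoint_empty_left T) h₁₂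
      (Finset.disjoint_empty_right _) (Finset.disjoint_empty_right _) hb₁ hb₂
      (Finset.notMem_empty b) ∅) ?_
    (quasiMeasurePreserving_map_right (quasiMeasurePreserving_map_right
      Measure.quasiMeasurePreserving_fst))
  have := M.measurable_obs T t
  have := M.measurable_lat T t
  have := M.measurable_var T t
  fun_prop

end HasJointDensity

end JointDensity

/-! ### The treatment is dominated given the other errors. -/

namespace NPSEM

attribute [local instance] NPSEM.measE NPSEM.isProb

variable {ν υ : Type*} [Fintype ν] [DecidableEq ν] [Fintype υ] {G : HiddenDAG ν υ}
  {𝒳 : ν → Type u} {𝒰 : υ → Type u}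
  [∀ i, MeasurableSpace (𝒳 i)] [∀ j, MeasurableSpace (𝒰 j)]
  {Ω : Type*} [MeasurableSpace Ω] (M : NPSEM G 𝒳 𝒰 Ω)

open Classical in
/-- The errors, with the error of `b` replaced by the constant `c`. -/
noncomputable def otherErrors (b : ν) (c : M.E (Sum.inl b)) (ω : Ω) : ∀ k, M.E k :=
  Function.update (fun k => M.ε k ω) (Sum.inl b) c

theorem otherErrors_of_ne {b : ν} (c : M.E (Sum.inl b)) (ω : Ω) {k : ν ⊕ υ}
    (hk : k ≠ Sum.inl b) : M.otherErrors b c ω k = M.ε k ω := by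
  unfold otherErrors Function.update
  exact dif_neg hk

theorem measurable_otherErrors (b : ν) (c : M.E (Sum.inl b)) : Measurable (M.otherErrors b c) := by
  refine measurable_pi_lambda _ fun k => ?_
  by_cases hk : k = Sum.inl b
  · subst hk
    simp only [otherErrors, Function.update_self]
    exact measurable_const
  · simp only [M.otherErrors_of_ne c _ hk]
    exact M.measurable_ε k

theorem solve_otherErrors {T : Finset ν} {b : ν} (hb : b ∈ T) (t : ∀ i, 𝒳 i)
    (c : M.E (Sum.inl b)) (ω : Ω) : M.solve T t (M.otherErrors b c ω) = M.potential T t ω := by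
  rw [potential_eq_solve]
  exact solve_congr_error hb t fun k hk => M.otherErrors_of_ne c ω hk

/-- The vector is a measurable function `φ` of the errors other than that of `b`, and those are
jointly independent of the error of `b`. -/
theorem indepFun_otherErrors (b : ν) (c : M.E (Sum.inl b)) :
    IndepFun (M.otherErrors b c) (M.ε (Sum.inl b)) M.P := by
  classical
  have h1 := M.indep_ε.indepFun_finset {Sum.inl b}ᶜ {Sum.inl b} disjoint_compl_left M.measurable_ε
  let φ : (∀ k : ({Sum.inl b}ᶜ : Finset (ν ⊕ υ)), M.E k) → ∀ k, M.E k := fun z k =>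
    if h : k = Sum.inl b then cast (congrArg M.E h.symm) c else z ⟨k, by simpa using h⟩
  have hφ : Measurable φ := by
    refine measurable_pi_lambda _ fun k => ?_
    by_cases h : k = Sum.inl b
    · simp only [φ, dif_pos h]
      exact measurable_const
    · simp only [φ, dif_neg h]
      exact measurable_pi_apply _
  have h2 := h1.comp hφ (measurable_pi_apply (⟨Sum.inl b, Finset.mem_singleton_self _⟩ :
    ({Sum.inl b} : Finset (ν ⊕ υ))))
  have h3 : M.otherErrors b c = φ ∘ fun ω (k : ({Sum.inl b}ᶜ : Finset (ν ⊕ υ))) => M.ε k ω := by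
    funext ω k
    by_cases h : k = Sum.inl b
    · subst h
      simp [φ, otherErrors]
    · simp [φ, otherErrors, h]
  rw [h3]
  exact h2

/-- Parents of `b` are not reached from `b`, so intervening on `b` leaves them unchanged; they can
be computed without the error of `b`. -/
theorem potential_eq_of_edge {T : Finset ν} {t : ∀ i, 𝒳 i} {b : ν} {j : ν ⊕ υ}
    (h : G.Edge j (Sum.inl b)) (ω : Ω) :
    M.potential T t ω j = M.potential (insert b T) t ω j := by
  rw [potential_eq_solve, potential_eq_solve, solve_eq_solve_insert_of_not_reaches t (t b) _
    (HiddenDAG.not_reaches_of_edge h), Function.update_eq_self]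

/-- The values of the parents of `b`, as a function of the latent variables and of the observed
variables other than `b` that are not intervened on. -/
def parentValues {A : Finset ν} (t : ∀ i, 𝒳 i) (b : ν)
    (p : (∀ j : (Finset.univ : Finset υ), 𝒰 j) × ∀ i : A, 𝒳 i) :
    ∀ j : G.pa (Sum.inl b), State 𝒳 𝒰 j
  | ⟨Sum.inl i, _⟩ => if h : i ∈ A then p.2 ⟨i, h⟩ else t i
  | ⟨Sum.inr j, _⟩ => p.1 ⟨j, Finset.mem_univ j⟩

theorem measurable_parentValues {A : Finset ν} (t : ∀ i, 𝒳 i) (b : ν) :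
    Measurable (parentValues (𝒰 := 𝒰) (G := G) (A := A) t b) := by
  refine measurable_pi_lambda _ fun ⟨k, hk⟩ => ?_
  cases k with
  | inl i =>
    by_cases h : i ∈ A
    · have e : (fun p => parentValues (𝒰 := 𝒰) (G := G) (A := A) t b p ⟨Sum.inl i, hk⟩) =
          fun p => p.2 ⟨i, h⟩ := funext fun _ => dif_pos h
      rw [e]
      exact (measurable_pi_apply (⟨i, h⟩ : A)).comp measurable_snd
    · have e : (fun p => parentValues (𝒰 := 𝒰) (G := G) (A := A) t b p ⟨Sum.inl i, hk⟩) =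
          fun _ => t i := funext fun _ => dif_neg h
      rw [e]
      exact measurable_const
  | inr j =>
    exact (by fun_prop : Measurable fun p : (∀ j : (Finset.univ : Finset υ), 𝒰 j) × ∀ i : A, 𝒳 i =>
      p.1 ⟨j, Finset.mem_univ j⟩)

theorem parentValues_eq (T : Finset ν) (t : ∀ i, 𝒳 i) (b : ν) (ω : Ω) :
    parentValues t b (M.lat T t Finset.univ ω, M.obs T t (insert b T)ᶜ ω) =
      fun j : G.pa (Sum.inl b) => M.potential T t ω j := by
  funext ⟨k, hk⟩
  cases k with
  | inl i =>
    by_cases h : i ∈ (insert b T)ᶜ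
    · exact dif_pos h
    · refine (dif_neg h).trans ?_
      have hib : i ≠ b := by
        rintro rfl
        exact G.acyclic _ (.single hk)
      have hi : i ∈ T := by simpa [hib] using h
      exact ((M.potential_inl T t ω i).trans (if_pos hi)).symm
  | inr j => rfl

/-- The joint density dominates the treatment given its parents. Given all other errors its law
depends only on the parents, because its own error is independent of the rest; domination therefore
persists although the errors themselves need not have densities. -/
theorem map_var_otherErrors_absolutelyContinuous [∀ i, StandardBorelSpace (𝒳 i)]
    {μ : ∀ i, Measure (𝒳 i)} [∀ i, SigmaFinite (μ i)]
    {η : ∀ j, Measure (𝒰 j)} [∀ j, SigmaFinite (η j)] {T : Finset ν} {t : ∀ i, 𝒳 i}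
    (h : HasJointDensity μ η M T t) {b : ν} (hb : b ∉ T) (c : M.E (Sum.inl b)) :
    M.P.map (fun ω => (M.var T t b ω, M.otherErrors b c ω)) ≪
      (μ b).prod (M.P.map (M.otherErrors b c)) := by
  classical
  have hv := M.measurable_var T t b
  have hr : Measurable fun ω => (M.lat T t Finset.univ ω, M.obs T t (insert b T)ᶜ ω) :=
    (M.measurable_lat ..).prodMk (M.measurable_obs ..)
  have h0 := h.map_var_lat_obs hb (A := (insert b T)ᶜ) (by simp)
    (Finset.subset_compl_iff_disjoint_right.1 (Finset.compl_subset_compl.2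
      (Finset.subset_insert b T)))
  have hvac : M.P.map (M.var T t b) ≪ μ b :=
    map_comp_absolutelyContinuous (T := fun ω =>
      (M.var T t b ω, M.lat T t Finset.univ ω, M.obs T t (insert b T)ᶜ ω)) h0 (hv.prodMk hr) Measure.quasiMeasurePreserving_fst
  have hp : IsProbabilityMeasure (M.P.map (M.var T t b)) :=
    Measure.isProbabilityMeasure_map hv.aemeasurable
  have hY := M.measurable_otherErrors b c
  have hpY : IsProbabilityMeasure (M.P.map (M.otherErrors b c)) :=
    Measure.isProbabilityMeasure_map hY.aemeasurable
  have hpr : IsProbabilityMeasure (M.P.map fun ω =>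
      (M.lat T t Finset.univ ω, M.obs T t (insert b T)ᶜ ω)) :=
    Measure.isProbabilityMeasure_map hr.aemeasurable
  have h1 := map_prod_absolutelyContinuous_prod_map hv hr h0
  have hm := measurable_parentValues (𝒰 := 𝒰) (G := G) (A := (insert b T)ᶜ) t b
  let V : Ω → ∀ j : G.pa (Sum.inl b), State 𝒳 𝒰 j := fun ω j => M.potential T t ω j
  have hV : (fun ω => parentValues t b
      (M.lat T t Finset.univ ω, M.obs T t (insert b T)ᶜ ω)) = V :=
    funext fun ω => M.parentValues_eq T t b ω
  have hVm : Measurable V := hV ▸ hm.comp hr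
  have hpV : IsProbabilityMeasure (M.P.map V) :=
    Measure.isProbabilityMeasure_map hVm.aemeasurable
  have hqm : Measure.QuasiMeasurePreserving (parentValues t b)
      (M.P.map fun ω => (M.lat T t Finset.univ ω, M.obs T t (insert b T)ᶜ ω)) (M.P.map V) := by
    refine ⟨hm, ?_⟩
    rw [Measure.map_map hm hr, ← hV]
    rfl
  have h2 := map_comp_absolutelyContinuous h1 (hv.prodMk hr) (quasiMeasurePreserving_map_right hqm)
  have hYV : ∀ ω, (fun j : G.pa (Sum.inl b) =>
      M.solve (insert b T) t (M.otherErrors b c ω) j) = V ω := by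
    intro ω
    funext j
    rw [solve_otherErrors _ (Finset.mem_insert_self b T)]
    exact (M.potential_eq_of_edge j.2 ω).symm
  -- The law of the treatment serves as a finite reference measure; it is replaced by `μ b` at the
  -- end.
  refine (map_prod_absolutelyContinuous_of_indep (ℬ := 𝒳 b) (ρ := M.P.map (M.var T t b))
    (F := fun p => M.f (Sum.inl b) p.1 p.2)
    (h := fun y (j : G.pa (Sum.inl b)) => M.solve (insert b T) t y j)
    (M.measurable_ε (Sum.inl b)) hY (M.indepFun_otherErrors b c)
    (measurable_pi_lambda _ fun j => measurable_solve _ measurable_const measurable_id _)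
    (M.measurable_f (Sum.inl b)) (fun ω => ?_) ?_).trans (hvac.prod .rfl)
  · rw [hYV]
    exact (M.potential_inl T t ω b).trans (if_neg hb)
  · simp only [hYV]
    have hV' : ∀ ω, parentValues t b (M.lat T t Finset.univ ω, M.obs T t (insert b T)ᶜ ω) = V ω :=
      congrFun hV
    have hYV' : (fun ω (j : G.pa (Sum.inl b)) =>
        M.solve (insert b T) t (M.otherErrors b c ω) j) = V := funext hYV
    simp only [hV'] at h2
    rwa [hYV']

end NPSEM

namespace NPSEM

variable {ν υ : Type*} [Finite ν] [Finite υ] [DecidableEq ν] {G : HiddenDAG ν υ}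
  {𝒳 : ν → Type u} {𝒰 : υ → Type u}
  [∀ i, MeasurableSpace (𝒳 i)] [∀ j, MeasurableSpace (𝒰 j)]
  {Ω : Type*} [MeasurableSpace Ω] (M : NPSEM G 𝒳 𝒰 Ω)

theorem var_eq_var_insert {T : Finset ν} {b : ν} (hb : b ∉ T) (t : ∀ i, 𝒳 i) (i : ν) (ω : Ω) :
    M.var T t i ω = M.var (insert b T) (Function.update t b (M.var T t b ω)) i ω := by
  have h1 := congrFun (solve_eq_solve_insert hb t fun k => M.ε k ω) (Sum.inl i)
  have h2 : M.solveVar T t b (fun k => M.ε k ω) = M.var T t b ω :=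
    (congrFun (M.potential_eq_solve T t ω) (Sum.inl b)).symm
  rw [h2, ← potential_eq_solve, ← potential_eq_solve] at h1
  exact h1

theorem var_eq_var_insert_of_not_reaches {T : Finset ν} {b i : ν} (t : ∀ i, 𝒳 i) (c : 𝒳 b)
    (ω : Ω) (hi : ¬ G.Reaches T b (Sum.inl i)) :
    M.var T t i ω = M.var (insert b T) (Function.update t b c) i ω := by
  have h1 := solve_eq_solve_insert_of_not_reaches t c (fun k => M.ε k ω) hi
  rw [← potential_eq_solve, ← potential_eq_solve] at h1
  exact h1

end NPSEM

/-! ### Vertices unaffected by the treatment, and assembling the output. -/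

namespace TbfInput

variable {ν υ : Type*} [Fintype ν] [DecidableEq ν] {D : TbfInput ν} {G : HiddenDAG ν υ}

/-- Translates "not a descendant in the CADMG" into "not reached in the underlying graph", the form
in which interventions are shown to have no effect. -/
theorem not_reaches_of_mem_R {i : ν} (hR : i ∈ D.R) (hZ : i ∉ D.Z)
    (hde : i ∉ G.de (D.R \ D.Z) D.S D.B) : ¬ G.Reaches D.S D.B (Sum.inl i) := fun h =>
  hde (HiddenDAG.mem_de_of_reaches (Finset.mem_sdiff.2 ⟨D.B_mem, D.B_notMem_Z⟩)
    (Finset.mem_sdiff.2 ⟨hR, hZ⟩) h)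

theorem not_reaches_of_mem_Wrest {i : ν} (hi : i ∈ D.Wrest G) :
    ¬ G.Reaches D.S D.B (Sum.inl i) := by
  simp only [Wrest, Wstar, Finset.mem_sdiff, Finset.mem_inter, not_and] at hi
  exact not_reaches_of_mem_R (D.W_subset hi.1) (Finset.disjoint_left.1 D.disjoint_WZ hi.1)
    fun h => hi.2 h hi.1

theorem not_reaches_of_mem_X {i : ν} (hi : i ∈ D.X G) : ¬ G.Reaches D.S D.B (Sum.inl i) := by
  simp only [X, O, Finset.mem_sdiff, Finset.mem_union, Finset.mem_singleton, not_or,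
    not_and] at hi
  refine not_reaches_of_mem_R hi.1 hi.2.1.2 fun h => ?_
  have := hi.2.1.1.1 h
  tauto

theorem Wrest_subset : D.Wrest G ⊆ D.W := Finset.sdiff_subset

theorem X_subset : D.X G ⊆ D.R := Finset.sdiff_subset

theorem out_subset : D.out G ⊆ D.R := Finset.sdiff_subset

theorem B_notMem_S : D.B ∉ D.S := Finset.disjoint_left.1 D.disjoint_RS D.B_mem

theorem disjoint_Z_X : Disjoint D.Z (D.X G) :=
  Finset.disjoint_right.2 fun i hi hZ => by simp [X, hZ] at hi

theorem disjoint_W_X : Disjoint D.W (D.X G) :=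
  Finset.disjoint_right.2 fun i hi hW => by simp [X, hW] at hi

theorem disjoint_out_Z : Disjoint (D.out G) D.Z :=
  Finset.disjoint_left.2 fun i hi hZ => by simp [out, hZ] at hi

theorem B_notMem_X : D.B ∉ D.X G := by simp [X]

theorem B_notMem_out : D.B ∉ D.out G := by simp [out]

variable {𝒳 : ν → Type u} [∀ i, MeasurableSpace (𝒳 i)]

variable (D G) in
/-- The value of the output variables made up of values of `O`, of `W \ W*` and of `X`. -/
noncomputable def combine (p : (∀ i : D.O G, 𝒳 i) × (∀ i : D.Wrest G, 𝒳 i) × ∀ i : D.X G, 𝒳 i)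
    (i : D.out G) : 𝒳 i :=
  if hO : (i : ν) ∈ D.O G then p.1 ⟨i, hO⟩ else
    if hW : (i : ν) ∈ D.Wrest G then p.2.1 ⟨i, hW⟩ else p.2.2 ⟨i, by
      have := (Finset.ext_iff.1 (D.out_eq G) i).1 i.2
      rw [Finset.mem_union, Finset.mem_union] at this
      tauto⟩

theorem measurable_combine : Measurable (D.combine G (𝒳 := 𝒳)) := by
  refine measurable_pi_lambda _ fun i => ?_
  unfold combine
  split_ifs <;> fun_prop

theorem measurable_xPart : Measurable (D.xPart (G := G) (𝒳 := 𝒳)) :=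
  measurable_pi_lambda _ fun _ => measurable_pi_apply _

theorem combine_eq {o v x} {r : ∀ i, 𝒳 i} (ho : ∀ i : D.O G, o i = r i)
    (hv : ∀ i : D.Wrest G, v i = r i) (hx : ∀ i : D.X G, x i = r i) :
    D.combine G (o, v, x) = fun i : D.out G => r i := by
  funext i
  unfold combine
  split_ifs with h1 h2
  · exact ho ⟨i, h1⟩
  · exact hv ⟨i, h2⟩
  · exact hx ⟨i, _⟩

end TbfInput

/-! ### Validity of the operation in one causal model. -/

section Validity

attribute [local instance] NPSEM.measE NPSEM.isProb

variable {ν υ : Type*} [Fintype ν] [DecidableEq ν] [Fintype υ] {G : HiddenDAG ν υ}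
  {D : TbfInput ν}
  {𝒳 : ν → Type u} {𝒰 : υ → Type u}
  [∀ i, MeasurableSpace (𝒳 i)] [∀ j, MeasurableSpace (𝒰 j)]
  [∀ i, StandardBorelSpace (𝒳 i)]
  {Ω : Type*} [MeasurableSpace Ω]
  {μ : ∀ i, Measure (𝒳 i)} [∀ i, SigmaFinite (μ i)]
  {η : ∀ j, Measure (𝒰 j)} [∀ j, SigmaFinite (η j)]
  {M : NPSEM G 𝒳 𝒰 Ω} {Us : Finset υ}

/-- Validity of the treatment bridge operation in one causal model. -/
theorem outputKernel_density {s : ∀ i, 𝒳 i} (hdens : HasJointDensity μ η M D.S s)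
    (hcond : TbfConditions D μ η M Us)
    {q : (∀ i, 𝒳 i) → (∀ i : D.Z, 𝒳 i) → 𝒳 D.B → (∀ i : D.X G, 𝒳 i) → ℝ}
    (hq : IsTreatmentBridge D μ M q) (hint : SufficientlyIntegrable D μ η M Us q) :
    ∀ᵐ b ∂ μ D.B, outputKernel D M s b ≪ ref μ (D.out G) ∧
      ∀ᵐ r ∂ ref μ (D.out G),
        Integrable (fun z => q s z b (D.xPart r) * inputDensity D μ M s r z b) (ref μ D.Z) ∧
        ((outputKernel D M s b).rnDeriv (ref μ (D.out G)) r).toReal =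
          ∫ z, q s z b (D.xPart r) * inputDensity D μ M s r z b ∂ ref μ D.Z := by
  classical
  obtain ⟨ω₀⟩ : Nonempty Ω := nonempty_of_isProbabilityMeasure M.P
  -- The value filled in for the error of `B` is arbitrary: `g` solves the equations with `B`
  -- intervened on, which ignore that error.
  let Y := M.otherErrors D.B (M.ε _ ω₀)
  let g : 𝒳 D.B → (∀ k, M.E k) → ∀ i : D.O G, 𝒳 i := fun b y i =>
    M.solve (insert D.B D.S) (Function.update s D.B b) y (Sum.inl (i : ν))
  have hgY : ∀ b, (fun ω => g b (Y ω)) =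
      M.obs (insert D.B D.S) (Function.update s D.B b) (D.O G) := fun b => by
    funext ω i
    exact congrFun (M.solve_otherErrors (Finset.mem_insert_self D.B D.S) _ _ ω) (Sum.inl (i : ν))
  have hgB : (fun ω => g (M.var D.S s D.B ω) (Y ω)) = M.obs D.S s (D.O G) := by
    funext ω i
    exact (congrFun (congrFun (hgY (M.var D.S s D.B ω)) ω) i).trans
      (M.var_eq_var_insert D.B_notMem_S s i ω).symm
  -- Intervening on `B` changes only the `O` coordinates of the output; those of `W̃` and `X` may be
  -- taken under `do(S = s)`.
  have hout : ∀ b, (fun ω => D.combine G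
      (g b (Y ω), M.obs D.S s (D.Wrest G) ω, M.obs D.S s (D.X G) ω)) =
      M.obs (insert D.B D.S) (Function.update s D.B b) (D.out G) := fun b => by
    funext ω
    refine TbfInput.combine_eq
      (r := fun i => M.var (insert D.B D.S) (Function.update s D.B b) i ω) ?_ ?_ ?_
    · exact fun i => congrFun (congrFun (hgY b) ω) i
    · exact fun i => M.var_eq_var_insert_of_not_reaches s b ω
        (TbfInput.not_reaches_of_mem_Wrest i.2)
    · exact fun i => M.var_eq_var_insert_of_not_reaches s b ω (TbfInput.not_reaches_of_mem_X i.2)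
  have hRj : ∀ ω, M.obs D.S s (D.out G) ω = D.combine G (g (M.var D.S s D.B ω) (Y ω),
      M.obs D.S s (D.Wrest G) ω, M.obs D.S s (D.X G) ω) := fun ω =>
    (TbfInput.combine_eq (r := fun i => M.var D.S s i ω)
      (fun i => congrFun (congrFun hgB ω) i) (fun _ => rfl) (fun _ => rfl)).symm
  have hgm : Measurable (Function.uncurry g) := measurable_pi_lambda _ fun i =>
    NPSEM.measurable_solve (α := 𝒳 D.B × ∀ k, M.E k) _
      ((measurable_update' (a := D.B)).comp (measurable_const.prodMk measurable_fst))
      measurable_snd (Sum.inl (i : ν))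
  have dR := D.disjoint_RS
  have dWS := dR.mono_left D.W_subset
  have dZS := dR.mono_left D.Z_subset
  have dXS := dR.mono_left (TbfInput.X_subset (D := D) (G := G))
  have hBV : D.B ∉ D.Wrest G := fun h => D.B_notMem_W (TbfInput.Wrest_subset h)
  have key := ae_potential_density_eq_of_condIndep (P := M.P) (ρU := ref η Us)
    (ρV := ref μ (D.Wrest G)) (ρW := ref μ D.W) (ρR := ref μ (D.out G)) (ρZ := ref μ D.Z)
    (ρB := μ D.B) (ρX := ref μ (D.X G)) (U := M.lat D.S s Us) (V := M.obs D.S s (D.Wrest G))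
    (W := M.obs D.S s D.W) (Z := M.obs D.S s D.Z) (B := M.var D.S s D.B) (X := M.obs D.S s (D.X G))
    (Y := Y) (R := M.obs D.S s (D.out G)) (g := g) (j := D.combine G) hgm
    TbfInput.measurable_combine (M.measurable_lat ..) (M.measurable_obs ..) (M.measurable_obs ..)
    (M.measurable_var ..) (M.measurable_obs ..) (M.measurable_obs ..)
    (M.measurable_otherErrors ..)
    (M.map_var_otherErrors_absolutelyContinuous hdens D.B_notMem_S _) hRj
    (x := D.xPart) TbfInput.measurable_xPart (fun _ => rfl)
    (v := Finset.restrict₂ (π := 𝒳) TbfInput.Wrest_subset)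
    (Finset.measurable_restrict₂ _) (fun _ => rfl)
    (hdens.map_obs_obs_var_obs D.B_notMem_S dZS dWS dXS D.disjoint_WZ.symm D.disjoint_Z_X
      D.disjoint_W_X D.B_notMem_Z D.B_notMem_W D.B_notMem_X Us)
    (hdens.map_obs_obs_var_obs D.B_notMem_S dZS (dWS.mono_left TbfInput.Wrest_subset) dXS
      (D.disjoint_WZ.symm.mono_right TbfInput.Wrest_subset) D.disjoint_Z_X
      (D.disjoint_W_X.mono_left TbfInput.Wrest_subset) D.B_notMem_Z hBV D.B_notMem_X Us)
    (hdens.map_obs_obs_var D.B_notMem_S (dR.mono_left TbfInput.out_subset) dZS D.disjoint_out_Z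
      D.B_notMem_out D.B_notMem_Z)
    (fun b => by rw [hgY b]; exact hcond.ignorability s b)
    (hcond.outcomeProxy s)
    (by rw [hgB]; exact hcond.treatmentProxy s)
    -- Only the direction of completeness from vanishing integrals to `g = 0` is used.
    (by filter_upwards [hcond.completeness s] with c hc g hg using (hc g hg).1)
    (hcond.positivity s)
    (q := fun p => q s p.1 p.2.1 p.2.2) (hq.measurable s) (hq.integrable s) (hq.bridge s) (hint s)
  simp only [hout] at key
  exact key

end Validity

/-! ### Transfer between models with the same input kernel. -/

section Transfer

theorem condDensity_congr {Ω Ω' α γ : Type*} [MeasurableSpace Ω] [MeasurableSpace Ω']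
    [MeasurableSpace α] [MeasurableSpace γ] {P : Measure Ω} {P' : Measure Ω'} {ρ : Measure α}
    {τ : Measure γ} {Y : Ω → α} {C : Ω → γ} {Y' : Ω' → α} {C' : Ω' → γ}
    (h : P'.map (fun ω => (Y' ω, C' ω)) = P.map (fun ω => (Y ω, C ω)))
    (hC : P'.map C' = P.map C) : condDensity P' ρ τ Y' C' = condDensity P ρ τ Y C := by
  funext y c
  rw [condDensity, condDensity, density, density, density, density, h, hC]

theorem eq_of_rnDeriv_toReal_ae_eq {α : Type*} [MeasurableSpace α] {μ ν ρ : Measure α}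
    [IsFiniteMeasure μ] [IsFiniteMeasure ν] [SigmaFinite ρ] (hμ : μ ≪ ρ) (hν : ν ≪ ρ)
    (h : ∀ᵐ x ∂ρ, (μ.rnDeriv ρ x).toReal = (ν.rnDeriv ρ x).toReal) : μ = ν := by
  rw [← Measure.withDensity_rnDeriv_eq μ ρ hμ, ← Measure.withDensity_rnDeriv_eq ν ρ hν]
  refine withDensity_congr_ae ?_
  filter_upwards [h, Measure.rnDeriv_lt_top μ ρ, Measure.rnDeriv_lt_top ν ρ] with x hx h1 h2
  exact (ENNReal.toReal_eq_toReal_iff' h1.ne h2.ne).1 hx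

variable {ν υ : Type*} [Fintype ν] [DecidableEq ν] [Fintype υ] {G : HiddenDAG ν υ}
  {D : TbfInput ν}
  {𝒳 : ν → Type u} {𝒰 𝒰' : υ → Type u}
  [∀ i, MeasurableSpace (𝒳 i)] [∀ j, MeasurableSpace (𝒰 j)] [∀ j, MeasurableSpace (𝒰' j)]
  {Ω Ω' : Type*} [MeasurableSpace Ω] [MeasurableSpace Ω']
  {μ : ∀ i, Measure (𝒳 i)}
  {M : NPSEM G 𝒳 𝒰 Ω} {M' : NPSEM G 𝒳 𝒰' Ω'}

theorem NPSEM.map_comp_obs_eq {R T : Finset ν} {t : ∀ i, 𝒳 i}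
    (h : M'.kernel R T t = M.kernel R T t) {α : Type*} [MeasurableSpace α]
    {φ : (∀ i : R, 𝒳 i) → α} (hφ : Measurable φ) :
    M'.P.map (fun ω => φ (M'.obs T t R ω)) = M.P.map fun ω => φ (M.obs T t R ω) := by
  have h1 := congrArg (Measure.map φ) h
  rw [NPSEM.kernel, NPSEM.kernel, Measure.map_map hφ (M'.measurable_obs ..),
    Measure.map_map hφ (M.measurable_obs ..)] at h1
  exact h1

/-- The bridge equation only involves the input kernel. -/
theorem IsTreatmentBridge.of_kernel_eq
    {q : (∀ i, 𝒳 i) → (∀ i : D.Z, 𝒳 i) → 𝒳 D.B → (∀ i : D.X G, 𝒳 i) → ℝ}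
    (hq : IsTreatmentBridge D μ M q) (h : ∀ s, M'.kernel D.R D.S s = M.kernel D.R D.S s) :
    IsTreatmentBridge D μ M' q := by
  have mW := Finset.measurable_restrict₂ (X := 𝒳) D.W_subset
  have mZ := Finset.measurable_restrict₂ (X := 𝒳) D.Z_subset
  have mX := Finset.measurable_restrict₂ (X := 𝒳) (D.X_subset (G := G))
  have mB : Measurable fun r : ∀ i : D.R, 𝒳 i => r ⟨D.B, D.B_mem⟩ := measurable_pi_apply _
  have eBX := fun s => NPSEM.map_comp_obs_eq (h s) (mB.prodMk mX)
  have eWX := fun s => NPSEM.map_comp_obs_eq (h s) (mW.prodMk mX)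
  have eWBX := fun s => NPSEM.map_comp_obs_eq (h s) (mW.prodMk (mB.prodMk mX))
  have eZBX := fun s => NPSEM.map_comp_obs_eq (h s) (mZ.prodMk (mB.prodMk mX))
  have eBWX := fun s => NPSEM.map_comp_obs_eq (h s) (mB.prodMk (mW.prodMk mX))
  have eZWBX := fun s =>
    NPSEM.map_comp_obs_eq (h s) (mZ.prodMk (mW.prodMk (mB.prodMk mX)))
  have cZ := fun s => condDensity_congr (ρ := ref μ D.Z) (τ := (μ D.B).prod (ref μ (D.X G)))
    (Y := M.obs D.S s D.Z) (C := fun ω => (M.var D.S s D.B ω, M.obs D.S s (D.X G) ω))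
    (Y' := M'.obs D.S s D.Z) (C' := fun ω => (M'.var D.S s D.B ω, M'.obs D.S s (D.X G) ω))
    (eZBX s) (eBX s)
  have cZW := fun s => condDensity_congr (ρ := ref μ D.Z)
    (τ := (ref μ D.W).prod ((μ D.B).prod (ref μ (D.X G)))) (Y := M.obs D.S s D.Z)
    (C := fun ω => (M.obs D.S s D.W ω, M.var D.S s D.B ω, M.obs D.S s (D.X G) ω))
    (Y' := M'.obs D.S s D.Z)
    (C' := fun ω => (M'.obs D.S s D.W ω, M'.var D.S s D.B ω, M'.obs D.S s (D.X G) ω))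
    (eZWBX s) (eWBX s)
  have cB := fun s => condDensity_congr (ρ := μ D.B) (τ := (ref μ D.W).prod (ref μ (D.X G)))
    (Y := M.var D.S s D.B) (C := fun ω => (M.obs D.S s D.W ω, M.obs D.S s (D.X G) ω))
    (Y' := M'.var D.S s D.B) (C' := fun ω => (M'.obs D.S s D.W ω, M'.obs D.S s (D.X G) ω))
    (eBWX s) (eWX s)
  refine ⟨hq.measurable, fun s => ?_, fun s => ?_⟩
  · rw [cZ s]
    exact (eBX s).symm ▸ hq.integrable s
  · rw [cZW s, cB s]
    exact (eWBX s).symm ▸ hq.bridge s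

theorem inputDensity_eq_of_kernel_eq {s : ∀ i, 𝒳 i}
    (h : M'.kernel D.R D.S s = M.kernel D.R D.S s) :
    inputDensity D μ M' s = inputDensity D μ M s := by
  have e := NPSEM.map_comp_obs_eq h
    ((Finset.measurable_restrict₂ (X := 𝒳) (D.out_subset (G := G))).prodMk
      ((Finset.measurable_restrict₂ (X := 𝒳) D.Z_subset).prodMk
        (measurable_pi_apply (⟨D.B, D.B_mem⟩ : D.R))))
  funext r z b
  exact congrArg (fun m : Measure _ => (m.rnDeriv _ _).toReal) e

end Transfer

end ProximalID

open ProximalID in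
theorem mainTheorem10 {ν υ : Type*} [Fintype ν] [DecidableEq ν] [Fintype υ]
    (G : HiddenDAG ν υ) (D : TbfInput ν)
    {𝒳 : ν → Type u} [∀ i, MeasurableSpace (𝒳 i)] [∀ i, StandardBorelSpace (𝒳 i)]
    (μ : ∀ i, Measure (𝒳 i)) [∀ i, SigmaFinite (μ i)]
    (q : (∀ i, 𝒳 i) → (∀ i : D.Z, 𝒳 i) → 𝒳 D.B → (∀ i : D.X G, 𝒳 i) → ℝ)
    {𝒰 : υ → Type u} [∀ j, MeasurableSpace (𝒰 j)] [∀ j, StandardBorelSpace (𝒰 j)]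
    (η : ∀ j, Measure (𝒰 j)) [∀ j, SigmaFinite (η j)]
    {Ω : Type*} [MeasurableSpace Ω] (M : NPSEM G 𝒳 𝒰 Ω) (Us : Finset υ)
    (hdens : ∀ s, HasJointDensity μ η M D.S s)
    (hcond : TbfConditions D μ η M Us)
    (hq : IsTreatmentBridge D μ M q)
    (hint : SufficientlyIntegrable D μ η M Us q) :
    (∀ s, ∀ᵐ b ∂ μ D.B,
      outputKernel D M s b ≪ ref μ (D.out G) ∧
      ∀ᵐ r ∂ ref μ (D.out G),
        Integrable (fun z => q s z b (D.xPart r) * inputDensity D μ M s r z b) (ref μ D.Z) ∧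
        ((outputKernel D M s b).rnDeriv (ref μ (D.out G)) r).toReal =
          ∫ z, q s z b (D.xPart r) * inputDensity D μ M s r z b ∂ ref μ D.Z) ∧
    (∀ {𝒰' : υ → Type u} [∀ j, MeasurableSpace (𝒰' j)] [∀ j, StandardBorelSpace (𝒰' j)]
      (η' : ∀ j, Measure (𝒰' j)) [∀ j, SigmaFinite (η' j)]
      {Ω' : Type*} [MeasurableSpace Ω'] (M' : NPSEM G 𝒳 𝒰' Ω') (Us' : Finset υ),
      (∀ s, HasJointDensity μ η' M' D.S s) →
      TbfConditions D μ η' M' Us' →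
      SufficientlyIntegrable D μ η' M' Us' q →
      (∀ s, M'.kernel D.R D.S s = M.kernel D.R D.S s) →
      ∀ s, ∀ᵐ b ∂ μ D.B, outputKernel D M' s b = outputKernel D M s b) := by
  refine ⟨fun s => outputKernel_density (hdens s) hcond hq hint, ?_⟩
  intro 𝒰' _ _ η' _ Ω' _ M' Us' hdens' hcond' hint' hker s
  have h1 := outputKernel_density (hdens s) hcond hq hint
  -- The same `q` is a bridge function in the second model, so both output kernels receive the same
  -- density formula, evaluated at the common input density.
  have h2 := outputKernel_density (hdens' s) hcond' (hq.of_kernel_eq hker) hint'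
  have := M.isProb
  have := M'.isProb
  rw [inputDensity_eq_of_kernel_eq (hker s)] at h2
  filter_upwards [h1, h2] with b hb hb'
  have : IsFiniteMeasure (outputKernel D M s b) := inferInstanceAs (IsFiniteMeasure (M.P.map _))
  have : IsFiniteMeasure (outputKernel D M' s b) :=
    inferInstanceAs (IsFiniteMeasure (M'.P.map _))
  refine eq_of_rnDeriv_toReal_ae_eq hb'.1 hb.1 ?_
  filter_upwards [hb.2, hb'.2] with r hr hr'
  rw [hr.2, hr'.2]
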